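/- **Setting.** Let $\epsilon = 2^{-j}$ with $j \ge 0$ an integer, and let $G$ be a simple graph with vertex set $V$, $|V| = n \ge 1$. The algorithm knows $V$ and $\epsilon$ and has access to $E(G)$ only through passes over a stream; in each pass every edge is presented exactly once, in an arbitrary order (which may differ from pass to pass) and with its ends in an arbitrary order. An edge $\{u,v\}$ that is read is treated as the two arcs $(u,v)$, $(v,u)$, one after the other. **Terms.** $M$ is the current matching; a vertex is free if no edge of $M$ is incident to it. Each matched arc $a$ has a label $\ell(a) \in \mathbb{N}$. Each free vertex $\alpha$ that is not removed has a structure $S_\alpha$: a vertex set, a set of arcs of $G$ (together the graph $G_\alpha$), a laminar set $\Omega_\alpha$ of blossoms $B$ with edge sets $E_B$, and a working vertex (a vertex of $T'_\alpha$, or none). The structures are vertex-disjoint. $T'_\alpha$ is obtained from $G_\alpha$ by contracting each maximal blossom of $\Omega_\alpha$; it is a tree rooted at the blossom of $\alpha$, and an arc of $G_\alpha$ that joins two maximal blossoms goes from parent to child. A vertex of $T'_\alpha$ is outer if its depth is even and inner otherwise. $\Omega(v)$ is the maximal blossom containing $v$, or $\{v\}$ if $v$ is in no structure (unvisited). **Parameters.**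 $\ell_{\max} = 3/\epsilon$; and for a scale $h$, $\mathsf{limit}_h = 6/h+1$, $\tau_{\max}(h) = 72/(h\epsilon)$, $t_{\max}(h) = 144/(h\epsilon)$. **Algorithm 1.** In one pass compute a greedy maximal matching $M$. For each scale $h = \frac12, \frac14, \dots, \frac{\epsilon^2}{64}$ execute $t_{\max}(h)$ phases. A phase sets $\mathcal P = \emptyset$, sets all labels to $\ell_{\max}+1$, sets $S_\alpha$ for each free $\alpha$ to the single vertex $\alpha$ with working vertex $\{\alpha\}$, executes $\tau_{\max}(h)$ pass-bundles, and finally restores all removed vertices, replaces $M$ by its symmetric difference with the paths of $\mathcal P$, and discards everything else. A pass-bundle does the following. 1. Mark each structure not modified, and mark it on hold if and only if it has at least $\mathsf{limit}_h$ vertices. 2. *Extend* (one pass). For each arc $g=(u,v)$ read: ignore $g$ if $u$ or $v$ is removed, if $\Omega(u)=\Omega(v)$, if $\Omega(u)$ is not a working vertex, if $g$ is matched, or if the structure of $u$ is modified or on hold. Otherwise, if $\Omega(v)$ is outer, *contract* along $g$ when $u,v$ are in the same structure and *augment* along $g$ when they are not. If $\Omega(v)$ is inner or unvisited, let $a=(v,t)$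 be the matched arc with tail $v$, and let $d$ be $0$ if $\Omega(u)$ contains a free vertex and the label of the matched arc entering $\Omega(u)$ otherwise; if $d+1<\ell(a)$, *overtake* $a$ through $g$ with the new label $d+1$. 3. *Collect* (one pass): store for each $\alpha$ the set $A_\alpha$ of the arcs of $G$ with both ends in $S_\alpha$. Then, while some $(u,v) \in A_\alpha$ has $\Omega(u)$ equal to the working vertex of $S_\alpha$ and $\Omega(v)\ne\Omega(u)$ outer, contract along such an arc (any choice). Afterwards discard the sets $A_\alpha$. 4. *Augment scan* (one pass): augment along each arc read that joins outer vertices of different structures. 5. *Backtrack*: in each structure that is neither on hold nor modified and has a working vertex $w$, the working vertex becomes the grandparent of $w$ in the tree, or none if $w$ is the root. *Contract* along $g=(u,v)$: add $g$ to $G_\alpha$; add to $\Omega_\alpha$ the blossom $B$ formed by the cycle that $g$ closes in $T'_\alpha$ ($E_B$ consists of the edge sets of the blossoms on the cycle and the edges of the cycle); set the labels of all matched arcs inside $B$ to $0$; make $B$ the working vertex. *Augment* along $g = (u,v)$, with $u \in S_\alpha$, $v \in S_\beta$: add to $\mathcal P$ an augmenting path from $\alpha$ to $\beta$ obtained from the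 path of $T'_\alpha$ from the root to $\Omega(u)$, the arc $g$, and the path of $T'_\beta$ from $\Omega(v)$ to the root, by replacing each blossom $B$ on it by a path in $E_B$ (any choice); remove $S_\alpha$, $S_\beta$ and all their vertices until the end of the phase. *Overtake* $a=(v,t)$ through $g=(u,v)$, $u \in S_\alpha$: if $v$ is unvisited, add $g$, $a$, and the trivial blossoms $\{v\},\{t\}$ to $S_\alpha$. Otherwise $v$ is an inner vertex of some $S_\beta$; delete the arc of $G_\beta$ from the parent of $\{v\}$ to $v$, add $g$ to $G_\alpha$, and, if $\beta\neq\alpha$, move the subtree of $v$ (vertices, arcs and blossoms) from $S_\beta$ to $S_\alpha$. The working vertex of $S_\alpha$ becomes $\Omega(t)$, except that if $\beta \ne \alpha$ and the working vertex of $S_\beta$ was in the subtree of $\Omega(t)$, then it becomes that vertex, and the working vertex of $S_\beta$ becomes the former parent of $\{v\}$. The structures changed by contract and overtake are marked modified. **Cost.** The number of passes is the number of passes begun, summed over all scales and phases. The space at a moment is the number of words that store the whole memory: the program point, the loop counters, the marks, $M$, the labels, all structures (each vertex set and edge set of each blossom being listed explicitly), the removed vertices, $\mathcal P$ and the sets $A_\alpha$.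 A word holds the name of a vertex, a label, a counter, a mark, or the size of a stored set or list; an arc or edge takes two words. **Lemma.** There is an absolute constant $C>0$ such that for all $\epsilon$ and $G$ as above and all orders of the stream and all choices, Algorithm 1 terminates (no execution is infinite, and none gets stuck before the algorithm has finished), and at every moment of the execution: * at most $C/\epsilon^6$ passes have been made; * the memory occupies at most $C n/\epsilon^6$ words, and the labels and loop counters are at most $C/\epsilon^3$; * in the scale $h$ every structure has at most $C/(h\epsilon)$ vertices. -/

import Mathlib

/-!
A multi-pass streaming algorithm for approximate maximum matching, written as a transition
system.  The approximation parameter is `ε = 2 ^ (-j)` and the scale is `h = 2 ^ (-i)`.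
The vertices of the contracted graph are represented by sets of vertices of the input graph
(a root blossom is represented by its vertex set, a vertex in no structure by its singleton).
-/

namespace EpsMM

noncomputable section

open scoped Classical

/-! ### Parameters -/

/-- The maximum label of a visited matched arc, `3 / ε`. -/
def ellMax (j : ℕ) : ℕ := 3 * 2 ^ j

/-- The index of the last scale: `ε ^ 2 / 64 = 2 ^ (-(2 * j + 6))`. -/
def lastScale (j : ℕ) : ℕ := 2 * j + 6

/-- A structure with at least `6 / h + 1` vertices is put on hold. -/
def limit (i : ℕ) : ℕ := 6 * 2 ^ i + 1

/-- The number of pass-bundles of a phase, `72 / (h * ε)`. -/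
def tauMax (j i : ℕ) : ℕ := 72 * 2 ^ i * 2 ^ j

/-- The number of phases of a scale, `144 / (h * ε)`. -/
def tMax (j i : ℕ) : ℕ := 144 * 2 ^ i * 2 ^ j

/-! ### Structures of free vertices -/

/-- A stored blossom: its vertex set `B` and its edge set `E_B`. -/
structure Blossom (V : Type*) where
  verts : Finset V
  edges : Finset (Sym2 V)

/-- The trivial blossom of a vertex. -/
def Blossom.trivial {V : Type*} (v : V) : Blossom V := ⟨{v}, ∅⟩

/-- The structure of a free vertex `root`: the subgraph with vertex set `verts` and arc set
`arcs`, its set of blossoms, its working vertex (a vertex of the contracted graph, or nothing),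
and the two marks. -/
structure Struct (V : Type*) where
  root : V
  verts : Finset V
  arcs : Finset (V × V)
  blossoms : Finset (Blossom V)
  working : Option (Finset V)
  onHold : Bool
  modified : Bool

namespace Struct

variable {V : Type*}

/-- The one-vertex structure. -/
def single (α : V) : Struct V where
  root := α
  verts := {α}
  arcs := ∅
  blossoms := {Blossom.trivial α}
  working := some {α}
  onHold := false
  modified := false

/-- The root blossom that contains `v`.  As the blossoms form a laminar family, it is
the union of the blossoms that contain `v`. -/
def top (S : Struct V) (v : V) : Finset V :=
  (S.blossoms.filter fun b => v ∈ b.verts).sup Blossom.verts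

/-- `p` is the parent of `c` in the contracted tree: arcs of the structure that are not inside
a root blossom go from a parent to its child. -/
def Child (S : Struct V) (p c : Finset V) : Prop :=
  p ≠ c ∧ ∃ e ∈ S.arcs, S.top e.1 = p ∧ S.top e.2 = c

/-- `a` is `c` or an ancestor of `c` in the contracted tree. -/
def Anc (S : Struct V) (a c : Finset V) : Prop := Relation.ReflTransGen S.Child a c

/-- `x` is an outer vertex of the contracted tree: it is reached from the root by a path
of even length. -/
def Outer (S : Struct V) (x : Finset V) : Prop :=
  Relation.ReflTransGen (fun a b => ∃ c, S.Child a c ∧ S.Child c b) (S.top S.root) x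

/-- The parent of `c` in the contracted tree. -/
def parent (S : Struct V) (c : Finset V) : Option (Finset V) :=
  if h : ∃ p, S.Child p c then some h.choose else none

/-- `l` is the path from the root of the contracted tree down to `x`. -/
def IsRootPath (S : Struct V) (l : List (Finset V)) (x : Finset V) : Prop :=
  l.head? = some (S.top S.root) ∧ l.getLast? = some x ∧ l.IsChain S.Child

/-! Contraction of the blossom that the arc `g` closes -/

/-- The vertices of the unique cycle that the arc `g` closes in the contracted tree: those on
the tree paths from the lowest common ancestor of the two ends of `g` to these ends. -/
def cycle [Fintype V] (S : Struct V) (g : V × V) : Finset (Finset V) :=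
  Finset.univ.filter fun x =>
    (S.Anc x (S.top g.1) ∨ S.Anc x (S.top g.2)) ∧
      ∀ c, S.Anc c (S.top g.1) → S.Anc c (S.top g.2) → S.Anc c x

/-- The blossom that the arc `g` closes: the union of the blossoms on the cycle, with the edges
of these blossoms and the edges of the cycle. -/
def newBlossom [Fintype V] (S : Struct V) (g : V × V) : Blossom V where
  verts := (S.cycle g).sup id
  edges :=
    (S.blossoms.filter fun b => ∃ x ∈ S.cycle g, b.verts ⊆ x).sup Blossom.edges ∪
      (S.arcs.filter fun e =>
        S.top e.1 ≠ S.top e.2 ∧ S.top e.1 ∈ S.cycle g ∧ S.top e.2 ∈ S.cycle g).image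
          (fun e => s(e.1, e.2)) ∪ {s(g.1, g.2)}

/-- The structure after contracting along the arc `g`. -/
def contract [Fintype V] (S : Struct V) (g : V × V) : Struct V :=
  { S with
    arcs := insert g S.arcs
    blossoms := insert (S.newBlossom g) S.blossoms
    working := some (S.newBlossom g).verts
    modified := true }

/-! Overtaking the matched arc `(v, t)` through the unmatched arc `(u, v)` -/

/-- The arcs that join the parent of `v` to `v`, where `v` is an inner vertex
(there is exactly one). -/
def parentArcs (S : Struct V) (v : V) : Finset (V × V) :=
  S.arcs.filter fun e => e.2 = v ∧ S.top e.1 ≠ S.top v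

/-- The vertices that lie in the subtree of `v`. -/
def subtree (S : Struct V) (v : V) : Finset V :=
  S.verts.filter fun x => S.Anc (S.top v) (S.top x)

/-- Case 1: `(v, t)` is in no structure. -/
def addArc (S : Struct V) (u v t : V) : Struct V :=
  { S with
    verts := S.verts ∪ {v, t}
    arcs := S.arcs ∪ {(u, v), (v, t)}
    blossoms := S.blossoms ∪ {Blossom.trivial v, Blossom.trivial t}
    working := some {t}
    modified := true }

/-- Case 2.1: `(v, t)` is in the structure of `u`. -/
def reroute (S : Struct V) (u v t : V) : Struct V :=
  { S with
    arcs := (S.arcs \ S.parentArcs v) ∪ {(u, v)}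
    working := some (S.top t)
    modified := true }

/-- The working vertex of `S` lies in the subtree of `t`. -/
def WorksUnder (S : Struct V) (t : V) : Prop := ∃ w, S.working = some w ∧ S.Anc (S.top t) w

/-- Case 2.2, the structure `T` of `v`, which loses the subtree of `v`. -/
def lose (T : Struct V) (v t : V) : Struct V :=
  { T with
    verts := T.verts \ T.subtree v
    arcs := (T.arcs \ T.parentArcs v).filter fun e => ¬ (e.1 ∈ T.subtree v ∧ e.2 ∈ T.subtree v)
    blossoms := T.blossoms.filter fun b => ¬ b.verts ⊆ T.subtree v
    working := if T.WorksUnder t then T.parent (T.top v) else T.working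
    modified := true }

/-- Case 2.2, the structure `S` of `u`, which receives the subtree of `v` from `T`. -/
def gain (S T : Struct V) (u v t : V) : Struct V :=
  { S with
    verts := S.verts ∪ T.subtree v
    arcs := S.arcs ∪ {(u, v)} ∪ T.arcs.filter fun e => e.1 ∈ T.subtree v ∧ e.2 ∈ T.subtree v
    blossoms := S.blossoms ∪ T.blossoms.filter fun b => b.verts ⊆ T.subtree v
    working := if T.WorksUnder t then T.working else some (T.top t)
    modified := true }

/-- Marking at the beginning of a pass-bundle of the scale `i`. -/
def mark (i : ℕ) (S : Struct V) : Struct V :=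
  { S with onHold := decide (limit i ≤ S.verts.card), modified := false }

/-- The backtracking step of a structure that is neither on hold nor modified. -/
def backtrack (S : Struct V) : Struct V :=
  if S.onHold = true ∨ S.modified = true then S
  else
    match S.working with
    | none => S
    | some w =>
      { S with working := if w = S.top S.root then none else (S.parent w).bind S.parent }

/-- The number of words that store the structure: every vertex takes one word, every arc and
every edge two, every mark one; each of the sets, and each vertex set and edge set of a blossom,
takes one more for its size. -/
def words (S : Struct V) : ℕ :=
  1 + (1 + S.verts.card) + (1 + 2 * S.arcs.card) +
    (1 + ∑ b ∈ S.blossoms, (2 + b.verts.card + 2 * b.edges.card)) +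
    (1 + (S.working.getD ∅).card) + 2

end Struct

/-! ### The memory of the algorithm -/

/-- The point of the program at which the execution is. -/
inductive Point
  | greedy
  | phaseBegin
  | bundleBegin
  | extend
  | collect
  | contracting
  | augmenting
  | backtracking
  | phaseEnd
  | finished

/-- The points at which the algorithm makes a pass over the stream. -/
def Point.UsesPass : Point → Prop
  | .greedy | .extend | .collect | .augmenting => True
  | _ => False

/-- The memory: the program point, the loop counters (`scale = i` means `h = 2 ^ (-i)`; `phase`
and `bundle` count the completed phases of the scale and the pass-bundles begun in the phase), the
matching, the labels (`label v` is the label of the matched arc with tail `v`), the structures of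
the free vertices that are not removed, the removed vertices, the augmenting paths found in the
phase, and the arcs collected for each structure. -/
structure Mem (V : Type*) where
  point : Point
  scale : ℕ
  phase : ℕ
  bundle : ℕ
  matching : Finset (Sym2 V)
  label : V → ℕ
  str : V → Option (Struct V)
  removed : Finset V
  paths : List (List V)
  collected : V → Finset (V × V)

/-- The edges of a path that is given by its list of vertices. -/
def pathEdges {V : Type*} (P : List V) : Finset (Sym2 V) :=
  ((P.zip P.tail).map fun e => s(e.1, e.2)).toFinset

namespace Mem

variable {V : Type*} [Fintype V]

/-- The number of words that the memory occupies: one for the program point and for each counter;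
two for each matched edge; one label for each vertex; the words of the structures, with one
more for each vertex; one for each removed vertex; one for each vertex of a stored path; two for
each collected arc; and one for the size of each set or list. -/
def words (m : Mem V) : ℕ :=
  4 + (1 + 2 * m.matching.card) + Fintype.card V +
    (∑ α, (1 + (m.str α).elim 0 Struct.words)) + (1 + m.removed.card) +
    (1 + (m.paths.map fun P => 1 + P.length).sum) +
    ∑ α, (1 + 2 * (m.collected α).card)

/-- The largest number, other than the name of a vertex or the size of a stored set,
that is stored in a word. -/
def maxNumber (m : Mem V) : ℕ :=
  max (max m.scale m.phase) (max m.bundle (Finset.univ.sup m.label))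

/-- The memory at the beginning. -/
def start : Mem V where
  point := .greedy
  scale := 1
  phase := 0
  bundle := 0
  matching := ∅
  label := fun _ => 0
  str := fun _ => none
  removed := ∅
  paths := []
  collected := fun _ => ∅

/-- `v` is incident to no matched edge. -/
def Free (m : Mem V) (v : V) : Prop := ∀ e ∈ m.matching, v ∉ e

/-- The other end of the matched edge at `v` (used only for matched vertices). -/
def mate (m : Mem V) (v : V) : V :=
  if h : ∃ t, s(v, t) ∈ m.matching then h.choose else v

/-- The structure that contains `v`, if there is one (the structures are disjoint). -/
def structOf (m : Mem V) (v : V) : Option (Struct V) :=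
  if h : ∃ S, ∃ α, m.str α = some S ∧ v ∈ S.verts then some h.choose else none

/-- The root blossom that contains `v`; a vertex in no structure is a trivial blossom. -/
def top (m : Mem V) (v : V) : Finset V :=
  match m.structOf v with
  | none => {v}
  | some S => S.top v

/-- The last label on the active path: zero if the root blossom of `u` contains a free vertex,
and the label of the (unique) matched arc of the contracted graph that enters it otherwise. -/
def distance (m : Mem V) (u : V) : ℕ :=
  if ∃ α ∈ m.top u, m.Free α then 0
  else (Finset.univ.filter fun x =>
    x ∉ m.top u ∧ ∃ y ∈ m.top u, s(x, y) ∈ m.matching).sup m.label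

/-! The three basic operations -/

/-- Contract the blossom that the arc `g` closes in its structure. -/
def contract (m : Mem V) (g : V × V) : Mem V :=
  { m with
    str := fun α => (m.str α).map fun S => if g.1 ∈ S.verts then S.contract g else S
    label := fun x =>
      if ∃ S, m.structOf g.1 = some S ∧
          ∃ y, s(x, y) ∈ m.matching ∧ x ∈ (S.newBlossom g).verts ∧ y ∈ (S.newBlossom g).verts
      then 0 else m.label x }

/-- The arc `g = (u, v)` overtakes the matched arc `(v, t)`, whose label becomes `k`. -/
def overtake (m : Mem V) (g : V × V) (k : ℕ) : Mem V :=
  { m with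
    label := Function.update m.label g.2 k
    str := fun α => (m.str α).map fun S =>
      if g.1 ∈ S.verts then
        if g.2 ∈ S.verts then S.reroute g.1 g.2 (m.mate g.2)
        else
          match m.structOf g.2 with
          | none => S.addArc g.1 g.2 (m.mate g.2)
          | some T => S.gain T g.1 g.2 (m.mate g.2)
      else if g.2 ∈ S.verts then S.lose g.2 (m.mate g.2)
      else S }

/-- `P` is an augmenting path that is obtained from the path
`root of S - ⋯ - Ω(u) - Ω(v) - ⋯ - root of T` of the contracted graph, where `g = (u, v)`, by
replacing each blossom on it by a path that uses edges of the blossom only. -/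
def IsExpansion (m : Mem V) (S T : Struct V) (g : V × V) (P : List V) : Prop :=
  P.head? = some S.root ∧ P.getLast? = some T.root ∧ P.Nodup ∧
  (∀ (k : ℕ) (hk : k + 1 < P.length), s(P[k], P[k + 1]) ∈ m.matching ↔ Odd k) ∧
  (∀ e ∈ pathEdges P, e = s(g.1, g.2) ∨ ∃ a ∈ S.arcs ∪ T.arcs, e = s(a.1, a.2)) ∧
  ∃ (p q : List (Finset V)) (segs : List (List V)),
    S.IsRootPath p (S.top g.1) ∧ T.IsRootPath q (T.top g.2) ∧ P = segs.flatten ∧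
    List.Forall₂ (fun B seg => seg ≠ [] ∧ (∀ x ∈ seg, x ∈ B) ∧
      ∀ e ∈ pathEdges seg, ∃ b ∈ S.blossoms ∪ T.blossoms, b.verts = B ∧ e ∈ b.edges)
      (p ++ q.reverse) segs

/-- Record an augmenting path through the arc `g`, which joins outer vertices of two
structures, and remove these structures.  (An expansion always exists, since any vertex
of a blossom is reached from its base by an even-length alternating path in the blossom;
the second alternative only keeps the operation total.) -/
def Augment (m : Mem V) (g : V × V) (m' : Mem V) : Prop :=
  ∃ S T, m.structOf g.1 = some S ∧ m.structOf g.2 = some T ∧ ∃ ps,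
    ((∃ P, m.IsExpansion S T g P ∧ ps = P :: m.paths) ∨
      ((¬ ∃ P, m.IsExpansion S T g P) ∧ ps = m.paths)) ∧
    m' = { m with
      paths := ps
      removed := m.removed ∪ (S.verts ∪ T.verts)
      str := fun α => if α = S.root ∨ α = T.root then none else m.str α }

/-! What the algorithm does with an arc of the stream -/

/-- Greedy maximal matching. -/
def greedyArc (m : Mem V) (g : V × V) : Mem V :=
  if m.Free g.1 ∧ m.Free g.2 then { m with matching := insert s(g.1, g.2) m.matching } else m

/-- The root blossom of `v` is an outer vertex of the structure of `v`. -/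
def Outer (m : Mem V) (v : V) : Prop := ∃ S, m.structOf v = some S ∧ S.Outer (S.top v)

/-- `u` and `v` are in the same structure. -/
def SameStruct (m : Mem V) (u v : V) : Prop := ∃ S, m.structOf u = some S ∧ v ∈ S.verts

/-- The arc `g` is read while the active paths are extended. -/
def ExtendArc (m : Mem V) (g : V × V) (m' : Mem V) : Prop :=
  if g.1 ∈ m.removed ∨ g.2 ∈ m.removed then m' = m
  else if m.top g.1 = m.top g.2 ∨
      (¬ ∃ S, m.structOf g.1 = some S ∧ S.working = some (S.top g.1)) ∨
      s(g.1, g.2) ∈ m.matching then m' = m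
  else if ∃ S, m.structOf g.1 = some S ∧ (S.modified = true ∨ S.onHold = true) then m' = m
  else if m.Outer g.2 then
    if m.SameStruct g.1 g.2 then m' = m.contract g else m.Augment g m'
  else if m.distance g.1 + 1 < m.label g.2 then m' = m.overtake g (m.distance g.1 + 1)
  else m' = m

/-- The arc `g` is read while the arcs inside each structure are collected. -/
def collectArc (m : Mem V) (g : V × V) : Mem V :=
  { m with
    collected := fun α =>
      if ∃ S, m.str α = some S ∧ g.1 ∈ S.verts ∧ g.2 ∈ S.verts then insert g (m.collected α)
      else m.collected α }

/-- The arc `g` is read in the search for arcs between outer vertices of different structures. -/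
def AugmentArc (m : Mem V) (g : V × V) (m' : Mem V) : Prop :=
  if m.Outer g.1 ∧ m.Outer g.2 ∧ ¬ m.SameStruct g.1 g.2 then m.Augment g m' else m' = m

/-- The effect of reading the arc `g`. -/
def Read (m : Mem V) (g : V × V) (m' : Mem V) : Prop :=
  match m.point with
  | .greedy => m' = m.greedyArc g
  | .extend => m.ExtendArc g m'
  | .collect => m' = m.collectArc g
  | .augmenting => m.AugmentArc g m'
  | _ => False

/-- The memory after the end of a pass. -/
def endPass (m : Mem V) : Mem V :=
  match m.point with
  | .greedy => { m with point := .phaseBegin }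
  | .extend => { m with point := .collect, collected := fun _ => ∅ }
  | .collect => { m with point := .contracting }
  | .augmenting => { m with point := .backtracking }
  | _ => m

/-! Steps between the passes -/

/-- The beginning of a phase. -/
def beginPhase (j : ℕ) (m : Mem V) : Mem V :=
  { m with
    point := .bundleBegin
    bundle := 0
    label := fun _ => ellMax j + 1
    str := fun α => if m.Free α then some (Struct.single α) else none
    removed := ∅
    paths := []
    collected := fun _ => ∅ }

/-- The head of the loop over the pass-bundles. -/
def beginBundle (j : ℕ) (m : Mem V) : Mem V :=
  if m.bundle < tauMax j m.scale then
    { m with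
      point := .extend
      bundle := m.bundle + 1
      str := fun α => (m.str α).map (Struct.mark m.scale) }
  else { m with point := .phaseEnd }

/-- The arc `g`, collected for the structure of `α`, joins the working vertex of the structure
to another outer vertex of it. -/
def Contractible (m : Mem V) (α : V) (g : V × V) : Prop :=
  g ∈ m.collected α ∧ ∃ S, m.str α = some S ∧ S.working = some (S.top g.1) ∧
    S.top g.2 ≠ S.top g.1 ∧ S.Outer (S.top g.2)

/-- One iteration of the contraction loop: contract along any suitable collected arc,
and leave the loop if there is none. -/
def ContractStep (m m' : Mem V) : Prop :=
  (∃ α g, m.Contractible α g ∧ m' = m.contract g) ∨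
    ((¬ ∃ α g, m.Contractible α g) ∧
      m' = { m with point := .augmenting, collected := fun _ => ∅ })

/-- Backtrack the stuck structures. -/
def backtrackAll (m : Mem V) : Mem V :=
  { m with point := .bundleBegin, str := fun α => (m.str α).map Struct.backtrack }

/-- The end of a phase: augment the matching along the paths found, restore all removed vertices,
forget the structures, and go to the next phase or, after the last phase, the next scale. -/
def endPhase (j : ℕ) (m : Mem V) : Mem V :=
  { m with
    matching := symmDiff m.matching
      (Finset.univ.filter fun e => ∃ P ∈ m.paths, e ∈ pathEdges P)
    str := fun _ => none
    removed := ∅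
    paths := []
    point :=
      if m.phase + 1 < tMax j m.scale ∨ m.scale < lastScale j then .phaseBegin else .finished
    phase := if m.phase + 1 < tMax j m.scale then m.phase + 1 else 0
    scale :=
      if m.phase + 1 < tMax j m.scale then m.scale
      else if m.scale < lastScale j then m.scale + 1 else m.scale }

/-- The steps that do not read the stream. -/
def Compute (j : ℕ) (m m' : Mem V) : Prop :=
  match m.point with
  | .phaseBegin => m' = m.beginPhase j
  | .bundleBegin => m' = m.beginBundle j
  | .contracting => m.ContractStep m'
  | .backtracking => m' = m.backtrackAll
  | .phaseEnd => m' = m.endPhase j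
  | _ => False

end Mem

/-! ### Executions -/

/-- A configuration: the memory, the number of passes begun, and the part of the current pass
that has not been read yet (`none` outside the passes).  Only the memory is stored
by the algorithm. -/
structure Config (V : Type*) where
  mem : Mem V
  passes : ℕ
  stream : Option (List (V × V))

/-- `l` lists every edge of `G` exactly once, in some order, each with its ends in some order. -/
def IsEdgeStream {V : Type*} (G : SimpleGraph V) (l : List (V × V)) : Prop :=
  (l.map fun e => s(e.1, e.2)).Nodup ∧ ∀ e, e ∈ l.map (fun e => s(e.1, e.2)) ↔ e ∈ G.edgeSet

/-- An edge that is read from the stream is treated as its two arcs. -/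
def arcsOf {V : Type*} (l : List (V × V)) : List (V × V) := l.flatMap fun e => [e, e.swap]

/-- The initial configuration. -/
def startConfig (V : Type*) [Fintype V] : Config V := ⟨Mem.start, 0, none⟩

/-- One step of an execution on the input graph `G`, which is accessed only through the passes.
In each pass the edges are presented in an arbitrary order. -/
inductive Step {V : Type*} [Fintype V] (G : SimpleGraph V) (j : ℕ) : Config V → Config V → Prop
  | beginPass (m : Mem V) (k : ℕ) (l : List (V × V)) (hm : m.point.UsesPass)
      (hl : IsEdgeStream G l) : Step G j ⟨m, k, none⟩ ⟨m, k + 1, some (arcsOf l)⟩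
  | read (m m' : Mem V) (k : ℕ) (g : V × V) (l : List (V × V)) (h : m.Read g m') :
      Step G j ⟨m, k, some (g :: l)⟩ ⟨m', k, some l⟩
  | endPass (m : Mem V) (k : ℕ) : Step G j ⟨m, k, some []⟩ ⟨m.endPass, k, none⟩
  | compute (m m' : Mem V) (k : ℕ) (h : m.Compute j m') : Step G j ⟨m, k, none⟩ ⟨m', k, none⟩

/-- The configurations that occur in the executions on `G` with `ε = 2 ^ (-j)`. -/
def Reachable {V : Type*} [Fintype V] (G : SimpleGraph V) (j : ℕ) (c : Config V) : Prop :=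
  Relation.ReflTransGen (Step G j) (startConfig V) c

end

end EpsMM

/-! All bounds come from an invariant that every step preserves, and its delicate part is the size
of a structure. Write K for the maximal label and L for the limit of the scale.

The shape of a contracted tree can be read off the labels. A matched arc that has been overtaken and
is not inside a blossom has a label between 1 and K; label 0 marks an arc that was contracted, and K
+ 1 an arc not overtaken in this phase. Arcs between nodes are either matched and leave an inner
vertex, or unmatched and enter one, so parity of depth agrees with this reading of the labels
(`Struct.Good.outer_iff`). Labels of inner vertices strictly increase downwards (`mono`), and the
subtree of an inner vertex w has at most L(K + 2 - l w) vertices (`size`).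

An overtake keeps `size` because the label drop pays for the vertices that are gained. The structure
S of u is neither on hold nor modified, so it has fewer than L vertices. If d is the last label on
the path to u, the overtaken arc of a visited v has label at least d + 2, so the subtree of v has at
most L(K - d) vertices. The inner ancestors of u have labels at most d, and now have at most L + L(K
- d) vertices below them. The same sum bounds S, whence the bound L(K + 2) = O(1/(hε)) on every
structure. If v lies in S itself, monotonicity shows that u is not below v, so rerouting closes no
cycle. An overtake is thus cutting a subtree, lowering the label of its root and hanging it
elsewhere (`good_cut`, `good_piece`, `lower_root`, `good_join`). Contraction (`good_contract`) only
turns inner vertices into outer ones, and augmenting only deletes structures. The stored paths are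
disjoint and alternating with free ends, so the matching remains a matching at the end of a phase
(`isMatching_symmDiff`).

The rest is counting. A contraction merges at least two nodes and adds one blossom, so a node with b
vertices contains at most 2b - 1 blossoms. Hence a structure with s vertices takes O(s^3) words. The
structures are disjoint, so all of them take O(n/(hε)^2) = O(n/ε^6) words, since h is at least
ε^2/64. A pass-bundle makes three passes and a scale has O(1/(hε)^2) bundles; this grows
geometrically with the scales, and the last one dominates. Termination is a lexicographic descent
(`rank`), in which the contraction loop is controlled by the number of blossoms, at most 2n.
Executions do not get stuck because every step has an outcome; `Augment` is total by its second
alternative, so no expansion has to be constructed. -/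

namespace EpsMM

open scoped Classical

/-! ### The invariant of a structure and the shape of its contracted tree -/

section Trees

variable {V : Type*}

/-- No loops, and no two edges with a common end. -/
def IsMatching (M : Finset (Sym2 V)) : Prop :=
  (∀ e ∈ M, ¬ e.IsDiag) ∧ ∀ e ∈ M, ∀ f ∈ M, ∀ v, v ∈ e → v ∈ f → e = f

/-- The tail of a matched arc that was overtaken and is not inside a blossom. -/
def Inner (K : ℕ) (l : V → ℕ) (v : V) : Prop := 1 ≤ l v ∧ l v ≤ K

theorem IsMatching.mate_eq {M : Finset (Sym2 V)} (hM : IsMatching M) {x y z : V}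
    (h1 : s(x, y) ∈ M) (h2 : s(x, z) ∈ M) : y = z := by
  rcases Sym2.eq_iff.1 (hM.2 _ h1 _ h2 x (by simp) (by simp)) with ⟨-, h⟩ | ⟨h, h'⟩
  · exact h
  · exact h'.trans h

theorem IsMatching.ne {M : Finset (Sym2 V)} (hM : IsMatching M) {x y : V}
    (h1 : s(x, y) ∈ M) : x ≠ y := by
  have := hM.1 _ h1
  simpa using this

namespace Struct

theorem mem_top {S : Struct V} {x y : V} :
    y ∈ S.top x ↔ ∃ b ∈ S.blossoms, x ∈ b.verts ∧ y ∈ b.verts := by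
  simp [top, Finset.mem_sup, and_assoc]

theorem mem_top_comm {S : Struct V} {x y : V} : y ∈ S.top x ↔ x ∈ S.top y := by
  simp only [mem_top, and_comm]

/-- The invariant of a structure, relative to the matching `M`, the maximal label `K`,
the size limit `L` and the labels `l`. -/
structure Good (M : Finset (Sym2 V)) (K L : ℕ) (l : V → ℕ) (S : Struct V) : Prop where
  root_mem : S.root ∈ S.verts
  arcs_mem : ∀ e ∈ S.arcs, e.1 ∈ S.verts ∧ e.2 ∈ S.verts
  blossom_sub : ∀ b ∈ S.blossoms, b.verts ⊆ S.verts
  blossom_nonempty : ∀ b ∈ S.blossoms, b.verts.Nonempty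
  blossom_edges : ∀ b ∈ S.blossoms, ∀ e ∈ b.edges, ∀ x ∈ e, x ∈ b.verts
  self_mem : ∀ x ∈ S.verts, x ∈ S.top x
  part : ∀ x ∈ S.verts, ∀ y ∈ S.top x, S.top y = S.top x
  uniq : ∀ p q c, S.Child p c → S.Child q c → p = q
  root_no_parent : ∀ p, ¬ S.Child p (S.top S.root)
  conn : ∀ x ∈ S.verts, S.Anc (S.top S.root) (S.top x)
  inner_top : ∀ x ∈ S.verts, Inner K l x → S.top x = {x}
  arc_type : ∀ e ∈ S.arcs, S.top e.1 ≠ S.top e.2 →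
    (s(e.1, e.2) ∈ M ∧ Inner K l e.1 ∧ ¬ Inner K l e.2) ∨
      (s(e.1, e.2) ∉ M ∧ ¬ Inner K l e.1 ∧ Inner K l e.2)
  mate : ∀ x ∈ S.verts, ∀ y, s(x, y) ∈ M → y ∈ S.verts ∧
    (S.top x = S.top y ∨ (Inner K l x ∧ ¬ Inner K l y ∧ (x, y) ∈ S.arcs) ∨
      (Inner K l y ∧ ¬ Inner K l x ∧ (y, x) ∈ S.arcs))
  mono : ∀ w ∈ S.verts, ∀ w' ∈ S.verts, Inner K l w → Inner K l w' →
    S.Anc (S.top w) (S.top w') → w = w' ∨ l w < l w'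
  -- The potential behind the size bound: each unit by which the label of w is lower permits L more
  -- vertices below w. Written additively to avoid truncated subtraction.
  size : ∀ w ∈ S.verts, Inner K l w → (S.subtree w).card + L * l w ≤ L * (K + 2)
  -- The usual bound 2b - 1 for a laminar family on b points, kept for each node so that it can be
  -- summed when nodes merge.
  count : ∀ x ∈ S.verts,
    (S.blossoms.filter fun b => b.verts ⊆ S.top x).card + 1 ≤ 2 * (S.top x).card

variable {M : Finset (Sym2 V)} {K L : ℕ} {l : V → ℕ} {S T P : Struct V}

theorem Good.congr (h : Good M K L l S) (h1 : T.root = S.root) (h2 : T.verts = S.verts)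
    (h3 : T.arcs = S.arcs) (h4 : T.blossoms = S.blossoms) : Good M K L l T := by
  cases S; cases T
  simp only at h1 h2 h3 h4
  subst h1 h2 h3 h4
  exact ⟨h.1, h.2, h.3, h.4, h.5, h.6, h.7, h.8, h.9, h.10, h.11, h.12, h.13, h.14, h.15, h.16⟩

theorem Good.congr_label (h : Good M K L l S) {l' : V → ℕ} (hl : ∀ x ∈ S.verts, l' x = l x) :
    Good M K L l' S := by
  have hi : ∀ x ∈ S.verts, (Inner K l' x ↔ Inner K l x) := fun x hx => by
    simp [Inner, hl x hx]
  refine ⟨h.1, h.2, h.3, h.4, h.5, h.6, h.7, h.8, h.9, h.10, ?_, ?_, ?_, ?_, ?_, h.16⟩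
  · intro x hx hix; exact h.inner_top x hx ((hi x hx).1 hix)
  · intro e he hne
    obtain ⟨a, b⟩ := h.arcs_mem e he
    rw [hi _ a, hi _ b]; exact h.arc_type e he hne
  · intro x hx y hxy
    obtain ⟨a, b⟩ := h.mate x hx y hxy
    rw [hi _ a, hi _ hx]; exact ⟨a, b⟩
  · intro w hw w' hw' i i' ha
    rw [hl _ hw, hl _ hw']
    exact h.mono w hw w' hw' ((hi _ hw).1 i) ((hi _ hw').1 i') ha
  · intro w hw i
    rw [hl _ hw]
    exact h.size w hw ((hi _ hw).1 i)

theorem Child.exists_arc {p c : Finset V} (h : S.Child p c) :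
    ∃ e ∈ S.arcs, S.top e.1 = p ∧ S.top e.2 = c ∧ S.top e.1 ≠ S.top e.2 := by
  obtain ⟨hne, e, he, h1, h2⟩ := h
  exact ⟨e, he, h1, h2, by rwa [h1, h2]⟩

theorem child_of_arc {e : V × V} (he : e ∈ S.arcs) (hne : S.top e.1 ≠ S.top e.2) :
    S.Child (S.top e.1) (S.top e.2) := ⟨hne, e, he, rfl, rfl⟩

namespace Good

theorem top_sub (h : Good M K L l S) (x : V) : S.top x ⊆ S.verts := by
  intro y hy
  obtain ⟨b, hb, -, hy⟩ := mem_top.1 hy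
  exact h.blossom_sub b hb hy

theorem mem_of_top_eq (h : Good M K L l S) {x y : V} (hy : y ∈ S.verts)
    (hxy : S.top x = S.top y) : x ∈ S.verts := by
  have : y ∈ S.top x := hxy ▸ h.self_mem y hy
  exact h.top_sub y (mem_top_comm.1 this)

theorem eq_of_inner (h : Good M K L l S) {x y : V} (hx : x ∈ S.verts) (hy : y ∈ S.verts)
    (hi : Inner K l y) (hxy : S.top x = S.top y) : x = y := by
  have := h.self_mem x hx
  rw [hxy, h.inner_top y hy hi] at this
  simpa using this

theorem inner_iff_of_top_eq (h : Good M K L l S) {x y : V} (hx : x ∈ S.verts) (hy : y ∈ S.verts)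
    (hxy : S.top x = S.top y) : Inner K l x ↔ Inner K l y := by
  constructor
  · intro hi; rwa [h.eq_of_inner hy hx hi hxy.symm]
  · intro hi; rwa [h.eq_of_inner hx hy hi hxy]

theorem node_of_anc (h : Good M K L l S) {a : Finset V} {x : V} (hx : x ∈ S.verts)
    (ha : S.Anc a (S.top x)) : ∃ y ∈ S.verts, a = S.top y := by
  rcases Relation.ReflTransGen.cases_head ha with rfl | ⟨b, hab, -⟩
  · exact ⟨x, hx, rfl⟩
  · obtain ⟨e, he, h1, -⟩ := hab.exists_arc
    exact ⟨e.1, (h.arcs_mem e he).1, h1.symm⟩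

theorem anc_parent (h : Good M K L l S) {a p c : Finset V} (ha : S.Anc a c) (hp : S.Child p c) :
    a = c ∨ S.Anc a p := by
  rcases Relation.ReflTransGen.cases_tail ha with rfl | ⟨b, hab, hbc⟩
  · exact Or.inl rfl
  · exact Or.inr (h.uniq _ _ _ hbc hp ▸ hab)

/-- Parents are unique, so a cycle through c also passes through the parent of c. Induction along
the path from the root to c moves the cycle up to the root, which has no parent. -/
theorem acyclic (h : Good M K L l S) {p c : Finset V} (hp : S.Child p c) : ¬ S.Anc c p := by
  obtain ⟨e, he, h1, h2, -⟩ := hp.exists_arc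
  have hc := h.conn e.2 (h.arcs_mem e he).2
  rw [h2] at hc
  clear h1 h2 he
  induction hc generalizing p with
  | refl => exact absurd hp (h.root_no_parent p)
  | @tail b c hb hbc ih =>
    intro hcp
    obtain rfl := h.uniq _ _ _ hp hbc
    rcases Relation.ReflTransGen.cases_tail hcp with rfl | ⟨q, hcq, hqp⟩
    · exact hp.1 rfl
    · exact ih hqp (Relation.ReflTransGen.head hp hcq)

theorem anc_antisymm (h : Good M K L l S) {a b : Finset V} (hab : S.Anc a b) (hba : S.Anc b a) :
    a = b := by
  rcases Relation.ReflTransGen.cases_tail hab with rfl | ⟨c, hac, hcb⟩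
  · rfl
  · exact absurd (hba.trans hac) (h.acyclic hcb)

/-- The matched arc is the only arc that leaves an inner vertex. -/
theorem child_of_inner (h : Good M K L l S) (hM : IsMatching M) {v t : V} (hv : v ∈ S.verts)
    (hi : Inner K l v) (ht : s(v, t) ∈ M) {c : Finset V} (hc : S.Child (S.top v) c) :
    c = S.top t := by
  obtain ⟨e, he, h1, h2, hne⟩ := hc.exists_arc
  obtain rfl := h.eq_of_inner (h.arcs_mem e he).1 hv hi h1
  rcases h.arc_type e he hne with ⟨hm, -⟩ | ⟨-, hn, -⟩
  · rw [← h2, hM.mate_eq hm ht]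
  · exact absurd hi hn

theorem anc_mate_of_inner (h : Good M K L l S) (hM : IsMatching M) {v t : V} (hv : v ∈ S.verts)
    (hi : Inner K l v) (ht : s(v, t) ∈ M) {c : Finset V} (hc : S.Anc (S.top v) c)
    (hne : S.top v ≠ c) : S.Anc (S.top t) c := by
  rcases Relation.ReflTransGen.cases_head hc with rfl | ⟨b, hb, hbc⟩
  · exact absurd rfl hne
  · rwa [← h.child_of_inner hM hv hi ht hb]

/-- An inner vertex is a node by itself, so its mate lies in another node, and of the alternatives
in `mate` only the outgoing arc is left. -/
theorem mate_of_inner (h : Good M K L l S) (hM : IsMatching M) {v t : V} (hv : v ∈ S.verts)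
    (hi : Inner K l v) (ht : s(v, t) ∈ M) :
    t ∈ S.verts ∧ ¬ Inner K l t ∧ (v, t) ∈ S.arcs ∧ S.Child (S.top v) (S.top t) := by
  obtain ⟨htv, h1⟩ := h.mate v hv t ht
  have hne : S.top v ≠ S.top t := fun heq =>
    hM.ne ht (h.eq_of_inner htv hv hi heq.symm).symm
  rcases h1 with h1 | ⟨-, h2, h3⟩ | ⟨-, h2, -⟩
  · exact absurd h1 hne
  · exact ⟨htv, h2, h3, child_of_arc h3 hne⟩
  · exact absurd hi h2

/-- The types of arcs alternate along every path from the root: an unmatched arc goes from outer to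
inner, a matched one from inner to outer. This replaces parity of depth by a condition on one label,
which survives surgery on the tree. -/
theorem outer_iff (h : Good M K L l S) (hr : ¬ Inner K l S.root) {x : V} (hx : x ∈ S.verts) :
    S.Outer (S.top x) ↔ ¬ Inner K l x := by
  constructor
  · intro ho
    have key : ∀ z, S.Outer z → ∀ x ∈ S.verts, S.top x = z → ¬ Inner K l x := by
      intro z hz
      induction hz with
      | refl =>
        intro x hx hxz
        rwa [h.inner_iff_of_top_eq hx h.root_mem hxz]
      | @tail a b _ hab ih =>
        obtain ⟨c, hac, hcb⟩ := hab
        intro x hx hxb hi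
        obtain ⟨f, hf, f1, f2, fne⟩ := hcb.exists_arc
        obtain ⟨e, he, e1, e2, ene⟩ := hac.exists_arc
        obtain rfl := h.eq_of_inner (h.arcs_mem f hf).2 hx hi (f2.trans hxb.symm)
        rcases h.arc_type f hf fne with ⟨-, -, hn⟩ | ⟨-, hn, -⟩
        · exact hn hi
        rcases h.arc_type e he ene with ⟨-, hn', -⟩ | ⟨-, -, hn'⟩
        · exact ih e.1 (h.arcs_mem e he).1 e1 hn'
        · exact hn ((h.inner_iff_of_top_eq (h.arcs_mem e he).2 (h.arcs_mem f hf).1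
            (e2.trans f1.symm)).1 hn')
    exact key _ ho x hx rfl
  -- Both kinds of nodes are treated in one induction: an inner node remembers its outer parent, so
  -- that its child is reached from there in two steps.
  · have key : ∀ z, S.Anc (S.top S.root) z → ∀ x ∈ S.verts, S.top x = z →
        (¬ Inner K l x → S.Outer z) ∧ (Inner K l x → ∃ p, S.Outer p ∧ S.Child p z) := by
      intro z hz
      induction hz with
      | refl =>
        intro x hx hxz
        refine ⟨fun _ => Relation.ReflTransGen.refl, fun hi => ?_⟩
        exact absurd ((h.inner_iff_of_top_eq hx h.root_mem hxz).1 hi) hr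
      | @tail p z _ hpz ih =>
        intro x hx hxz
        obtain ⟨e, he, e1, e2, ene⟩ := hpz.exists_arc
        have ih' := ih e.1 (h.arcs_mem e he).1 e1
        have hxe := h.inner_iff_of_top_eq hx (h.arcs_mem e he).2 (hxz.trans e2.symm)
        rw [hxe]
        rcases h.arc_type e he ene with ⟨-, h1, h2⟩ | ⟨-, h1, h2⟩
        · refine ⟨fun _ => ?_, fun h' => absurd h' h2⟩
          obtain ⟨q, hq, hqp⟩ := ih'.2 h1
          exact Relation.ReflTransGen.tail hq ⟨p, hqp, hpz⟩
        · exact ⟨fun h' => absurd h2 h', fun _ => ⟨p, ih'.1 h1, hpz⟩⟩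
    intro hi
    exact (key _ (h.conn x hx) x hx rfl).1 hi

theorem mem_subtree {x v : V} : x ∈ S.subtree v ↔ x ∈ S.verts ∧ S.Anc (S.top v) (S.top x) := by
  simp [subtree]

theorem mem_subtree_of_top_eq (h : Good M K L l S) {x y v : V} (hx : x ∈ S.subtree v)
    (hxy : S.top y = S.top x) : y ∈ S.subtree v := by
  rw [mem_subtree] at hx ⊢
  exact ⟨h.mem_of_top_eq hx.1 hxy, hxy ▸ hx.2⟩

theorem mem_subtree_of_child (h : Good M K L l S) {e : V × V} {v : V} (he : e ∈ S.arcs)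
    (hx : e.1 ∈ S.subtree v) : e.2 ∈ S.subtree v := by
  by_cases hne : S.top e.1 = S.top e.2
  · exact h.mem_subtree_of_top_eq hx hne.symm
  · rw [mem_subtree] at hx ⊢
    exact ⟨(h.arcs_mem e he).2, hx.2.tail (child_of_arc he hne)⟩

theorem self_mem_subtree {v : V} (hv : v ∈ S.verts) : v ∈ S.subtree v :=
  mem_subtree.2 ⟨hv, Relation.ReflTransGen.refl⟩

theorem mem_subtree_parent (h : Good M K L l S) {e : V × V} {v : V} (he : e ∈ S.arcs)
    (hx : e.2 ∈ S.subtree v) : e.1 ∈ S.subtree v ∨ (S.top v = S.top e.2 ∧ S.top e.1 ≠ S.top e.2) := by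
  by_cases hne : S.top e.1 = S.top e.2
  · exact Or.inl (h.mem_subtree_of_top_eq hx hne)
  · rw [mem_subtree] at hx ⊢
    rcases h.anc_parent hx.2 (child_of_arc he hne) with h1 | h1
    · exact Or.inr ⟨h1, hne⟩
    · exact Or.inl ⟨(h.arcs_mem e he).1, h1⟩

theorem top_sub_subtree (h : Good M K L l S) {x v : V} (hx : x ∈ S.subtree v) :
    S.top x ⊆ S.subtree v := fun _ hy =>
  h.mem_subtree_of_top_eq hx (h.part x (mem_subtree.1 hx).1 _ hy)

/-- The only arc between nodes that crosses into the subtree enters v, and an arc into an inner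
vertex is unmatched. So cutting at an inner vertex never separates a matched pair. -/
theorem mate_mem_subtree (h : Good M K L l S) {x y v : V} (hi : Inner K l v)
    (hx : x ∈ S.subtree v) (hxy : s(x, y) ∈ M) : y ∈ S.subtree v := by
  have hxv := (mem_subtree.1 hx).1
  obtain ⟨hy, h1 | ⟨-, -, h1⟩ | ⟨h2, h3, h1⟩⟩ := h.mate x hxv y hxy
  · exact h.mem_subtree_of_top_eq hx h1.symm
  · exact h.mem_subtree_of_child h1 hx
  · rcases h.mem_subtree_parent h1 hx with h4 | ⟨h4, h5⟩
    · exact h4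
    · have hv : v ∈ S.verts := h.mem_of_top_eq hxv h4
      exact absurd ((h.inner_iff_of_top_eq hv hxv h4).1 hi) h3

theorem subtree_card_le : (S.subtree v).card ≤ S.verts.card :=
  Finset.card_le_card (Finset.filter_subset _ _)

theorem anc_label_le {v w : V} (h : Good M K L l S) (hv : v ∈ S.verts) (hw : w ∈ S.verts)
    (hiv : Inner K l v) (hiw : Inner K l w) (ha : S.Anc (S.top v) (S.top w)) : l v ≤ l w := by
  rcases h.mono v hv w hw hiv hiw ha with rfl | h1
  · exact le_rfl
  · exact h1.le

end Good

end Struct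

end Trees

end EpsMM

namespace EpsMM

open scoped Classical

/-! ### Cutting off a subtree and hanging it below another vertex -/

section Surgery

variable {V : Type*}

namespace Struct

/-- The structure without the subtree of `v`. -/
noncomputable def cut (T : Struct V) (v : V) : Struct V :=
  { T with
    verts := T.verts \ T.subtree v
    arcs := (T.arcs \ T.parentArcs v).filter fun e => ¬ (e.1 ∈ T.subtree v ∧ e.2 ∈ T.subtree v)
    blossoms := T.blossoms.filter fun b => ¬ b.verts ⊆ T.subtree v }

/-- The subtree of `v` as a structure of its own. -/
noncomputable def piece (T : Struct V) (v : V) : Struct V :=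
  { T with
    root := v
    verts := T.subtree v
    arcs := T.arcs.filter fun e => e.1 ∈ T.subtree v ∧ e.2 ∈ T.subtree v
    blossoms := T.blossoms.filter fun b => b.verts ⊆ T.subtree v }

/-- The tree that consists of the arc `(v, t)`. -/
noncomputable def pair (v t : V) : Struct V where
  root := v
  verts := {v, t}
  arcs := {(v, t)}
  blossoms := {Blossom.trivial v, Blossom.trivial t}
  working := none
  onHold := false
  modified := false

/-- The tree obtained by hanging `P` below the vertex `u` of `S`. -/
noncomputable def join (S P : Struct V) (u : V) : Struct V :=
  { S with
    verts := S.verts ∪ P.verts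
    arcs := S.arcs ∪ {(u, P.root)} ∪ P.arcs
    blossoms := S.blossoms ∪ P.blossoms }

variable {M : Finset (Sym2 V)} {K L : ℕ} {l : V → ℕ} {S T P : Struct V} {u v t : V}

/-! ### Cutting off a subtree -/

section Cut

theorem top_cut {x : V} (hx : x ∉ T.subtree v) :
    (T.cut v).top x = T.top x := by
  ext y
  simp only [mem_top, cut, Finset.mem_filter]
  constructor
  · rintro ⟨b, ⟨hb, -⟩, h1⟩; exact ⟨b, hb, h1⟩
  · rintro ⟨b, hb, h1, h2⟩; exact ⟨b, ⟨hb, fun h3 => hx (h3 h1)⟩, h1, h2⟩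

/-- The arcs removed as parent arcs of v are exactly those that enter the subtree from outside, and
no arc leaves it. Hence each remaining arc has both ends on one side. -/
theorem Good.mem_cut_arcs (h : Good M K L l T) (hv : v ∈ T.verts) (hi : Inner K l v)
    {e : V × V} : e ∈ (T.cut v).arcs ↔ e ∈ T.arcs ∧ e.1 ∉ T.subtree v ∧ e.2 ∉ T.subtree v := by
  simp only [cut, parentArcs, Finset.mem_filter, Finset.mem_sdiff, not_and]
  constructor
  · rintro ⟨⟨he, h1⟩, h2⟩
    have h3 : e.1 ∉ T.subtree v := fun h3 => h2 h3 (h.mem_subtree_of_child he h3)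
    refine ⟨he, h3, fun h4 => ?_⟩
    rcases h.mem_subtree_parent he h4 with h5 | ⟨h5, h6⟩
    · exact h3 h5
    · have := h.eq_of_inner (h.arcs_mem e he).2 hv hi h5.symm
      exact h1 he this (h5 ▸ h6)
  · rintro ⟨he, h1, h2⟩
    exact ⟨⟨he, fun _ h3 _ => h2 (h3.symm ▸ Good.self_mem_subtree hv)⟩, fun h3 => absurd h3 h1⟩

theorem Good.child_of_cut (h : Good M K L l T) (hv : v ∈ T.verts) (hi : Inner K l v)
    {p c : Finset V} (hc : (T.cut v).Child p c) : T.Child p c := by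
  obtain ⟨e, he, h1, h2, hne⟩ := hc.exists_arc
  obtain ⟨he, h3, h4⟩ := (h.mem_cut_arcs hv hi).1 he
  rw [top_cut h3] at h1 hne
  rw [top_cut h4] at h2 hne
  exact h1 ▸ h2 ▸ child_of_arc he hne

theorem Good.anc_of_cut (h : Good M K L l T) (hv : v ∈ T.verts) (hi : Inner K l v)
    {p c : Finset V} (hc : (T.cut v).Anc p c) : T.Anc p c :=
  Relation.ReflTransGen.mono (fun _ _ => h.child_of_cut hv hi) _ _ hc

/-- The subtree is closed downwards, so a path that ends outside it never visited it and is
untouched by the cut. -/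
theorem Good.anc_cut (h : Good M K L l T) (hv : v ∈ T.verts) (hi : Inner K l v)
    {a c : Finset V} (ha : T.Anc a c) :
    ∀ x ∈ T.verts, x ∉ T.subtree v → T.top x = c → (T.cut v).Anc a c := by
  induction ha with
  | refl => intros; exact Relation.ReflTransGen.refl
  | @tail b c _ hbc ih =>
    intro x hx hxv hxc
    obtain ⟨e, he, h1, h2, hne⟩ := hbc.exists_arc
    have h4 : e.2 ∉ T.subtree v := fun h4 =>
      hxv (h.mem_subtree_of_top_eq h4 (hxc.trans h2.symm))
    have h3 : e.1 ∉ T.subtree v := fun h3 => h4 (h.mem_subtree_of_child he h3)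
    refine (ih e.1 (h.arcs_mem e he).1 h3 h1).tail ?_
    have := child_of_arc (S := T.cut v) ((h.mem_cut_arcs hv hi).2 ⟨he, h3, h4⟩)
    rw [top_cut h3, top_cut h4, h1, h2] at this
    exact this hbc.1

theorem Good.root_notMem_subtree (h : Good M K L l T) (hv : v ∈ T.verts) (hi : Inner K l v)
    (hr : ¬ Inner K l T.root) : T.root ∉ T.subtree v := by
  intro h1
  rcases Relation.ReflTransGen.cases_tail (Good.mem_subtree.1 h1).2 with h2 | ⟨p, -, h2⟩
  · exact hr (h.eq_of_inner h.root_mem hv hi h2 ▸ hi)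
  · exact h.root_no_parent p h2

theorem Good.good_cut (h : Good M K L l T) (hv : v ∈ T.verts) (hi : Inner K l v)
    (hr : ¬ Inner K l T.root) : Good M K L l (T.cut v) := by
  have hroot := h.root_notMem_subtree hv hi hr
  have hmem : ∀ {x}, x ∈ (T.cut v).verts ↔ x ∈ T.verts ∧ x ∉ T.subtree v := by
    intro x; simp [cut]
  have htop : ∀ {x}, x ∈ (T.cut v).verts → (T.cut v).top x = T.top x :=
    fun hx => top_cut (hmem.1 hx).2
  have hrt : (T.cut v).top (T.cut v).root = T.top T.root := top_cut hroot
  have hbl : ∀ {b}, b ∈ (T.cut v).blossoms ↔ b ∈ T.blossoms ∧ ¬ b.verts ⊆ T.subtree v := by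
    intro b; simp [cut]
  refine ⟨hmem.2 ⟨h.root_mem, hroot⟩, ?_, ?_, ?_, ?_, ?_, ?_, ?_, ?_, ?_, ?_, ?_, ?_, ?_, ?_, ?_⟩
  · intro e he
    obtain ⟨he, h1, h2⟩ := (h.mem_cut_arcs hv hi).1 he
    exact ⟨hmem.2 ⟨(h.arcs_mem e he).1, h1⟩, hmem.2 ⟨(h.arcs_mem e he).2, h2⟩⟩
  · intro b hb x hx
    obtain ⟨hb, h1⟩ := hbl.1 hb
    refine hmem.2 ⟨h.blossom_sub b hb hx, fun h2 => h1 fun y hy => ?_⟩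
    exact h.top_sub_subtree h2 (mem_top.2 ⟨b, hb, hx, hy⟩)
  · intro b hb; exact h.blossom_nonempty b (hbl.1 hb).1
  · intro b hb; exact h.blossom_edges b (hbl.1 hb).1
  · intro x hx; rw [htop hx]; exact h.self_mem x (hmem.1 hx).1
  · intro x hx y hy
    rw [htop hx] at hy ⊢
    have := h.part x (hmem.1 hx).1 y hy
    rw [← this]
    refine top_cut fun h1 => (hmem.1 hx).2 (h.mem_subtree_of_top_eq h1 this.symm)
  · intro p q c hp hq
    exact h.uniq p q c (h.child_of_cut hv hi hp) (h.child_of_cut hv hi hq)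
  · intro p hp
    rw [hrt] at hp
    exact h.root_no_parent p (h.child_of_cut hv hi hp)
  · intro x hx
    rw [hrt, htop hx]
    exact h.anc_cut hv hi (h.conn x (hmem.1 hx).1) x (hmem.1 hx).1 (hmem.1 hx).2 rfl
  · intro x hx hix; rw [htop hx]; exact h.inner_top x (hmem.1 hx).1 hix
  · intro e he
    obtain ⟨he, h1, h2⟩ := (h.mem_cut_arcs hv hi).1 he
    rw [top_cut h1, top_cut h2]
    exact h.arc_type e he
  · intro x hx y hxy
    have hy : y ∉ T.subtree v := fun hy =>
      (hmem.1 hx).2 (h.mate_mem_subtree hi hy (Sym2.eq_swap ▸ hxy))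
    obtain ⟨h1, h2⟩ := h.mate x (hmem.1 hx).1 y hxy
    rw [htop hx, top_cut hy, h.mem_cut_arcs hv hi, h.mem_cut_arcs hv hi]
    exact ⟨hmem.2 ⟨h1, hy⟩, h2.imp_right (Or.imp (fun h3 => ⟨h3.1, h3.2.1, h3.2.2, (hmem.1 hx).2, hy⟩)
      fun h3 => ⟨h3.1, h3.2.1, h3.2.2, hy, (hmem.1 hx).2⟩)⟩
  · intro w hw w' hw' i i' ha
    rw [htop hw, htop hw'] at ha
    exact h.mono w (hmem.1 hw).1 w' (hmem.1 hw').1 i i' (h.anc_of_cut hv hi ha)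
  · intro w hw i
    refine le_trans ?_ (h.size w (hmem.1 hw).1 i)
    gcongr
    intro x hx
    rw [Good.mem_subtree] at hx ⊢
    refine ⟨(hmem.1 hx.1).1, ?_⟩
    rw [← htop hw, ← htop hx.1]
    exact h.anc_of_cut hv hi hx.2
  · intro x hx
    rw [htop hx]
    refine le_trans ?_ (h.count x (hmem.1 hx).1)
    gcongr
    exact Finset.filter_subset _ _

theorem Good.top_piece (h : Good M K L l T) {x : V} (hx : x ∈ T.subtree v) :
    (T.piece v).top x = T.top x := by
  ext y
  simp only [mem_top, piece, Finset.mem_filter]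
  constructor
  · rintro ⟨b, ⟨hb, -⟩, h1⟩; exact ⟨b, hb, h1⟩
  · rintro ⟨b, hb, h1, h2⟩
    exact ⟨b, ⟨hb, fun z hz => h.top_sub_subtree hx (mem_top.2 ⟨b, hb, h1, hz⟩)⟩, h1, h2⟩

theorem mem_piece_arcs {e : V × V} :
    e ∈ (T.piece v).arcs ↔ e ∈ T.arcs ∧ e.1 ∈ T.subtree v ∧ e.2 ∈ T.subtree v := by
  simp [piece]

theorem Good.child_of_piece (h : Good M K L l T) {p c : Finset V} (hc : (T.piece v).Child p c) :
    T.Child p c := by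
  obtain ⟨e, he, h1, h2, hne⟩ := hc.exists_arc
  obtain ⟨he, h3, h4⟩ := mem_piece_arcs.1 he
  rw [h.top_piece h3] at h1 hne
  rw [h.top_piece h4] at h2 hne
  exact h1 ▸ h2 ▸ child_of_arc he hne

theorem Good.anc_of_piece (h : Good M K L l T) {p c : Finset V} (hc : (T.piece v).Anc p c) :
    T.Anc p c :=
  Relation.ReflTransGen.mono (fun _ _ => h.child_of_piece) _ _ hc

theorem Good.anc_piece (h : Good M K L l T)
    {c : Finset V} (ha : T.Anc (T.top v) c) : (T.piece v).Anc (T.top v) c := by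
  induction ha with
  | refl => exact Relation.ReflTransGen.refl
  | @tail b c hb hbc ih =>
    obtain ⟨e, he, h1, h2, hne⟩ := hbc.exists_arc
    have h3 : e.1 ∈ T.subtree v := Good.mem_subtree.2 ⟨(h.arcs_mem e he).1, by rwa [h1]⟩
    have h4 := h.mem_subtree_of_child he h3
    refine ih.tail ?_
    have := child_of_arc (S := T.piece v) (mem_piece_arcs.2 ⟨he, h3, h4⟩)
    rw [h.top_piece h3, h.top_piece h4, h1, h2] at this
    exact this hbc.1

/-- `Good` does not ask that the root be free or outer, precisely so that it applies to this
subtree, whose root v is inner. -/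
theorem Good.good_piece (h : Good M K L l T) (hv : v ∈ T.verts) (hi : Inner K l v) :
    Good M K L l (T.piece v) := by
  have hmem : ∀ {x}, x ∈ (T.piece v).verts ↔ x ∈ T.subtree v := Iff.rfl
  have hver : ∀ {x}, x ∈ (T.piece v).verts → x ∈ T.verts := fun hx => (Good.mem_subtree.1 hx).1
  have htop : ∀ {x}, x ∈ (T.piece v).verts → (T.piece v).top x = T.top x :=
    fun hx => h.top_piece hx
  have hself := Good.self_mem_subtree hv
  have hrt : (T.piece v).top (T.piece v).root = T.top v := h.top_piece hself
  have hbl : ∀ {b}, b ∈ (T.piece v).blossoms ↔ b ∈ T.blossoms ∧ b.verts ⊆ T.subtree v := by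
    intro b; simp [piece]
  refine ⟨hself, ?_, ?_, ?_, ?_, ?_, ?_, ?_, ?_, ?_, ?_, ?_, ?_, ?_, ?_, ?_⟩
  · intro e he
    exact (mem_piece_arcs.1 he).2
  · intro b hb x hx
    exact (hbl.1 hb).2 hx
  · intro b hb; exact h.blossom_nonempty b (hbl.1 hb).1
  · intro b hb; exact h.blossom_edges b (hbl.1 hb).1
  · intro x hx; rw [htop hx]; exact h.self_mem x (hver hx)
  · intro x hx y hy
    rw [htop hx] at hy ⊢
    have := h.part x (hver hx) y hy
    rw [← this]
    exact h.top_piece (h.mem_subtree_of_top_eq hx this)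
  · intro p q c hp hq
    exact h.uniq p q c (h.child_of_piece hp) (h.child_of_piece hq)
  · intro p hp
    rw [hrt] at hp
    obtain ⟨e, he, h1, h2, hne⟩ := hp.exists_arc
    obtain ⟨he, h3, h4⟩ := mem_piece_arcs.1 he
    rw [h.top_piece h3] at h1
    exact h.acyclic (h.child_of_piece hp) (h1 ▸ (Good.mem_subtree.1 h3).2)
  · intro x hx
    rw [hrt, htop hx]
    exact h.anc_piece (Good.mem_subtree.1 hx).2
  · intro x hx hix; rw [htop hx]; exact h.inner_top x (hver hx) hix
  · intro e he
    obtain ⟨he, h1, h2⟩ := mem_piece_arcs.1 he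
    rw [h.top_piece h1, h.top_piece h2]
    exact h.arc_type e he
  · intro x hx y hxy
    have hy : y ∈ T.subtree v := h.mate_mem_subtree hi hx hxy
    obtain ⟨h1, h2⟩ := h.mate x (hver hx) y hxy
    rw [htop hx, h.top_piece hy, mem_piece_arcs, mem_piece_arcs]
    exact ⟨hy, h2.imp_right (Or.imp (fun h3 => ⟨h3.1, h3.2.1, h3.2.2, hx, hy⟩)
      fun h3 => ⟨h3.1, h3.2.1, h3.2.2, hy, hx⟩)⟩
  · intro w hw w' hw' i i' ha
    rw [htop hw, htop hw'] at ha
    exact h.mono w (hver hw) w' (hver hw') i i' (h.anc_of_piece ha)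
  · intro w hw i
    refine le_trans ?_ (h.size w (hver hw) i)
    gcongr
    intro x hx
    rw [Good.mem_subtree] at hx ⊢
    refine ⟨hver hx.1, ?_⟩
    rw [← htop hw, ← htop hx.1]
    exact h.anc_of_piece hx.2
  · intro x hx
    rw [htop hx]
    refine le_trans ?_ (h.count x (hver hx))
    gcongr
    exact Finset.filter_subset _ _

end Cut

/-- Lowering the label of the root of a subtree. -/
theorem Good.lower_root (h : Good M K L l P) (hi : Inner K l P.root) {k : ℕ} (hk : 1 ≤ k)
    (hkl : k ≤ l P.root) : Good M K L (Function.update l P.root k) P := by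
  have hle : ∀ x, Function.update l P.root k x ≤ l x := fun x => by
    by_cases hx : x = P.root
    · subst hx; simpa using hkl
    · simp [hx]
  have hii : ∀ x, (Inner K (Function.update l P.root k) x ↔ Inner K l x) := fun x => by
    by_cases hx : x = P.root
    · subst hx
      refine iff_of_true ?_ hi
      simp only [Inner, Function.update_self]
      exact ⟨hk, hkl.trans hi.2⟩
    · simp [Inner, hx]
  refine ⟨h.1, h.2, h.3, h.4, h.5, h.6, h.7, h.8, h.9, h.10, ?_, ?_, ?_, ?_, ?_, h.16⟩
  · simpa only [hii] using h.inner_top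
  · simpa only [hii] using h.arc_type
  · simpa only [hii] using h.mate
  · intro w hw w' hw' i i' ha
    rw [hii] at i i'
    rcases h.mono w hw w' hw' i i' ha with rfl | h1
    · exact Or.inl rfl
    -- If the lowered vertex is the lower end, then w would have a smaller label than the root,
    -- which is above every vertex of the tree: impossible.
    by_cases hx : w' = P.root
    · subst hx
      have := h.anc_label_le h.root_mem hw i' i (h.conn w hw)
      omega
    · right
      rw [Function.update_of_ne hx]
      exact (hle w).trans_lt h1
  · intro w hw i
    rw [hii] at i
    refine le_trans ?_ (h.size w hw i)
    gcongr
    exact hle w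

theorem blossom_filter_card_le_one {b : Blossom V} {A : Finset V} {s : Finset (Blossom V)}
    (hs : ∀ c ∈ s, c.verts ⊆ A → c = b) (hA : A.card = 1) :
    (s.filter fun c => c.verts ⊆ A).card + 1 ≤ 2 * A.card := by
  have : s.filter (fun c => c.verts ⊆ A) ⊆ {b} := by
    intro c hc
    rw [Finset.mem_filter] at hc
    exact Finset.mem_singleton.2 (hs c hc.1 hc.2)
  have := Finset.card_le_card this
  simp at this
  omega

theorem good_single (α : V) (hf : ∀ y, s(α, y) ∉ M) (hi : ¬ Inner K l α) :
    Good M K L l (Struct.single α) := by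
  have htop : (Struct.single α).top α = {α} := by
    ext y; simp [mem_top, single, Blossom.trivial]
  have hm : ∀ {x}, x ∈ (Struct.single α).verts ↔ x = α := by simp [single]
  have hch : ∀ p c, ¬ (Struct.single α).Child p c := by
    rintro p c ⟨-, e, he, -⟩; simp [single] at he
  refine ⟨by simp [single], by simp [single], ?_, ?_, ?_, ?_, ?_, ?_, ?_, ?_, ?_, ?_, ?_, ?_, ?_, ?_⟩
  · simp [single, Blossom.trivial]
  · simp [single, Blossom.trivial]
  · simp [single, Blossom.trivial]
  · intro x hx; rw [hm] at hx; subst hx; simp [htop]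
  · intro x hx y hy; rw [hm] at hx; subst hx
    rw [htop] at hy; simp at hy; rw [hy]
  · intro p q c hp; exact absurd hp (hch _ _)
  · intro p hp; exact absurd hp (hch _ _)
  · intro x hx; rw [hm] at hx; subst hx; exact Relation.ReflTransGen.refl
  · intro x hx; rw [hm] at hx; subst hx; intro; exact htop
  · simp [single]
  · intro x hx; rw [hm] at hx; subst hx; intro y hy; exact absurd hy (hf y)
  · intro x hx; rw [hm] at hx; subst hx; intro y hy; rw [hm] at hy; subst hy; intros; exact Or.inl rfl
  · intro x hx; rw [hm] at hx; subst hx; intro h; exact absurd h hi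
  · intro x hx; rw [hm] at hx; subst hx; rw [htop]
    exact blossom_filter_card_le_one (b := Blossom.trivial x) (by simp [single]) (by simp)

theorem good_pair (hM : IsMatching M) (hvt : s(v, t) ∈ M) (hv : Inner K l v) (ht : ¬ Inner K l t)
    (hs : 2 + L * l v ≤ L * (K + 2)) : Good M K L l (pair v t) := by
  have hne : v ≠ t := hM.ne hvt
  have htv : (pair v t).top v = {v} := by
    ext y; simp [mem_top, pair, Blossom.trivial, hne]
  have htt : (pair v t).top t = {t} := by
    ext y; simp [mem_top, pair, Blossom.trivial, hne.symm]
  have hm : ∀ {x}, x ∈ (pair v t).verts ↔ x = v ∨ x = t := by simp [pair]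
  have hch : ∀ {p c}, (pair v t).Child p c → p = {v} ∧ c = {t} := by
    rintro p c ⟨-, e, he, rfl, rfl⟩
    simp only [pair, Finset.mem_singleton] at he
    subst he
    exact ⟨htv, htt⟩
  have hsn : ({v} : Finset V) ≠ {t} := by simpa using hne
  refine ⟨by simp [pair], by simp [pair], ?_, ?_, ?_, ?_, ?_, ?_, ?_, ?_, ?_, ?_, ?_, ?_, ?_, ?_⟩
  · simp [pair, Blossom.trivial]
  · simp [pair, Blossom.trivial]
  · simp [pair, Blossom.trivial]
  · intro x hx
    rcases hm.1 hx with rfl | rfl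
    · simp [htv]
    · simp [htt]
  · intro x hx y hy
    rcases hm.1 hx with rfl | rfl
    · rw [htv] at hy; simp at hy; rw [hy]
    · rw [htt] at hy; simp at hy; rw [hy]
  · intro p q c hp hq; rw [(hch hp).1, (hch hq).1]
  · intro p hp
    have : (pair v t).root = v := rfl
    rw [this, htv] at hp
    exact hsn (hch hp).2
  · intro x hx
    have : (pair v t).root = v := rfl
    rw [this]
    rcases hm.1 hx with rfl | rfl
    · exact Relation.ReflTransGen.refl
    · exact Relation.ReflTransGen.single
        ⟨by rwa [htv, htt], (v, x), by simp [pair], rfl, rfl⟩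
  · intro x hx _
    rcases hm.1 hx with rfl | rfl
    · exact htv
    · exact htt
  · intro e he _
    simp only [pair, Finset.mem_singleton] at he
    subst he
    exact Or.inl ⟨hvt, hv, ht⟩
  · intro x hx y hxy
    rcases hm.1 hx with rfl | rfl
    · obtain rfl := hM.mate_eq hxy hvt
      exact ⟨by simp [pair], Or.inr (Or.inl ⟨hv, ht, by simp [pair]⟩)⟩
    · obtain rfl := hM.mate_eq hxy (Sym2.eq_swap ▸ hvt)
      exact ⟨by simp [pair], Or.inr (Or.inr ⟨hv, ht, by simp [pair]⟩)⟩
  · intro w hw w' hw' i i' _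
    rcases hm.1 hw with rfl | rfl
    · rcases hm.1 hw' with rfl | rfl
      · exact Or.inl rfl
      · exact absurd i' ht
    · exact absurd i ht
  · intro w hw i
    rcases hm.1 hw with rfl | rfl
    · refine le_trans ?_ hs
      gcongr
      exact (Good.subtree_card_le (S := pair w t)).trans Finset.card_le_two
    · exact absurd i ht
  · intro x hx
    rcases hm.1 hx with rfl | rfl
    · rw [htv]
      exact blossom_filter_card_le_one (b := Blossom.trivial x)
        (by simp [pair, Blossom.trivial, hne.symm]) (by simp)
    · rw [htt]
      exact blossom_filter_card_le_one (b := Blossom.trivial x)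
        (by simp [pair, Blossom.trivial, hne]) (by simp)

/-! ### Joining two trees -/

section Join

theorem top_join_left (hP : Good M K L l P)
    (hd : Disjoint S.verts P.verts) {x : V} (hx : x ∈ S.verts) : (S.join P u).top x = S.top x := by
  ext y
  simp only [mem_top, join, Finset.mem_union]
  constructor
  · rintro ⟨b, hb | hb, h1, h2⟩
    · exact ⟨b, hb, h1, h2⟩
    · exact absurd (hP.blossom_sub b hb h1) (Finset.disjoint_left.1 hd hx)
  · rintro ⟨b, hb, h1⟩; exact ⟨b, Or.inl hb, h1⟩

theorem Good.top_join_right (h : Good M K L l S)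
    (hd : Disjoint S.verts P.verts) {x : V} (hx : x ∈ P.verts) : (S.join P u).top x = P.top x := by
  ext y
  simp only [mem_top, join, Finset.mem_union]
  constructor
  · rintro ⟨b, hb | hb, h1, h2⟩
    · exact absurd hx (Finset.disjoint_left.1 hd (h.blossom_sub b hb h1))
    · exact ⟨b, hb, h1, h2⟩
  · rintro ⟨b, hb, h1⟩; exact ⟨b, Or.inr hb, h1⟩

theorem Good.node_ne (h : Good M K L l S) (hP : Good M K L l P)
    (hd : Disjoint S.verts P.verts) {x y : V} (hx : x ∈ S.verts) :
    S.top x ≠ P.top y := by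
  intro heq
  have := h.self_mem x hx
  rw [heq] at this
  exact Finset.disjoint_left.1 hd hx (hP.top_sub y this)

variable (h : Good M K L l S) (hP : Good M K L l P) (hd : Disjoint S.verts P.verts)
  (hu : u ∈ S.verts)

include h hP hd hu in
theorem Good.child_join {p c : Finset V} : (S.join P u).Child p c ↔
    S.Child p c ∨ P.Child p c ∨ (p = S.top u ∧ c = P.top P.root) := by
  constructor
  · intro hc
    obtain ⟨e, he, h1, h2, hne⟩ := hc.exists_arc
    simp only [join, Finset.mem_union, Finset.mem_singleton] at he
    rcases he with (he | he) | he
    · obtain ⟨h3, h4⟩ := h.arcs_mem e he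
      rw [top_join_left hP hd h3] at h1 hne
      rw [top_join_left hP hd h4] at h2 hne
      exact Or.inl (h1 ▸ h2 ▸ child_of_arc he hne)
    · subst he
      rw [top_join_left hP hd hu] at h1
      rw [h.top_join_right hd hP.root_mem] at h2
      exact Or.inr (Or.inr ⟨h1.symm, h2.symm⟩)
    · obtain ⟨h3, h4⟩ := hP.arcs_mem e he
      rw [h.top_join_right hd h3] at h1 hne
      rw [h.top_join_right hd h4] at h2 hne
      exact Or.inr (Or.inl (h1 ▸ h2 ▸ child_of_arc he hne))
  · rintro (hc | hc | ⟨rfl, rfl⟩)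
    · obtain ⟨e, he, h1, h2, hne⟩ := hc.exists_arc
      obtain ⟨h3, h4⟩ := h.arcs_mem e he
      exact ⟨hc.1, e, by simp [join, he], by rwa [top_join_left hP hd h3],
        by rwa [top_join_left hP hd h4]⟩
    · obtain ⟨e, he, h1, h2, hne⟩ := hc.exists_arc
      obtain ⟨h3, h4⟩ := hP.arcs_mem e he
      exact ⟨hc.1, e, by simp [join, he], by rwa [h.top_join_right hd h3],
        by rwa [h.top_join_right hd h4]⟩
    · exact ⟨h.node_ne hP hd hu, (u, P.root), by simp [join],
        top_join_left hP hd hu, h.top_join_right hd hP.root_mem⟩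

include h hP hd hu in
theorem Good.anc_join_left {a c : Finset V} (ha : (S.join P u).Anc a c) :
    ∀ x ∈ S.verts, S.top x = c → S.Anc a c := by
  induction ha with
  | refl => intros; exact Relation.ReflTransGen.refl
  | @tail b c _ hbc ih =>
    rintro x hx rfl
    rcases (h.child_join hP hd hu).1 hbc with h1 | h1 | ⟨-, h1⟩
    · obtain ⟨e, he, h2, -⟩ := h1.exists_arc
      exact (ih e.1 (h.arcs_mem e he).1 h2).tail h1
    · obtain ⟨e, he, -, h2, -⟩ := h1.exists_arc
      exact absurd h2.symm (h.node_ne hP hd hx)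
    · exact absurd h1 (h.node_ne hP hd hx)

include h hP hd hu in
-- The two trees are connected by a single arc. A path that ends in P either started there or used
-- this arc, and then its start is above u.
theorem Good.anc_join_right {a c : Finset V} (ha : (S.join P u).Anc a c) :
    ∀ x ∈ P.verts, P.top x = c → P.Anc a c ∨ S.Anc a (S.top u) := by
  induction ha with
  | refl => intros; exact Or.inl Relation.ReflTransGen.refl
  | @tail b c hab hbc ih =>
    rintro x hx rfl
    rcases (h.child_join hP hd hu).1 hbc with h1 | h1 | ⟨rfl, h1⟩
    · obtain ⟨e, he, -, h2, -⟩ := h1.exists_arc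
      exact absurd h2 (h.node_ne hP hd (h.arcs_mem e he).2)
    · obtain ⟨e, he, h2, -⟩ := h1.exists_arc
      exact (ih e.1 (hP.arcs_mem e he).1 h2).imp_left fun h3 => h3.tail h1
    · exact Or.inr (h.anc_join_left hP hd hu hab u hu rfl)

include h hP hd hu in
-- The common core of all three kinds of overtake. The bound `hlow` makes labels still increase
-- across the new arc, and `hSL` with `hPL` pays for the vertices that the ancestors of u receive.
theorem Good.good_join (hui : ¬ Inner K l u) (hv : Inner K l P.root) (hm : s(u, P.root) ∉ M)
    {d : ℕ} (hlow : ∀ w ∈ S.verts, Inner K l w → S.Anc (S.top w) (S.top u) → l w ≤ d)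
    (hroot : l P.root = d + 1) (hSL : S.verts.card ≤ L)
    (hPL : P.verts.card + L * (d + 2) ≤ L * (K + 2)) : Good M K L l (S.join P u) := by
  have hmem : ∀ {x}, x ∈ (S.join P u).verts ↔ x ∈ S.verts ∨ x ∈ P.verts := by
    intro x; simp [join]
  have hbl : ∀ {b}, b ∈ (S.join P u).blossoms ↔ b ∈ S.blossoms ∨ b ∈ P.blossoms := by
    intro b; simp [join]
  have harc : ∀ {e}, e ∈ (S.join P u).arcs ↔ e ∈ S.arcs ∨ e = (u, P.root) ∨ e ∈ P.arcs := by
    intro e; simp [join]; tauto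
  have hl : ∀ {x}, x ∈ S.verts → (S.join P u).top x = S.top x :=
    fun hx => top_join_left hP hd hx
  have hr : ∀ {x}, x ∈ P.verts → (S.join P u).top x = P.top x :=
    fun hx => h.top_join_right hd hx
  have hrt : (S.join P u).top (S.join P u).root = S.top S.root := hl h.root_mem
  have hch := fun {p c} => h.child_join hP hd hu (p := p) (c := c)
  have hSn : ∀ {p c}, S.Child p c → ∃ x ∈ S.verts, ∃ y ∈ S.verts, p = S.top x ∧ c = S.top y := by
    intro p c hc
    obtain ⟨e, he, h1, h2, -⟩ := hc.exists_arc
    exact ⟨e.1, (h.arcs_mem e he).1, e.2, (h.arcs_mem e he).2, h1.symm, h2.symm⟩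
  have hPn : ∀ {p c}, P.Child p c → ∃ x ∈ P.verts, ∃ y ∈ P.verts, p = P.top x ∧ c = P.top y := by
    intro p c hc
    obtain ⟨e, he, h1, h2, -⟩ := hc.exists_arc
    exact ⟨e.1, (hP.arcs_mem e he).1, e.2, (hP.arcs_mem e he).2, h1.symm, h2.symm⟩
  have hSA : ∀ {a c}, S.Anc a c → (S.join P u).Anc a c := fun ha =>
    Relation.ReflTransGen.mono (fun _ _ h1 => hch.2 (Or.inl h1)) _ _ ha
  have hPA : ∀ {a c}, P.Anc a c → (S.join P u).Anc a c := fun ha =>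
    Relation.ReflTransGen.mono (fun _ _ h1 => hch.2 (Or.inr (Or.inl h1))) _ _ ha
  have hne : ∀ {x y}, x ∈ S.verts → y ∈ P.verts → S.top x ≠ P.top y :=
    fun hx _ => h.node_ne hP hd hx
  have hnSP : ∀ {x y}, x ∈ S.verts → y ∈ P.verts → ¬ S.Anc (P.top y) (S.top x) := by
    intro x y hx hy ha
    obtain ⟨z, hz, h1⟩ := h.node_of_anc hx ha
    exact hne hz hy h1.symm
  have hnPS : ∀ {x y}, x ∈ S.verts → y ∈ P.verts → ¬ P.Anc (S.top x) (P.top y) := by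
    intro x y hx hy ha
    obtain ⟨z, hz, h1⟩ := hP.node_of_anc hy ha
    exact hne hx hz h1
  refine ⟨hmem.2 (Or.inl h.root_mem), ?_, ?_, ?_, ?_, ?_, ?_, ?_, ?_, ?_, ?_, ?_, ?_, ?_, ?_, ?_⟩
  · intro e he
    rw [hmem, hmem]
    rcases harc.1 he with he | rfl | he
    · exact ⟨Or.inl (h.arcs_mem e he).1, Or.inl (h.arcs_mem e he).2⟩
    · exact ⟨Or.inl hu, Or.inr hP.root_mem⟩
    · exact ⟨Or.inr (hP.arcs_mem e he).1, Or.inr (hP.arcs_mem e he).2⟩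
  · intro b hb x hx
    rw [hmem]
    exact (hbl.1 hb).imp (fun hb => h.blossom_sub b hb hx) fun hb => hP.blossom_sub b hb hx
  · intro b hb; exact (hbl.1 hb).elim (h.blossom_nonempty b) (hP.blossom_nonempty b)
  · intro b hb; exact (hbl.1 hb).elim (h.blossom_edges b) (hP.blossom_edges b)
  · intro x hx
    rcases hmem.1 hx with hx | hx
    · rw [hl hx]; exact h.self_mem x hx
    · rw [hr hx]; exact hP.self_mem x hx
  · intro x hx y hy
    rcases hmem.1 hx with hx | hx
    · rw [hl hx] at hy ⊢
      rw [hl (h.top_sub x hy)]; exact h.part x hx y hy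
    · rw [hr hx] at hy ⊢
      rw [hr (hP.top_sub x hy)]; exact hP.part x hx y hy
  · intro p q c hp hq
    rcases hch.1 hp with hp | hp | ⟨hpu, hp⟩ <;> rcases hch.1 hq with hq | hq | ⟨hqu, hq⟩
    · exact h.uniq p q c hp hq
    · obtain ⟨-, -, y, hy, -, h1⟩ := hSn hp
      obtain ⟨-, -, y', hy', -, h2⟩ := hPn hq
      exact absurd (h1.symm.trans h2) (hne hy hy')
    · obtain ⟨-, -, y, hy, -, h1⟩ := hSn hp
      exact absurd (h1.symm.trans hq) (hne hy hP.root_mem)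
    · obtain ⟨-, -, y, hy, -, h1⟩ := hSn hq
      obtain ⟨-, -, y', hy', -, h2⟩ := hPn hp
      exact absurd (h1.symm.trans h2) (hne hy hy')
    · exact hP.uniq p q c hp hq
    · exact absurd (hq ▸ hp) (hP.root_no_parent p)
    · obtain ⟨-, -, y, hy, -, h1⟩ := hSn hq
      exact absurd (h1.symm.trans hp) (hne hy hP.root_mem)
    · exact absurd (hp ▸ hq) (hP.root_no_parent q)
    · rw [hpu, hqu]
  · intro p hp
    rw [hrt] at hp
    rcases hch.1 hp with hp | hp | ⟨-, hp⟩
    · exact h.root_no_parent p hp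
    · obtain ⟨-, -, y', hy', -, h2⟩ := hPn hp
      exact hne h.root_mem hy' h2
    · exact hne h.root_mem hP.root_mem hp
  · intro x hx
    rw [hrt]
    rcases hmem.1 hx with hx | hx
    · rw [hl hx]; exact hSA (h.conn x hx)
    · rw [hr hx]
      exact ((hSA (h.conn u hu)).tail (hch.2 (Or.inr (Or.inr ⟨rfl, rfl⟩)))).trans
        (hPA (hP.conn x hx))
  · intro x hx
    rcases hmem.1 hx with hx | hx
    · rw [hl hx]; exact h.inner_top x hx
    · rw [hr hx]; exact hP.inner_top x hx
  · intro e he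
    rcases harc.1 he with he | rfl | he
    · rw [hl (h.arcs_mem e he).1, hl (h.arcs_mem e he).2]; exact h.arc_type e he
    · intro _; exact Or.inr ⟨hm, hui, hv⟩
    · rw [hr (hP.arcs_mem e he).1, hr (hP.arcs_mem e he).2]; exact hP.arc_type e he
  · intro x hx y hxy
    rw [harc, harc]
    rcases hmem.1 hx with hx | hx
    · obtain ⟨h1, h2⟩ := h.mate x hx y hxy
      rw [hl hx, hl h1]
      exact ⟨hmem.2 (Or.inl h1), h2.imp_right (Or.imp (fun h3 => ⟨h3.1, h3.2.1, Or.inl h3.2.2⟩)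
        fun h3 => ⟨h3.1, h3.2.1, Or.inl h3.2.2⟩)⟩
    · obtain ⟨h1, h2⟩ := hP.mate x hx y hxy
      rw [hr hx, hr h1]
      exact ⟨hmem.2 (Or.inr h1), h2.imp_right (Or.imp
        (fun h3 => ⟨h3.1, h3.2.1, Or.inr (Or.inr h3.2.2)⟩)
        fun h3 => ⟨h3.1, h3.2.1, Or.inr (Or.inr h3.2.2)⟩)⟩
  · intro w hw w' hw' i i' ha
    rcases hmem.1 hw with hw | hw <;> rcases hmem.1 hw' with hw' | hw'
    · rw [hl hw, hl hw'] at ha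
      exact h.mono w hw w' hw' i i' (h.anc_join_left hP hd hu ha w' hw' rfl)
    · rw [hl hw, hr hw'] at ha
      right
      rcases h.anc_join_right hP hd hu ha w' hw' rfl with h1 | h1
      · exact absurd h1 (hnPS hw hw')
      · have h2 := hlow w hw i h1
        have h3 := hP.anc_label_le hP.root_mem hw' hv i' (hP.conn w' hw')
        omega
    · rw [hr hw, hl hw'] at ha
      exact absurd (h.anc_join_left hP hd hu ha w' hw' rfl) (hnSP hw' hw)
    · rw [hr hw, hr hw'] at ha
      rcases h.anc_join_right hP hd hu ha w' hw' rfl with h1 | h1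
      · exact hP.mono w hw w' hw' i i' h1
      · exact absurd h1 (hnSP hu hw)
  · intro w hw i
    rcases hmem.1 hw with hw | hw
    -- Only ancestors of u gain vertices. For such w the joined tree has at most L + L(K - d)
    -- vertices, and l w ≤ d leaves room for L(K + 2 - d). All other subtrees of S are unchanged.
    · by_cases hwu : S.Anc (S.top w) (S.top u)
      · have h1 := hlow w hw i hwu
        have h2 : ((S.join P u).subtree w).card ≤ S.verts.card + P.verts.card :=
          Good.subtree_card_le.trans (Finset.card_union_le _ _)
        have h3 : L * l w ≤ L * d := Nat.mul_le_mul_left _ h1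
        have h4 : L * (d + 2) = L * d + L + L := by ring
        omega
      · refine le_trans ?_ (h.size w hw i)
        gcongr
        intro x hx
        rw [Good.mem_subtree] at hx ⊢
        obtain ⟨hx, h1⟩ := hx
        rw [hl hw] at h1
        rcases hmem.1 hx with hx | hx
        · rw [hl hx] at h1
          exact ⟨hx, h.anc_join_left hP hd hu h1 x hx rfl⟩
        · rw [hr hx] at h1
          rcases h.anc_join_right hP hd hu h1 x hx rfl with h2 | h2
          · exact absurd h2 (hnPS hw hx)
          · exact absurd h2 hwu
    · refine le_trans ?_ (hP.size w hw i)
      gcongr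
      intro x hx
      rw [Good.mem_subtree] at hx ⊢
      obtain ⟨hx, h1⟩ := hx
      rw [hr hw] at h1
      rcases hmem.1 hx with hx | hx
      · rw [hl hx] at h1
        exact absurd (h.anc_join_left hP hd hu h1 x hx rfl) (hnSP hx hw)
      · rw [hr hx] at h1
        rcases h.anc_join_right hP hd hu h1 x hx rfl with h2 | h2
        · exact ⟨hx, h2⟩
        · exact absurd h2 (hnSP hu hw)
  · intro x hx
    rcases hmem.1 hx with hx | hx
    · rw [hl hx]
      refine le_trans (Nat.add_le_add_right (Finset.card_le_card fun b hb => ?_) 1) (h.count x hx)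
      rw [Finset.mem_filter] at hb ⊢
      refine ⟨(hbl.1 hb.1).resolve_right fun h1 => ?_, hb.2⟩
      obtain ⟨y, hy⟩ := hP.blossom_nonempty b h1
      exact Finset.disjoint_left.1 hd (h.top_sub x (hb.2 hy)) (hP.blossom_sub b h1 hy)
    · rw [hr hx]
      refine le_trans (Nat.add_le_add_right (Finset.card_le_card fun b hb => ?_) 1) (hP.count x hx)
      rw [Finset.mem_filter] at hb ⊢
      refine ⟨(hbl.1 hb.1).resolve_left fun h1 => ?_, hb.2⟩
      obtain ⟨y, hy⟩ := h.blossom_nonempty b h1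
      exact Finset.disjoint_left.1 hd (h.blossom_sub b h1 hy) (hP.top_sub x (hb.2 hy))

end Join

end Struct

end Surgery

end EpsMM

namespace EpsMM

open scoped Classical

/-! ### Contracting a blossom preserves the invariant -/

section Contraction

variable {V : Type*} [Fintype V]

namespace Struct

variable {M : Finset (Sym2 V)} {K L : ℕ} {l l' : V → ℕ} {S : Struct V} {g : V × V}

theorem mem_cycle {x : Finset V} : x ∈ S.cycle g ↔
    (S.Anc x (S.top g.1) ∨ S.Anc x (S.top g.2)) ∧
      ∀ c, S.Anc c (S.top g.1) → S.Anc c (S.top g.2) → S.Anc c x := by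
  simp [cycle]

theorem left_mem_cycle : S.top g.1 ∈ S.cycle g :=
  mem_cycle.2 ⟨Or.inl Relation.ReflTransGen.refl, fun _ h _ => h⟩

theorem right_mem_cycle : S.top g.2 ∈ S.cycle g :=
  mem_cycle.2 ⟨Or.inr Relation.ReflTransGen.refl, fun _ _ h => h⟩

theorem mem_newBlossom_verts {x : V} : x ∈ (S.newBlossom g).verts ↔ ∃ c ∈ S.cycle g, x ∈ c := by
  simp [newBlossom, Finset.mem_sup]

theorem Good.cycle_node (h : Good M K L l S) (h1 : g.1 ∈ S.verts) (h2 : g.2 ∈ S.verts)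
    {c : Finset V} (hc : c ∈ S.cycle g) : ∃ y ∈ S.verts, c = S.top y :=
  (mem_cycle.1 hc).1.elim (h.node_of_anc h1) (h.node_of_anc h2)

theorem Good.mem_newBlossom_iff (h : Good M K L l S) (h1 : g.1 ∈ S.verts) (h2 : g.2 ∈ S.verts)
    {x : V} : x ∈ (S.newBlossom g).verts ↔ x ∈ S.verts ∧ S.top x ∈ S.cycle g := by
  rw [mem_newBlossom_verts]
  constructor
  · rintro ⟨c, hc, hx⟩
    obtain ⟨y, hy, rfl⟩ := h.cycle_node h1 h2 hc
    exact ⟨h.top_sub y hx, by rwa [h.part y hy x hx]⟩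
  · rintro ⟨hx, hc⟩
    exact ⟨_, hc, h.self_mem x hx⟩

theorem Good.top_contract_of_mem (h : Good M K L l S) (h1 : g.1 ∈ S.verts) (h2 : g.2 ∈ S.verts)
    {x : V} (hx : x ∈ (S.newBlossom g).verts) :
    (S.contract g).top x = (S.newBlossom g).verts := by
  ext y
  simp only [mem_top, contract, Finset.mem_insert]
  constructor
  · rintro ⟨b, rfl | hb, h3, h4⟩
    · exact h4
    · rw [h.mem_newBlossom_iff h1 h2] at hx
      exact mem_newBlossom_verts.2 ⟨_, hx.2, mem_top.2 ⟨b, hb, h3, h4⟩⟩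
  · intro hy
    exact ⟨_, Or.inl rfl, hx, hy⟩

theorem top_contract_of_notMem {x : V} (hx : x ∉ (S.newBlossom g).verts) :
    (S.contract g).top x = S.top x := by
  ext y
  simp only [mem_top, contract, Finset.mem_insert]
  constructor
  · rintro ⟨b, rfl | hb, h3, h4⟩
    · exact absurd h3 hx
    · exact ⟨b, hb, h3, h4⟩
  · rintro ⟨b, hb, h3⟩
    exact ⟨b, Or.inr hb, h3⟩

/-- An arc that enters the cycle ends at the lowest common ancestor. -/
theorem Good.anc_of_enter (h : Good M K L l S) (h1 : g.1 ∈ S.verts) (h2 : g.2 ∈ S.verts)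
    {e : V × V} (he : e ∈ S.arcs) (he1 : e.1 ∉ (S.newBlossom g).verts)
    (he2 : e.2 ∈ (S.newBlossom g).verts) :
    S.top e.1 ≠ S.top e.2 ∧ S.Anc (S.top e.2) (S.top g.1) ∧ S.Anc (S.top e.2) (S.top g.2) ∧
      ∀ c ∈ S.cycle g, S.Anc (S.top e.2) c := by
  have hv := h.arcs_mem e he
  rw [h.mem_newBlossom_iff h1 h2] at he1 he2
  have hc1 : S.top e.1 ∉ S.cycle g := fun hc => he1 ⟨hv.1, hc⟩
  have hne : S.top e.1 ≠ S.top e.2 := fun heq => hc1 (heq ▸ he2.2)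
  have hch := child_of_arc he hne
  have hc2 := mem_cycle.1 he2.2
  rw [mem_cycle, not_and] at hc1
  have := hc1 (hc2.1.imp (fun h3 => Relation.ReflTransGen.head hch h3)
    fun h3 => Relation.ReflTransGen.head hch h3)
  push Not at this
  obtain ⟨c, hcg1, hcg2, hce⟩ := this
  obtain rfl := (h.anc_parent (hc2.2 c hcg1 hcg2) hch).resolve_right hce
  exact ⟨hne, hcg1, hcg2, fun c hc => (mem_cycle.1 hc).2 _ hcg1 hcg2⟩

/-- A cycle that passes through an inner vertex passes through its matched edge. -/
theorem Good.mate_mem_newBlossom (h : Good M K L l S) (hM : IsMatching M)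
    (h1 : g.1 ∈ S.verts) (h2 : g.2 ∈ S.verts) (i1 : ¬ Inner K l g.1) (i2 : ¬ Inner K l g.2)
    {v t : V} (hi : Inner K l v) (hv : v ∈ (S.newBlossom g).verts) (ht : s(v, t) ∈ M) :
    t ∈ (S.newBlossom g).verts := by
  rw [h.mem_newBlossom_iff h1 h2] at hv ⊢
  obtain ⟨hv, hc⟩ := hv
  obtain ⟨htv, -, -, hch⟩ := h.mate_of_inner hM hv hi ht
  rw [mem_cycle] at hc ⊢
  refine ⟨htv, hc.1.imp (fun h3 => ?_) (fun h3 => ?_), fun c hc1 hc2 => (hc.2 c hc1 hc2).tail hch⟩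
  · exact h.anc_mate_of_inner hM hv hi ht h3 fun heq => i1 (h.eq_of_inner h1 hv hi heq.symm ▸ hi)
  · exact h.anc_mate_of_inner hM hv hi ht h3 fun heq => i2 (h.eq_of_inner h2 hv hi heq.symm ▸ hi)

/-- The vertex where the tree enters the cycle is the lowest common ancestor of the ends of g. If it
were inner, both paths would continue through its mate, which would then be a lower common ancestor.
-/
theorem Good.enter_not_inner (h : Good M K L l S) (hM : IsMatching M)
    (h1 : g.1 ∈ S.verts) (h2 : g.2 ∈ S.verts) (i1 : ¬ Inner K l g.1) (i2 : ¬ Inner K l g.2)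
    {e : V × V} (he : e ∈ S.arcs) (he1 : e.1 ∉ (S.newBlossom g).verts)
    (he2 : e.2 ∈ (S.newBlossom g).verts) {t : V} (ht : s(e.2, t) ∈ M) : ¬ Inner K l e.2 := by
  intro hi
  have hv := (h.arcs_mem e he).2
  obtain ⟨hne, hg1, hg2, hcyc⟩ := h.anc_of_enter h1 h2 he he1 he2
  obtain ⟨-, -, -, hch⟩ := h.mate_of_inner hM hv hi ht
  have ha1 := h.anc_mate_of_inner hM hv hi ht hg1 fun heq =>
    i1 (h.eq_of_inner h1 hv hi heq.symm ▸ hi)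
  have ha2 := h.anc_mate_of_inner hM hv hi ht hg2 fun heq =>
    i2 (h.eq_of_inner h2 hv hi heq.symm ▸ hi)
  have hc := (mem_cycle.1 ((h.mem_newBlossom_iff h1 h2).1 he2).2).2 _ ha1 ha2
  exact h.acyclic hch hc

/-- An inner vertex on the cycle has its matched arc inside the blossom, so its label becomes 0 and
it stops being inner; inner vertices outside keep their labels. The entering vertex is outer, so the
arc into the blossom keeps its type, and subtrees of the remaining inner vertices do not grow. -/
theorem Good.good_contract (h : Good M K L l S) (hM : IsMatching M)
    (hmate : ∀ x ∈ S.verts, Inner K l x → ∃ t, s(x, t) ∈ M)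
    (h1 : g.1 ∈ S.verts) (h2 : g.2 ∈ S.verts) (i1 : ¬ Inner K l g.1) (i2 : ¬ Inner K l g.2)
    (hne : S.top g.1 ≠ S.top g.2)
    (hl : ∀ x, l' x = if ∃ y, s(x, y) ∈ M ∧ x ∈ (S.newBlossom g).verts ∧
      y ∈ (S.newBlossom g).verts then 0 else l x) : Good M K L l' (S.contract g) := by
  set B := (S.newBlossom g).verts with hB
  have hBm : ∀ {x}, x ∈ B ↔ x ∈ S.verts ∧ S.top x ∈ S.cycle g := h.mem_newBlossom_iff h1 h2
  have hBv : ∀ {x}, x ∈ B → x ∈ S.verts := fun hx => (hBm.1 hx).1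
  have hg1 : g.1 ∈ B := hBm.2 ⟨h1, left_mem_cycle⟩
  have hg2 : g.2 ∈ B := hBm.2 ⟨h2, right_mem_cycle⟩
  have tin : ∀ {x}, x ∈ B → (S.contract g).top x = B := fun hx => h.top_contract_of_mem h1 h2 hx
  have tout : ∀ {x}, x ∉ B → (S.contract g).top x = S.top x := fun hx => top_contract_of_notMem hx
  have hBtop : ∀ {x y}, S.top x = S.top y → y ∈ B → x ∈ B := fun hxy hy =>
    hBm.2 ⟨h.mem_of_top_eq (hBv hy) hxy, hxy ▸ (hBm.1 hy).2⟩
  have teq : ∀ {x y}, y ∈ S.verts → S.top x = S.top y →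
      (S.contract g).top x = (S.contract g).top y := by
    intro x y hy hxy
    by_cases hyB : y ∈ B
    · rw [tin hyB, tin (hBtop hxy hyB)]
    · rw [tout hyB, tout fun hxB => hyB (hBtop hxy.symm hxB), hxy]
  -- The only identification made by the contraction is that of the nodes on the cycle.
  have teq' : ∀ {x y}, x ∈ S.verts → y ∈ S.verts →
      (S.contract g).top x = (S.contract g).top y → S.top x = S.top y ∨ (x ∈ B ∧ y ∈ B) := by
    intro x y hx hy hxy
    by_cases hxB : x ∈ B <;> by_cases hyB : y ∈ B
    · exact Or.inr ⟨hxB, hyB⟩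
    · rw [tin hxB, tout hyB] at hxy
      exact absurd (hxy ▸ h.self_mem y hy) hyB
    · rw [tout hxB, tin hyB] at hxy
      exact absurd (hxy ▸ h.self_mem x hx) hxB
    · rw [tout hxB, tout hyB] at hxy
      exact Or.inl hxy
  have hle : ∀ x, l' x ≤ l x := fun x => by rw [hl]; split_ifs <;> simp
  have hin : ∀ {x}, Inner K l' x → Inner K l x ∧ l' x = l x ∧
      ¬ ∃ y, s(x, y) ∈ M ∧ x ∈ B ∧ y ∈ B := by
    intro x hx
    by_cases hc : ∃ y, s(x, y) ∈ M ∧ x ∈ B ∧ y ∈ B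
    · have := hx.1
      rw [hl, if_pos hc] at this
      omega
    · have h3 : l' x = l x := by rw [hl, if_neg hc]
      exact ⟨⟨h3 ▸ hx.1, h3 ▸ hx.2⟩, h3, hc⟩
  have hin' : ∀ {x}, Inner K l x → (¬ ∃ y, s(x, y) ∈ M ∧ x ∈ B ∧ y ∈ B) → Inner K l' x := by
    intro x hx hc
    have h3 : l' x = l x := by rw [hl, if_neg hc]
    exact ⟨h3.symm ▸ hx.1, h3.symm ▸ hx.2⟩
  have hinB : ∀ {x}, x ∈ S.verts → Inner K l' x → x ∉ B := by
    intro x hx hi hxB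
    obtain ⟨h3, -, h4⟩ := hin hi
    obtain ⟨t, ht⟩ := hmate x hx h3
    exact h4 ⟨t, ht, hxB, h.mate_mem_newBlossom hM h1 h2 i1 i2 h3 hxB ht⟩
  have hchild : ∀ {p c}, (S.contract g).Child p c → ∃ e ∈ S.arcs, (S.contract g).top e.1 = p ∧
      (S.contract g).top e.2 = c ∧ (S.contract g).top e.1 ≠ (S.contract g).top e.2 := by
    intro p c hc
    obtain ⟨e, he, h3⟩ := hc.exists_arc
    rcases Finset.mem_insert.1 he with rfl | he
    · exact absurd ((tin hg1).trans (tin hg2).symm) h3.2.2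
    · exact ⟨e, he, h3⟩
  -- If the root is swallowed, an arc entering the blossom would end at an ancestor of the root,
  -- hence at the root itself.
  have hroot : ∀ p, ¬ (S.contract g).Child p ((S.contract g).top S.root) := by
    intro p hp
    obtain ⟨e, he, h3, h4, h5⟩ := hchild hp
    have hev := h.arcs_mem e he
    have hne' : S.top e.1 ≠ S.top e.2 := fun h6 => h5 (teq hev.2 h6)
    rcases teq' hev.2 h.root_mem h4 with h6 | ⟨h6, h7⟩
    · exact h.root_no_parent _ (h6 ▸ child_of_arc he hne')
    · have h8 : e.1 ∉ B := fun h8 => h5 ((tin h8).trans (tin h6).symm)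
      have h9 := (h.anc_of_enter h1 h2 he h8 h6).2.2.2 _ (hBm.1 h7).2
      have h10 := h.anc_antisymm h9 (h.conn _ hev.2)
      exact h.root_no_parent _ (h10 ▸ child_of_arc he hne')
  have hanc : ∀ {a c}, S.Anc a c → ∀ x ∈ S.verts, ∀ y ∈ S.verts, a = S.top x → c = S.top y →
      (S.contract g).Anc ((S.contract g).top x) ((S.contract g).top y) := by
    intro a c hac
    induction hac with
    | refl =>
      rintro x hx y hy rfl h3
      rw [teq hy h3]
      exact Relation.ReflTransGen.refl
    | @tail b c _ hbc ih =>
      rintro x hx y hy rfl rfl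
      obtain ⟨e, he, h3, h4, h5⟩ := hbc.exists_arc
      have hev := h.arcs_mem e he
      have h6 := ih x hx e.1 hev.1 rfl h3.symm
      rw [← teq hy h4]
      by_cases h7 : (S.contract g).top e.1 = (S.contract g).top e.2
      · rwa [← h7]
      · exact h6.tail (child_of_arc (Finset.mem_insert_of_mem he) h7)
  -- Descent in the new tree is descent in the old one, when it starts outside the blossom: a path
  -- enters the blossom at the lowest common ancestor, which is above every node of the cycle.
  have hanc' : ∀ {v c}, v ∈ S.verts → v ∉ B → (S.contract g).Anc (S.top v) c →
      ∀ x ∈ S.verts, (S.contract g).top x = c → S.Anc (S.top v) (S.top x) := by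
    intro v c hv hvB hac
    induction hac with
    | refl =>
      intro x hx hxv
      rw [← tout hvB] at hxv
      rcases teq' hx hv hxv with h3 | ⟨-, h3⟩
      · rw [h3]; exact Relation.ReflTransGen.refl
      · exact absurd h3 hvB
    | @tail b c _ hbc ih =>
      intro x hx hxc
      obtain ⟨e, he, h3, h4, h5⟩ := hchild hbc
      have hev := h.arcs_mem e he
      have hne' : S.top e.1 ≠ S.top e.2 := fun h6 => h5 (teq hev.2 h6)
      have h6 := (ih e.1 hev.1 h3).tail (child_of_arc he hne')
      rcases teq' hev.2 hx (h4.trans hxc.symm) with h7 | ⟨h7, h8⟩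
      · rwa [← h7]
      · have h9 : e.1 ∉ B := fun h9 => h5 ((tin h9).trans (tin h7).symm)
        exact h6.trans ((h.anc_of_enter h1 h2 he h9 h7).2.2.2 _ (hBm.1 h8).2)
  refine ⟨h.root_mem, ?_, ?_, ?_, ?_, ?_, ?_, ?_, hroot, ?_, ?_, ?_, ?_, ?_, ?_, ?_⟩
  · intro e he
    rcases Finset.mem_insert.1 he with rfl | he
    · exact ⟨h1, h2⟩
    · exact h.arcs_mem e he
  · intro b hb
    rcases Finset.mem_insert.1 hb with rfl | hb
    · exact fun x hx => hBv hx
    · exact h.blossom_sub b hb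
  · intro b hb
    rcases Finset.mem_insert.1 hb with rfl | hb
    · exact ⟨_, hg1⟩
    · exact h.blossom_nonempty b hb
  · intro b hb
    rcases Finset.mem_insert.1 hb with rfl | hb
    · intro e he x hx
      rw [← hB]
      simp only [newBlossom, Finset.mem_union, Finset.mem_sup, Finset.mem_filter,
        Finset.mem_image, Finset.mem_singleton] at he
      rcases he with (⟨b, ⟨hb, c, hc, hbc⟩, he⟩ | ⟨a, ⟨ha, -, h3, h4⟩, rfl⟩) | rfl
      · exact mem_newBlossom_verts.2 ⟨c, hc, hbc (h.blossom_edges b hb e he x hx)⟩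
      · rcases Sym2.mem_iff.1 hx with rfl | rfl
        · exact hBm.2 ⟨(h.arcs_mem a ha).1, h3⟩
        · exact hBm.2 ⟨(h.arcs_mem a ha).2, h4⟩
      · rcases Sym2.mem_iff.1 hx with rfl | rfl
        · exact hg1
        · exact hg2
    · exact h.blossom_edges b hb
  · intro x hx
    by_cases hxB : x ∈ B
    · rwa [tin hxB]
    · rw [tout hxB]; exact h.self_mem x hx
  · intro x hx y hy
    by_cases hxB : x ∈ B
    · rw [tin hxB] at hy ⊢
      exact tin hy
    · rw [tout hxB] at hy
      exact teq hx (h.part x hx y hy)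
  · intro p q c hp hq
    obtain ⟨e, he, e1, e2, e3⟩ := hchild hp
    obtain ⟨f, hf, f1, f2, f3⟩ := hchild hq
    have hev := h.arcs_mem e he
    have hfv := h.arcs_mem f hf
    have ec := child_of_arc he fun h6 => e3 (teq hev.2 h6)
    have fc := child_of_arc hf fun h6 => f3 (teq hfv.2 h6)
    -- Two arcs into the blossom end at nodes that are ancestors of each other, hence at the same
    -- old node, whose parent is unique.
    have key : S.top e.2 = S.top f.2 := by
      rcases teq' hev.2 hfv.2 (e2.trans f2.symm) with h3 | ⟨h3, h4⟩
      · exact h3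
      · have h5 : e.1 ∉ B := fun h5 => e3 ((tin h5).trans (tin h3).symm)
        have h6 : f.1 ∉ B := fun h6 => f3 ((tin h6).trans (tin h4).symm)
        exact h.anc_antisymm ((h.anc_of_enter h1 h2 he h5 h3).2.2.2 _ (hBm.1 h4).2)
          ((h.anc_of_enter h1 h2 hf h6 h4).2.2.2 _ (hBm.1 h3).2)
    rw [← e1, ← f1]
    exact teq hfv.1 (h.uniq _ _ _ ec (key ▸ fc))
  · intro x hx
    exact hanc (h.conn x hx) S.root h.root_mem x hx rfl rfl
  · intro x hx hi
    rw [tout (hinB hx hi)]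
    exact h.inner_top x hx (hin hi).1
  · intro e he hne'
    rcases Finset.mem_insert.1 he with rfl | he
    · exact absurd ((tin hg1).trans (tin hg2).symm) hne'
    have hev := h.arcs_mem e he
    rcases h.arc_type e he fun h6 => hne' (teq hev.2 h6) with ⟨h3, h4, h5⟩ | ⟨h3, h4, h5⟩
    · refine Or.inl ⟨h3, hin' h4 ?_, fun h6 => h5 (hin h6).1⟩
      rintro ⟨y, hy, h6, h7⟩
      obtain rfl := hM.mate_eq hy h3
      exact hne' ((tin h6).trans (tin h7).symm)
    · refine Or.inr ⟨h3, fun h6 => h4 (hin h6).1, hin' h5 ?_⟩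
      rintro ⟨y, hy, h6, h7⟩
      refine h.enter_not_inner hM h1 h2 i1 i2 he (fun h8 => ?_) h6 hy h5
      exact hne' ((tin h8).trans (tin h6).symm)
  · intro x hx y hxy
    obtain ⟨hy, h3⟩ := h.mate x hx y hxy
    refine ⟨hy, ?_⟩
    by_cases h4 : (S.contract g).top x = (S.contract g).top y
    · exact Or.inl h4
    right
    have h5 : S.top x ≠ S.top y := fun h5 => h4 (teq hy h5)
    have h6 : ¬ (x ∈ B ∧ y ∈ B) := fun h6 => h4 ((tin h6.1).trans (tin h6.2).symm)
    refine (h3.resolve_left h5).imp (fun h7 => ?_) fun h7 => ?_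
    · refine ⟨hin' h7.1 ?_, fun h8 => h7.2.1 (hin h8).1, Finset.mem_insert_of_mem h7.2.2⟩
      rintro ⟨z, hz, h8⟩
      obtain rfl := hM.mate_eq hz hxy
      exact h6 h8
    · refine ⟨hin' h7.1 ?_, fun h8 => h7.2.1 (hin h8).1, Finset.mem_insert_of_mem h7.2.2⟩
      rintro ⟨z, hz, h8⟩
      obtain rfl := hM.mate_eq hz (Sym2.eq_swap ▸ hxy)
      exact h6 h8.symm
  · intro w hw w' hw' i i' ha
    rw [tout (hinB hw i)] at ha
    rw [(hin i).2.1, (hin i').2.1]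
    exact h.mono w hw w' hw' (hin i).1 (hin i').1 (hanc' hw (hinB hw i) ha w' hw' rfl)
  · intro w hw i
    rw [(hin i).2.1]
    refine le_trans ?_ (h.size w hw (hin i).1)
    gcongr
    intro x hx
    rw [Good.mem_subtree] at hx ⊢
    rw [tout (hinB hw i)] at hx
    exact ⟨hx.1, hanc' hw (hinB hw i) hx.2 x hx.1 rfl⟩
  · intro x hx
    by_cases hxB : x ∈ B
    · rw [tin hxB]
      -- The count for B is at most one plus the sum of 2|c| - 1 over the nodes c of the cycle. As
      -- the cycle has at least two nodes, this is at most 2|B| - 1.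
      have hsub : ((S.contract g).blossoms.filter fun b => b.verts ⊆ B) ⊆
          insert (S.newBlossom g)
            ((S.cycle g).biUnion fun c => S.blossoms.filter fun b => b.verts ⊆ c) := by
        intro b hb
        rw [Finset.mem_filter] at hb
        rcases Finset.mem_insert.1 hb.1 with rfl | h3
        · exact Finset.mem_insert_self _ _
        · obtain ⟨y, hy⟩ := h.blossom_nonempty b h3
          refine Finset.mem_insert_of_mem (Finset.mem_biUnion.2
            ⟨_, (hBm.1 (hb.2 hy)).2, Finset.mem_filter.2 ⟨h3, fun z hz => ?_⟩⟩)
          exact mem_top.2 ⟨b, h3, hy, hz⟩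
      have hc1 := (Finset.card_le_card hsub).trans (Finset.card_insert_le _ _)
      have hc2 := Finset.card_biUnion_le (s := S.cycle g)
        (t := fun c => S.blossoms.filter fun b => b.verts ⊆ c)
      have hc3 : B.card = ∑ c ∈ S.cycle g, c.card := by
        have : B = (S.cycle g).biUnion id := by
          ext y; rw [mem_newBlossom_verts]; simp
        rw [this, Finset.card_biUnion]
        · rfl
        · intro c hc d hd hcd
          obtain ⟨y, hy, rfl⟩ := h.cycle_node h1 h2 hc
          obtain ⟨z, hz, rfl⟩ := h.cycle_node h1 h2 hd
          refine Finset.disjoint_left.2 fun a ha hb => hcd ?_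
          exact (h.part y hy a ha).symm.trans (h.part z hz a hb)
      have hc4 : ∑ c ∈ S.cycle g, ((S.blossoms.filter fun b => b.verts ⊆ c).card + 1) ≤
          ∑ c ∈ S.cycle g, 2 * c.card := by
        refine Finset.sum_le_sum fun c hc => ?_
        obtain ⟨y, hy, rfl⟩ := h.cycle_node h1 h2 hc
        exact h.count y hy
      rw [Finset.sum_add_distrib, ← Finset.mul_sum, ← hc3, Finset.sum_const, smul_eq_mul,
        mul_one] at hc4
      have hc5 : 1 < (S.cycle g).card :=
        Finset.one_lt_card.2 ⟨_, left_mem_cycle, _, right_mem_cycle, hne⟩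
      omega
    · rw [tout hxB]
      refine le_trans (Nat.add_le_add_right (Finset.card_le_card fun b hb => ?_) 1) (h.count x hx)
      rw [Finset.mem_filter] at hb ⊢
      rcases Finset.mem_insert.1 hb.1 with rfl | h3
      · exact absurd (hBtop (h.part x hx _ (hb.2 hg1)).symm hg1) hxB
      · exact ⟨h3, hb.2⟩

end Struct

end Contraction

end EpsMM

namespace EpsMM

open scoped Classical

/-! ### The structure of a free vertex under the operations of the algorithm, and its space -/

section Operations

variable {V : Type*}

namespace Struct

/-- The invariant of the structure of a free vertex. -/
structure OK (M : Finset (Sym2 V)) (K L : ℕ) (l : V → ℕ) (S : Struct V) : Prop where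
  good : Good M K L l S
  root_free : ∀ e ∈ M, S.root ∉ e
  eq_root : ∀ x ∈ S.verts, (∀ e ∈ M, x ∉ e) → x = S.root
  root_not_inner : ¬ Inner K l S.root
  work : ∀ w, S.working = some w → ∃ x ∈ S.verts, S.top x = w ∧ ¬ Inner K l x
  card_le : S.verts.card ≤ L * (K + 2)
  -- Overtaking and contracting set `modified`, so a structure with both marks false has not grown
  -- since it was created or last compared with the limit.
  hold : S.onHold = false → S.modified = false → S.verts.card < L

variable {M : Finset (Sym2 V)} {K L : ℕ} {l : V → ℕ} {S T : Struct V} {u v t : V} {d : ℕ}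

theorem OK.exists_mate (h : OK M K L l S) {x : V} (hx : x ∈ S.verts) (hne : x ≠ S.root) :
    ∃ y, s(x, y) ∈ M := by
  by_contra hcon
  push Not at hcon
  refine hne (h.eq_root x hx fun e he hxe => ?_)
  obtain ⟨y, rfl⟩ := hxe
  exact hcon y he

theorem OK.exists_mate_of_inner (h : OK M K L l S) {x : V} (hx : x ∈ S.verts)
    (hi : Inner K l x) : ∃ y, s(x, y) ∈ M :=
  h.exists_mate hx fun heq => h.root_not_inner (heq ▸ hi)

theorem OK.congr_label (h : OK M K L l S) {l' : V → ℕ} (hl : ∀ x ∈ S.verts, l' x = l x) :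
    OK M K L l' S := by
  have hi : ∀ x ∈ S.verts, (Inner K l' x ↔ Inner K l x) := fun x hx => by
    simp [Inner, hl x hx]
  refine ⟨h.good.congr_label hl, h.root_free, h.eq_root, ?_, ?_, h.card_le, h.hold⟩
  · rw [hi _ h.good.root_mem]; exact h.root_not_inner
  · intro w hw
    obtain ⟨x, hx, h1, h2⟩ := h.work w hw
    exact ⟨x, hx, h1, by rwa [hi x hx]⟩

theorem ok_single (α : V) (hf : ∀ e ∈ M, α ∉ e) (hi : ¬ Inner K l α) (hL : 2 ≤ L) :
    OK M K L l (single α) := by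
  have htop : (single α).top α = {α} := by
    ext y; simp [mem_top, single, Blossom.trivial]
  refine ⟨good_single α (fun y hy => hf _ hy (by simp)) hi, hf, by simp [single], hi, ?_, ?_, ?_⟩
  · intro w hw
    have : w = {α} := by simpa [single, eq_comm] using hw
    subst this
    exact ⟨α, by simp [single], htop, hi⟩
  · have : (single α).verts.card = 1 := by simp [single]
    rw [this]; nlinarith
  · intro _ _
    have : (single α).verts.card = 1 := by simp [single]
    omega

theorem OK.mark (h : OK M K (limit i) l S) : OK M K (limit i) l (S.mark i) := by
  refine ⟨h.good.congr rfl rfl rfl rfl, h.root_free, h.eq_root, h.root_not_inner, h.work,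
    h.card_le, fun h1 _ => ?_⟩
  simpa [Struct.mark] using h1

theorem OK.exists_outer_parent (h : OK M K L l S) {v : V} (hv : v ∈ S.verts)
    (hi : Inner K l v) {p : Finset V} (hp : S.parent (S.top v) = some p) :
    ∃ x ∈ S.verts, S.top x = p ∧ ¬ Inner K l x ∧ S.Child p (S.top v) := by
  unfold Struct.parent at hp
  split_ifs at hp with hex
  have hc : S.Child p (S.top v) := by
    have := hex.choose_spec
    rwa [Option.some.inj hp] at this
  obtain ⟨e, he, h1, h2, h3⟩ := hc.exists_arc
  refine ⟨e.1, (h.good.arcs_mem e he).1, h1, ?_, hc⟩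
  obtain rfl := h.good.eq_of_inner (h.good.arcs_mem e he).2 hv hi h2
  rcases h.good.arc_type e he h3 with ⟨-, -, h4⟩ | ⟨-, h4, -⟩
  · exact absurd hi h4
  · exact h4

/-- The working vertex is outer, so its parent is inner and its grandparent outer again. -/
theorem OK.backtrack (h : OK M K L l S) : OK M K L l S.backtrack := by
  unfold Struct.backtrack
  split_ifs with h1
  · exact h
  cases hw : S.working with
  | none => exact h
  | some w =>
    refine ⟨h.good.congr rfl rfl rfl rfl, h.root_free, h.eq_root, h.root_not_inner, ?_,
      h.card_le, h.hold⟩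
    intro w' hw'
    simp only at hw'
    split_ifs at hw' with h2
    rw [Option.bind_eq_some_iff] at hw'
    obtain ⟨p, hp, hw'⟩ := hw'
    have hp' := hp
    obtain ⟨x, hx, rfl, hxi⟩ := h.work w hw
    unfold Struct.parent at hp
    split_ifs at hp with hex
    have hc : S.Child p (S.top x) := by
      have := hex.choose_spec
      rwa [Option.some.inj hp] at this
    obtain ⟨e, he, h4, h5, h6⟩ := hc.exists_arc
    have hev := h.good.arcs_mem e he
    rcases h.good.arc_type e he h6 with ⟨-, h7, -⟩ | ⟨-, -, h7⟩
    · rw [← h4] at hw'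
      obtain ⟨y, hy, h8, h9, -⟩ := h.exists_outer_parent hev.1 h7 hw'
      exact ⟨y, hy, h8, h9⟩
    · exact absurd ((h.good.inner_iff_of_top_eq hev.2 hx h5).1 h7) hxi

theorem OK.lose (h : OK M K L l T) (hM : IsMatching M) (hv : v ∈ T.verts) (hi : Inner K l v)
    (ht : s(v, t) ∈ M) : OK M K L l (T.lose v t) := by
  have hroot := h.good.root_notMem_subtree hv hi h.root_not_inner
  have hg := h.good.good_cut hv hi h.root_not_inner
  refine ⟨hg.congr rfl rfl rfl rfl, h.root_free, ?_, h.root_not_inner, ?_, ?_, ?_⟩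
  · intro x hx
    exact h.eq_root x (Finset.sdiff_subset hx)
  · have hfin : ∀ x ∈ T.verts, x ∉ T.subtree v → ¬ Inner K l x → ∃ y ∈ (T.lose v t).verts,
        (T.lose v t).top y = T.top x ∧ ¬ Inner K l y := fun x hx hxv hxi =>
      ⟨x, Finset.mem_sdiff.2 ⟨hx, hxv⟩, top_cut hxv, hxi⟩
    intro w hw
    simp only [Struct.lose] at hw
    split_ifs at hw with hwu
    · obtain ⟨x, hx, h1, h2, h3⟩ := h.exists_outer_parent hv hi hw
      rw [← h1]
      refine hfin x hx (fun hxv => ?_) h2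
      exact h.good.acyclic h3 (h1 ▸ (Good.mem_subtree.1 hxv).2)
    -- A working vertex in the subtree of v is outer, hence different from v, hence below the mate
    -- t. Such a working vertex has been replaced by the parent of v.
    · obtain ⟨x, hx, rfl, h2⟩ := h.work w hw
      refine hfin x hx (fun hxv => hwu ⟨_, hw, ?_⟩) h2
      refine h.good.anc_mate_of_inner hM hv hi ht (Good.mem_subtree.1 hxv).2 fun heq => ?_
      exact h2 ((h.good.inner_iff_of_top_eq hv hx heq).1 hi)
  · exact (Finset.card_le_card Finset.sdiff_subset).trans h.card_le
  · intro _ h2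
    simp [Struct.lose] at h2

theorem not_inner_update (hi : Inner K l v) {x : V} (hx : ¬ Inner K l x) {k : ℕ} :
    ¬ Inner K (Function.update l v k) x := by
  have : x ≠ v := fun h => hx (h ▸ hi)
  simpa [Inner, this] using hx

theorem OK.gain (h : OK M K L l S) (hT : OK M K L l T) (hM : IsMatching M)
    (hd : Disjoint S.verts T.verts) (hu : u ∈ S.verts) (hui : ¬ Inner K l u) (hv : v ∈ T.verts)
    (hi : Inner K l v) (ht : s(v, t) ∈ M) (huv : s(u, v) ∉ M) (hc : S.verts.card < L)
    (hlow : ∀ w ∈ S.verts, Inner K l w → S.Anc (S.top w) (S.top u) → l w ≤ d)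
    (hdv : d + 1 < l v) : OK M K L (Function.update l v (d + 1)) (S.gain T u v t) := by
  set l' := Function.update l v (d + 1) with hl'
  have hsub : T.subtree v ⊆ T.verts := Finset.filter_subset _ _
  have hvS : v ∉ S.verts := fun h1 => Finset.disjoint_left.1 hd h1 hv
  have hlS : ∀ x ∈ S.verts, l' x = l x := fun x hx =>
    Function.update_of_ne (fun h1 : x = v => hvS (h1 ▸ hx)) _ _
  have hS' := h.congr_label hlS
  have hP := (hT.good.good_piece hv hi).lower_root hi (k := d + 1) (by omega) hdv.le
  change Good M K L l' (T.piece v) at hP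
  have hd' : Disjoint S.verts (T.piece v).verts := hd.mono_right hsub
  have hiv : Inner K l' v := by
    simp only [Inner, hl', Function.update_self]
    exact ⟨by omega, hdv.le.trans hi.2⟩
  have hroot := hT.good.root_notMem_subtree hv hi hT.root_not_inner
  have hui' : ¬ Inner K l' u := not_inner_update hi hui
  have hsize := hT.good.size v hv hi
  -- The bound is taken at the old label of v, at least d + 2, although the new label is d + 1; the
  -- difference is one more L, which covers the vertices of S.
  have hsize2 : (T.subtree v).card + L * (d + 2) ≤ L * (K + 2) :=
    le_trans (by gcongr; omega) hsize
  have hJ := hS'.good.good_join hP hd' hu hui' hiv huv (d := d)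
    (fun w hw hwi hwa => by
      rw [hlS w hw]
      refine hlow w hw ?_ hwa
      simpa [Inner, hlS w hw] using hwi) (by simp [hl', piece]) hc.le hsize2
  refine ⟨hJ.congr rfl rfl rfl rfl, h.root_free, ?_, hS'.root_not_inner, ?_, ?_, ?_⟩
  · intro x hx hf
    rcases Finset.mem_union.1 hx with hx | hx
    · exact h.eq_root x hx hf
    · exact absurd (hT.eq_root x (hsub hx) hf ▸ hx) hroot
  · have hfin : ∀ x ∈ T.subtree v, ¬ Inner K l x → ∃ y ∈ (S.gain T u v t).verts,
        (S.gain T u v t).top y = T.top x ∧ ¬ Inner K l' y := fun x hx hxi =>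
      ⟨x, Finset.mem_union_right _ hx, (hS'.good.top_join_right (u := u) hd' hx).trans
        (hT.good.top_piece hx), not_inner_update hi hxi⟩
    obtain ⟨htv, hti, hta, htc⟩ := hT.good.mate_of_inner hM hv hi ht
    intro w hw
    simp only [Struct.gain] at hw
    split_ifs at hw with hwu
    · obtain ⟨w', h1, h2⟩ := hwu
      obtain rfl : w' = w := Option.some.inj (h1.symm.trans hw)
      obtain ⟨x, hx, rfl, h3⟩ := hT.work w' hw
      exact hfin x (Good.mem_subtree.2 ⟨hx, Relation.ReflTransGen.head htc h2⟩) h3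
    · obtain rfl := Option.some.inj hw
      exact hfin t (Good.mem_subtree.2 ⟨htv, Relation.ReflTransGen.single htc⟩) hti
  · refine (Finset.card_union_le _ _).trans ?_
    have : L * (d + 2) = L * d + L + L := by ring
    omega
  · intro _ h2
    simp [Struct.gain] at h2

theorem OK.addArc (h : OK M K L l S) (hM : IsMatching M) (hL : 2 ≤ L) (hu : u ∈ S.verts)
    (hui : ¬ Inner K l u) (hv : v ∉ S.verts) (htS : t ∉ S.verts)
    (ht : s(v, t) ∈ M) (huv : s(u, v) ∉ M) (hc : S.verts.card < L)
    (hlow : ∀ w ∈ S.verts, Inner K l w → S.Anc (S.top w) (S.top u) → l w ≤ d)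
    (hlv : l v = K + 1) (hlt : l t = K + 1) (hdv : d + 1 < l v) :
    OK M K L (Function.update l v (d + 1)) (S.addArc u v t) := by
  set l' := Function.update l v (d + 1) with hl'
  have hlS : ∀ x ∈ S.verts, l' x = l x := fun x hx =>
    Function.update_of_ne (fun h1 : x = v => hv (h1 ▸ hx)) _ _
  have hS' := h.congr_label hlS
  have hiv : Inner K l' v := by
    simp only [Inner, hl', Function.update_self]; omega
  have hne : v ≠ t := hM.ne ht
  have hti : ¬ Inner K l' t := by
    simp only [Inner, hl', Function.update_of_ne hne.symm]; omega
  -- The old label is K + 1 and exceeds d + 1. The remaining L, at least 2, accommodates the two new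
  -- vertices.
  have huK : L * (d + 2) ≤ L * (K + 1) := Nat.mul_le_mul_left _ (by omega)
  have e1 : L * (K + 2) = L * (K + 1) + L := by ring
  have e2 : L * (d + 2) = L * (d + 1) + L := by ring
  have hP : Good M K L l' (pair v t) := by
    refine good_pair hM ht hiv hti ?_
    simp only [hl', Function.update_self]
    omega
  have hd' : Disjoint S.verts (pair v t).verts := by
    simp [pair, hv, htS]
  have hui' : ¬ Inner K l' u := by simpa [Inner, hlS u hu] using hui
  have hcard : (pair v t).verts.card ≤ 2 := Finset.card_le_two
  have hJ := hS'.good.good_join hP hd' hu hui' hiv huv (d := d)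
    (fun w hw hwi hwa => by
      rw [hlS w hw]
      refine hlow w hw ?_ hwa
      simpa [Inner, hlS w hw] using hwi) (by simp [hl', pair]) hc.le (by omega)
  refine ⟨hJ.congr rfl rfl ?_ ?_, h.root_free, ?_, hS'.root_not_inner, ?_, ?_, ?_⟩
  · ext e; simp [Struct.addArc, join, pair]
  · rfl
  · intro x hx hf
    simp only [Struct.addArc, Finset.mem_union, Finset.mem_insert, Finset.mem_singleton] at hx
    rcases hx with hx | rfl | rfl
    · exact h.eq_root x hx hf
    · exact (hf _ ht (by simp)).elim
    · exact (hf _ ht (by simp)).elim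
  · intro w hw
    obtain rfl : {t} = w := by simpa [Struct.addArc] using hw
    have htp : t ∈ (pair v t).verts := by simp [pair]
    refine ⟨t, by simp [Struct.addArc], ?_, hti⟩
    refine (hS'.good.top_join_right (u := u) hd' htp).trans ?_
    ext y; simp [mem_top, pair, Blossom.trivial, hne.symm]
  · have : (S.addArc u v t).verts.card ≤ S.verts.card + (pair v t).verts.card :=
      Finset.card_union_le _ _
    have : L * 1 ≤ L * (K + 1) := Nat.mul_le_mul_left _ (by omega)
    omega
  · intro _ h2
    simp [Struct.addArc] at h2

/-- Rerouting inside one structure is a cut followed by a join of the same two parts, so it reduces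
to the case of two trees. -/
theorem OK.reroute (h : OK M K L l S) (hM : IsMatching M) (hu : u ∈ S.verts)
    (hui : ¬ Inner K l u) (hv : v ∈ S.verts) (hi : Inner K l v)
    (ht : s(v, t) ∈ M) (huv : s(u, v) ∉ M) (hc : S.verts.card < L)
    (hlow : ∀ w ∈ S.verts, Inner K l w → S.Anc (S.top w) (S.top u) → l w ≤ d)
    (hdv : d + 1 < l v) : OK M K L (Function.update l v (d + 1)) (S.reroute u v t) := by
  set l' := Function.update l v (d + 1) with hl'
  have hsub : S.subtree v ⊆ S.verts := Finset.filter_subset _ _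
  -- If v were above u, its label would be at most d, against d + 1 < l v. This is why an overtake
  -- creates no cycle.
  have hu' : u ∉ S.subtree v := fun h1 => by
    have := hlow v hv hi (Good.mem_subtree.1 h1).2
    omega
  have hvv := Good.self_mem_subtree hv
  have hC := h.good.good_cut hv hi h.root_not_inner
  have hCm : ∀ {x}, x ∈ (S.cut v).verts ↔ x ∈ S.verts ∧ x ∉ S.subtree v := by simp [cut]
  have hlC : ∀ x ∈ (S.cut v).verts, l' x = l x := fun x hx =>
    Function.update_of_ne (fun h1 : x = v => (hCm.1 hx).2 (h1 ▸ hvv)) _ _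
  have hC' := hC.congr_label hlC
  have hP := (h.good.good_piece hv hi).lower_root hi (k := d + 1) (by omega) hdv.le
  change Good M K L l' (S.piece v) at hP
  have hd' : Disjoint (S.cut v).verts (S.piece v).verts := Finset.sdiff_disjoint
  have hiv : Inner K l' v := by
    simp only [Inner, hl', Function.update_self]
    exact ⟨by omega, hdv.le.trans hi.2⟩
  have hui' : ¬ Inner K l' u := not_inner_update hi hui
  have hsize := h.good.size v hv hi
  have hsize2 : (S.subtree v).card + L * (d + 2) ≤ L * (K + 2) :=
    le_trans (by gcongr; omega) hsize
  have huC : u ∈ (S.cut v).verts := hCm.2 ⟨hu, hu'⟩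
  have hJ := hC'.good_join hP hd' huC hui' hiv huv (d := d)
    (fun w hw hwi hwa => by
      rw [hlC w hw]
      refine hlow w (hCm.1 hw).1 (by simpa [Inner, hlC w hw] using hwi) ?_
      rw [top_cut (hCm.1 hw).2, top_cut hu'] at hwa
      exact h.good.anc_of_cut hv hi hwa) (by simp [hl', piece])
      ((Finset.card_le_card Finset.sdiff_subset).trans hc.le) hsize2
  refine ⟨hJ.congr rfl ?_ ?_ ?_, h.root_free, h.eq_root,
    not_inner_update hi h.root_not_inner, ?_, h.card_le, ?_⟩
  · ext x
    by_cases hx : x ∈ S.subtree v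
    · simp [Struct.reroute, join, cut, piece, hx, hsub hx]
    · simp [Struct.reroute, join, cut, piece, hx]
  · ext e
    simp only [Struct.reroute, join, Finset.mem_union, h.good.mem_cut_arcs hv hi, mem_piece_arcs,
      Finset.mem_sdiff, Finset.mem_singleton, parentArcs, Finset.mem_filter]
    -- An arc of S has both ends on the same side of the cut exactly when it is not the parent arc
    -- of v. This identifies the arcs of `reroute` with those of the join.
    have key : e ∈ S.arcs → ((e.1 ∉ S.subtree v ∧ e.2 ∉ S.subtree v) ∨
        (e.1 ∈ S.subtree v ∧ e.2 ∈ S.subtree v) ↔ ¬ (e.2 = v ∧ S.top e.1 ≠ S.top v)) := by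
      intro he
      constructor
      · rintro (h1 | h1) ⟨h2, h3⟩
        · exact h1.2 (h2 ▸ hvv)
        · refine h.good.acyclic (child_of_arc he (h2 ▸ h3)) (h2 ▸ (Good.mem_subtree.1 h1.1).2)
      · intro h1
        by_cases h2 : e.1 ∈ S.subtree v
        · exact Or.inr ⟨h2, h.good.mem_subtree_of_child he h2⟩
        · refine Or.inl ⟨h2, fun h3 => ?_⟩
          rcases h.good.mem_subtree_parent he h3 with h4 | ⟨h4, h5⟩
          · exact h2 h4
          · exact h1 ⟨h.good.eq_of_inner (h.good.arcs_mem e he).2 hv hi h4.symm, h4 ▸ h5⟩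
    show _ ∨ e = (u, v) ↔ (_ ∨ e = (u, v)) ∨ _
    constructor
    · rintro (⟨h1, h2⟩ | h1)
      · have h2' : ¬ (e.2 = v ∧ S.top e.1 ≠ S.top v) := fun h3 => h2 ⟨h1, h3⟩
        rcases (key h1).2 h2' with h3 | h3
        · exact Or.inl (Or.inl ⟨h1, h3⟩)
        · exact Or.inr ⟨h1, h3⟩
      · exact Or.inl (Or.inr h1)
    · rintro ((⟨h1, h2⟩ | h1) | ⟨h1, h2⟩)
      · exact Or.inl ⟨h1, fun h3 => (key h1).1 (Or.inl h2) h3.2⟩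
      · exact Or.inr h1
      · exact Or.inl ⟨h1, fun h3 => (key h1).1 (Or.inr h2) h3.2⟩
  · ext b
    simp only [Struct.reroute, join, cut, piece, Finset.mem_union, Finset.mem_filter]
    tauto
  · intro w hw
    obtain rfl : S.top t = w := by simpa [Struct.reroute] using hw
    obtain ⟨htv, hti, -⟩ := h.good.mate_of_inner hM hv hi ht
    exact ⟨t, htv, rfl, not_inner_update hi hti⟩
  · intro _ h2
    simp [Struct.reroute] at h2

theorem OK.contract [Fintype V] (h : OK M K L l S) (hM : IsMatching M) {g : V × V} {l' : V → ℕ}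
    (h1 : g.1 ∈ S.verts) (h2 : g.2 ∈ S.verts) (i1 : ¬ Inner K l g.1) (i2 : ¬ Inner K l g.2)
    (hne : S.top g.1 ≠ S.top g.2)
    (hl : ∀ x, l' x = if ∃ y, s(x, y) ∈ M ∧ x ∈ (S.newBlossom g).verts ∧
      y ∈ (S.newBlossom g).verts then 0 else l x) : OK M K L l' (S.contract g) := by
  have hg := h.good.good_contract hM (fun x hx => h.exists_mate_of_inner hx) h1 h2 i1 i2 hne hl
  have hle : ∀ x, ¬ Inner K l x → ¬ Inner K l' x := fun x => by
    simp only [Inner, hl]; split_ifs <;> simp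
  refine ⟨hg, h.root_free, h.eq_root, hle _ h.root_not_inner, ?_, h.card_le, ?_⟩
  · intro w hw
    obtain rfl : (S.newBlossom g).verts = w := by simpa [Struct.contract] using hw
    exact ⟨g.1, h1, h.good.top_contract_of_mem h1 h2
      ((h.good.mem_newBlossom_iff h1 h2).2 ⟨h1, left_mem_cycle⟩), hle _ i1⟩
  · intro _ h2
    simp [Struct.contract] at h2

/-! ### The space of a structure -/

/-- Each blossom lies inside a single node and the nodes are disjoint, so the counts for the nodes
add up. -/
theorem Good.blossoms_card_le (h : Good M K L l S) : S.blossoms.card ≤ 2 * S.verts.card := by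
  set N := S.verts.image S.top with hN
  have hsub : S.blossoms ⊆ N.biUnion fun c => S.blossoms.filter fun b => b.verts ⊆ c := by
    intro b hb
    obtain ⟨y, hy⟩ := h.blossom_nonempty b hb
    refine Finset.mem_biUnion.2 ⟨S.top y, Finset.mem_image_of_mem _ (h.blossom_sub b hb hy),
      Finset.mem_filter.2 ⟨hb, fun z hz => mem_top.2 ⟨b, hb, hy, hz⟩⟩⟩
  have hc1 : ∑ c ∈ N, (S.blossoms.filter fun b => b.verts ⊆ c).card ≤ ∑ c ∈ N, 2 * c.card := by
    refine Finset.sum_le_sum fun c hc => ?_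
    obtain ⟨y, hy, rfl⟩ := Finset.mem_image.1 hc
    have := h.count y hy
    omega
  have hc2 : ∑ c ∈ N, c.card ≤ S.verts.card := by
    have hdis := Finset.card_biUnion (s := N) (t := id) ?_
    · refine hdis.symm.le.trans ?_
      refine Finset.card_le_card fun x hx => ?_
      obtain ⟨c, hc, hx⟩ := Finset.mem_biUnion.1 hx
      obtain ⟨y, -, rfl⟩ := Finset.mem_image.1 hc
      exact h.top_sub y hx
    · intro c hc d hd hcd
      obtain ⟨y, hy, rfl⟩ := Finset.mem_image.1 hc
      obtain ⟨z, hz, rfl⟩ := Finset.mem_image.1 hd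
      refine Finset.disjoint_left.2 fun a ha hb => hcd ?_
      exact (h.part y hy a ha).symm.trans (h.part z hz a hb)
  rw [← Finset.mul_sum] at hc1
  have := (Finset.card_le_card hsub).trans Finset.card_biUnion_le
  omega

theorem card_le_sq_of_subset {A : Finset V} {E : Finset (V × V)}
    (hE : ∀ e ∈ E, e.1 ∈ A ∧ e.2 ∈ A) : E.card ≤ A.card ^ 2 := by
  rw [sq, ← Finset.card_product]
  exact Finset.card_le_card fun e he => Finset.mem_product.2 (hE e he)

theorem edges_card_le_sq {A : Finset V} {E : Finset (Sym2 V)}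
    (hE : ∀ e ∈ E, ∀ x ∈ e, x ∈ A) : E.card ≤ A.card ^ 2 := by
  rw [sq, ← Finset.card_product]
  refine (Finset.card_le_card fun e he => ?_).trans
    (Finset.card_image_le (s := A ×ˢ A) (f := fun p => s(p.1, p.2)))
  induction e with
  | _ x y =>
    exact Finset.mem_image.2 ⟨(x, y), Finset.mem_product.2
      ⟨hE _ he x (by simp), hE _ he y (by simp)⟩, rfl⟩

/-- At most 2s blossoms, each with at most s vertices and s^2 edges. The total is 7 + 6s + 4s^2 +
4s^3, and 7 + 6 + 4 + 4 = 21. -/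
theorem OK.words_le (h : OK M K L l S) : S.words ≤ 21 * S.verts.card ^ 3 := by
  set s := S.verts.card with hs
  have hs1 : 1 ≤ s := Finset.card_pos.2 ⟨_, h.good.root_mem⟩
  have ha : S.arcs.card ≤ s ^ 2 := card_le_sq_of_subset h.good.arcs_mem
  have hb : ∑ b ∈ S.blossoms, (2 + b.verts.card + 2 * b.edges.card) ≤
      (2 * s) * (2 + s + 2 * s ^ 2) := by
    refine (Finset.sum_le_card_nsmul _ _ (2 + s + 2 * s ^ 2) fun b hb => ?_).trans ?_
    · have h1 : b.verts.card ≤ s := Finset.card_le_card (h.good.blossom_sub b hb)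
      have h2 : b.edges.card ≤ s ^ 2 := edges_card_le_sq fun e he x hx =>
        h.good.blossom_sub b hb (h.good.blossom_edges b hb e he x hx)
      omega
    · rw [smul_eq_mul]
      exact Nat.mul_le_mul_right _ h.good.blossoms_card_le
  have hw : (S.working.getD ∅).card ≤ s := by
    cases hw : S.working with
    | none => simp
    | some w =>
      obtain ⟨x, hx, rfl, -⟩ := h.work w hw
      exact Finset.card_le_card (h.good.top_sub x)
  have h2 : s ≤ s ^ 2 := by nlinarith
  have h3 : s ^ 2 ≤ s ^ 3 := by nlinarith
  unfold words
  have : (2 * s) * (2 + s + 2 * s ^ 2) = 4 * s + 2 * s ^ 2 + 4 * s ^ 3 := by ring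
  omega

end Struct

end Operations

end EpsMM

namespace EpsMM

open scoped Classical

/-! ### The invariant of the whole memory during a phase -/

section Memory

variable {V : Type*}

/-- `P` is an alternating path with free ends among the removed vertices. -/
structure PathOK (M : Finset (Sym2 V)) (removed : Finset V) (P : List V) : Prop where
  ne_nil : P ≠ []
  nodup : P.Nodup
  mem : ∀ x ∈ P, x ∈ removed
  alt : ∀ (k : ℕ) (hk : k + 1 < P.length), s(P[k], P[k + 1]) ∈ M ↔ Odd k
  free : ∀ x, P.head? = some x ∨ P.getLast? = some x → ∀ e ∈ M, x ∉ e

/-- The invariant of the memory at all times. -/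
structure Base (K L : ℕ) (M : Finset (Sym2 V)) (l : V → ℕ) (str : V → Option (Struct V))
    (removed : Finset V) (paths : List (List V)) : Prop where
  matching : IsMatching M
  ok : ∀ α S, str α = some S → Struct.OK M K L l S ∧ S.root = α
  disj : ∀ α β S T, str α = some S → str β = some T → α ≠ β → Disjoint S.verts T.verts
  removed_disj : ∀ α S, str α = some S → Disjoint S.verts removed
  removed_mate : ∀ x ∈ removed, ∀ y, s(x, y) ∈ M → y ∈ removed
  label_le : ∀ x, l x ≤ K + 1
  path : ∀ P ∈ paths, PathOK M removed P
  paths_disj : paths.Pairwise List.Disjoint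

/-- The invariant of the memory during a phase. -/
structure PhaseInv (K L : ℕ) (M : Finset (Sym2 V)) (l : V → ℕ) (str : V → Option (Struct V))
    (removed : Finset V) (paths : List (List V)) : Prop
    extends Base K L M l str removed paths where
  free : ∀ α, (∀ e ∈ M, α ∉ e) → α ∈ removed ∨ ∃ S, str α = some S
  unvisited : ∀ x ∉ removed, (∀ α S, str α = some S → x ∉ S.verts) → l x = K + 1

variable {K L : ℕ} {M : Finset (Sym2 V)} {l : V → ℕ} {str : V → Option (Struct V)}
  {removed : Finset V} {paths : List (List V)}

theorem Base.eq_of_mem (h : Base K L M l str removed paths) {α β : V} {S T : Struct V}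
    (hS : str α = some S) (hT : str β = some T) {x : V} (hx : x ∈ S.verts) (hx' : x ∈ T.verts) :
    α = β ∧ S = T := by
  have : α = β := by
    by_contra hne
    exact Finset.disjoint_left.1 (h.disj α β S T hS hT hne) hx hx'
  subst this
  exact ⟨rfl, Option.some.inj (hS.symm.trans hT)⟩

/-- Every operation on the structures other than augmenting applies some map F to each of them. By
`hcov` no vertex drops out of all structures, and by `hun` labels change only at vertices that end
up in a structure; together they keep the label K + 1 at unvisited vertices. -/
theorem PhaseInv.map (h : PhaseInv K L M l str removed paths) {F : Struct V → Struct V}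
    {l' : V → ℕ}
    (hok : ∀ β R, str β = some R → Struct.OK M K L l' (F R) ∧ (F R).root = R.root)
    (hdisj : ∀ β γ R Q, str β = some R → str γ = some Q → β ≠ γ →
      Disjoint (F R).verts (F Q).verts)
    (hrem : ∀ β R, str β = some R → Disjoint (F R).verts removed)
    (hcov : ∀ β R x, str β = some R → x ∈ R.verts → ∃ γ Q, str γ = some Q ∧ x ∈ (F Q).verts)
    (hle : ∀ x, l' x ≤ K + 1)
    (hun : ∀ x, (∀ β R, str β = some R → x ∉ (F R).verts) → l' x = l x) :
    PhaseInv K L M l' (fun β => (str β).map F) removed paths := by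
  have hF : ∀ β R', (str β).map F = some R' → ∃ R, str β = some R ∧ F R = R' := by
    intro β R' hR; simpa using hR
  refine ⟨⟨h.matching, ?_, ?_, ?_, h.removed_mate, hle, h.path, h.paths_disj⟩, ?_, ?_⟩
  · intro β R' hR
    obtain ⟨R, hR1, rfl⟩ := hF β R' hR
    exact ⟨(hok β R hR1).1, (hok β R hR1).2.trans (h.ok β R hR1).2⟩
  · intro β γ R' Q' hR hQ hne
    obtain ⟨R, hR1, rfl⟩ := hF β R' hR
    obtain ⟨Q, hQ1, rfl⟩ := hF γ Q' hQ
    exact hdisj β γ R Q hR1 hQ1 hne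
  · intro β R' hR
    obtain ⟨R, hR1, rfl⟩ := hF β R' hR
    exact hrem β R hR1
  · intro α hα
    refine (h.free α hα).imp_right fun ⟨S, hS⟩ => ⟨F S, ?_⟩
    simp [hS]
  · intro x hx hx'
    have h1 : ∀ β R, str β = some R → x ∉ (F R).verts := fun β R hR =>
      hx' β (F R) (by simp [hR])
    rw [hun x h1]
    refine h.unvisited x hx fun α S hS hxS => ?_
    obtain ⟨γ, Q, hQ, hxQ⟩ := hcov α S x hS hxS
    exact h1 γ Q hQ hxQ

/-- A change that keeps the vertex sets of the structures. -/
theorem PhaseInv.map_of_verts (h : PhaseInv K L M l str removed paths) {F : Struct V → Struct V}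
    {l' : V → ℕ}
    (hok : ∀ β R, str β = some R → Struct.OK M K L l' (F R) ∧ (F R).root = R.root)
    (hv : ∀ R, (F R).verts = R.verts) (hle : ∀ x, l' x ≤ K + 1)
    (hun : ∀ x, (∀ β R, str β = some R → x ∉ R.verts) → l' x = l x) :
    PhaseInv K L M l' (fun β => (str β).map F) removed paths := by
  refine h.map hok ?_ ?_ ?_ hle ?_
  · intro β γ R Q hR hQ hne
    rw [hv, hv]; exact h.disj β γ R Q hR hQ hne
  · intro β R hR
    rw [hv]; exact h.removed_disj β R hR
  · intro β R x hR hx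
    exact ⟨β, R, hR, by rwa [hv]⟩
  · intro x hx
    exact hun x fun β R hR => by have := hx β R hR; rwa [hv] at this

namespace Mem

/-- The invariant of the memory during a phase. -/
def Inv (K L : ℕ) (m : Mem V) : Prop :=
  PhaseInv K L m.matching m.label m.str m.removed m.paths

variable {m m' : Mem V} {g : V × V}

theorem exists_of_structOf {x : V} {S : Struct V} (h : m.structOf x = some S) :
    ∃ α, m.str α = some S ∧ x ∈ S.verts := by
  unfold structOf at h
  split_ifs at h with hex
  have := hex.choose_spec
  rwa [Option.some.inj h] at this

theorem Inv.structOf_eq (h : m.Inv K L) {x α : V} {S : Struct V} (hS : m.str α = some S)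
    (hx : x ∈ S.verts) : m.structOf x = some S := by
  have hex : ∃ S, ∃ α, m.str α = some S ∧ x ∈ S.verts := ⟨S, α, hS, hx⟩
  unfold structOf
  rw [dif_pos hex]
  obtain ⟨β, h1, h2⟩ := hex.choose_spec
  rw [(h.eq_of_mem h1 hS h2 hx).2]

theorem Inv.not_inner_of_working (h : m.Inv K L) {x α : V} {S : Struct V}
    (hS : m.str α = some S) (hx : x ∈ S.verts) (hw : S.working = some (S.top x)) :
    ¬ Inner K m.label x := by
  have hok := (h.ok α S hS).1
  obtain ⟨y, hy, h1, h2⟩ := hok.work _ hw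
  rwa [hok.good.inner_iff_of_top_eq hx hy h1.symm]

theorem Inv.mark (h : m.Inv K (limit i)) :
    PhaseInv K (limit i) m.matching m.label (fun α => (m.str α).map (Struct.mark i))
      m.removed m.paths :=
  h.map_of_verts (fun β R hR => ⟨(h.ok β R hR).1.mark, rfl⟩) (fun _ => rfl) h.label_le
    fun _ _ => rfl

theorem backtrack_verts (S : Struct V) :
    S.backtrack.verts = S.verts ∧ S.backtrack.root = S.root := by
  unfold Struct.backtrack
  split_ifs
  · simp
  · cases S.working <;> simp

theorem Inv.not_free_of_unvisited (h : m.Inv K L) {v : V} (hv : v ∉ m.removed)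
    (hvn : ∀ α S, m.str α = some S → v ∉ S.verts) : ¬ m.Free v := by
  intro hf
  rcases h.free v hf with h1 | ⟨S, hS⟩
  · exact hv h1
  · have h2 := h.ok v S hS
    exact hvn v S hS (h2.2 ▸ h2.1.good.root_mem)

theorem structOf_eq_none {v : V} (hvn : ∀ α S, m.str α = some S → v ∉ S.verts) :
    m.structOf v = none := by
  unfold structOf
  rw [dif_neg]
  rintro ⟨S, α, hS, hv⟩
  exact hvn α S hS hv

theorem mem_pathEdges {P : List V} {e : Sym2 V} :
    e ∈ pathEdges P ↔ ∃ (k : ℕ) (hk : k + 1 < P.length), e = s(P[k], P[k + 1]) := by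
  simp only [pathEdges, List.mem_toFinset, List.mem_map]
  constructor
  · rintro ⟨a, ha, rfl⟩
    obtain ⟨k, hk, rfl⟩ := List.getElem_of_mem ha
    simp only [List.length_zip, List.length_tail] at hk
    exact ⟨k, by omega, by simp⟩
  · rintro ⟨k, hk, rfl⟩
    refine ⟨(P[k], P[k + 1]), ?_, rfl⟩
    have hlen : k < (P.zip P.tail).length := by
      simp only [List.length_zip, List.length_tail]; omega
    exact List.mem_iff_getElem.2 ⟨k, hlen, by simp⟩

theorem Inv.top_eq (h : m.Inv K L) {x α : V} {S : Struct V} (hS : m.str α = some S)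
    (hx : x ∈ S.verts) : m.top x = S.top x := by
  unfold top
  rw [h.structOf_eq hS hx]

theorem Inv.outer_iff (h : m.Inv K L) {x α : V} {S : Struct V} (hS : m.str α = some S)
    (hx : x ∈ S.verts) : m.Outer x ↔ ¬ Inner K m.label x := by
  have hok := (h.ok α S hS).1
  unfold Outer
  rw [h.structOf_eq hS hx]
  simpa using hok.good.outer_iff hok.root_not_inner hx

theorem Inv.backtrack (h : m.Inv K L) :
    PhaseInv K L m.matching m.label (fun α => (m.str α).map Struct.backtrack)
      m.removed m.paths :=
  h.map_of_verts (fun β R hR => ⟨(h.ok β R hR).1.backtrack, (backtrack_verts R).2⟩)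
    (fun R => (backtrack_verts R).1) h.label_le fun _ _ => rfl

/-- Structures are disjoint from the removed set, so a new path lies in fresh vertices and avoids
the stored ones. Structures are closed under mates, hence so is the enlarged removed set. -/
theorem Inv.augment (h : m.Inv K L) {α β : V} {S T : Struct V} (hS : m.str α = some S)
    (hT : m.str β = some T) (hne : α ≠ β) (h1 : g.1 ∈ S.verts) (h2 : g.2 ∈ T.verts)
    (ha : m.Augment g m') : m'.Inv K L := by
  obtain ⟨S', T', hS', hT', ps, hps, rfl⟩ := ha
  obtain rfl := Option.some.inj (hS'.symm.trans (h.structOf_eq hS h1))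
  obtain rfl := Option.some.inj (hT'.symm.trans (h.structOf_eq hT h2))
  obtain ⟨hokS, hSr⟩ := h.ok α S' hS
  obtain ⟨hokT, hTr⟩ := h.ok β T' hT
  have hstr : ∀ γ R, (if γ = S'.root ∨ γ = T'.root then none else m.str γ) = some R →
      m.str γ = some R ∧ γ ≠ α ∧ γ ≠ β := by
    intro γ R hR
    split_ifs at hR with h3
    rw [hSr, hTr, not_or] at h3
    exact ⟨hR, h3⟩
  have hsubr : ∀ x ∈ m.removed, x ∈ m.removed ∪ (S'.verts ∪ T'.verts) := fun x hx =>
    Finset.mem_union_left _ hx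
  have hold : ∀ P ∈ m.paths, PathOK m.matching (m.removed ∪ (S'.verts ∪ T'.verts)) P :=
    fun P hP => by
      have := h.path P hP
      exact ⟨this.1, this.2, fun x hx => hsubr x (this.3 x hx), this.4, this.5⟩
  have hnew : ∀ P, m.IsExpansion S' T' g P →
      PathOK m.matching (m.removed ∪ (S'.verts ∪ T'.verts)) P ∧
        ∀ Q ∈ m.paths, List.Disjoint P Q := by
    intro P hP
    obtain ⟨hhd, hlast, hnd, halt, hed, -⟩ := hP
    have hrne : S'.root ≠ T'.root := by rwa [hSr, hTr]
    have hnil : P ≠ [] := by rintro rfl; simp at hhd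
    have hedge : ∀ e ∈ pathEdges P, ∀ x ∈ e, x ∈ S'.verts ∪ T'.verts := by
      intro e he x hx
      rw [Finset.mem_union]
      rcases hed e he with rfl | ⟨a, ha, rfl⟩
      · rcases Sym2.mem_iff.1 hx with rfl | rfl
        · exact Or.inl h1
        · exact Or.inr h2
      · rcases Finset.mem_union.1 ha with ha | ha
        · have := hokS.good.arcs_mem a ha
          rcases Sym2.mem_iff.1 hx with rfl | rfl
          · exact Or.inl this.1
          · exact Or.inl this.2
        · have := hokT.good.arcs_mem a ha
          rcases Sym2.mem_iff.1 hx with rfl | rfl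
          · exact Or.inr this.1
          · exact Or.inr this.2
    -- The vertices are located through the edges of P, so the case of a one-vertex path has to be
    -- excluded; it would make the two roots equal.
    have hmem : ∀ x ∈ P, x ∈ S'.verts ∪ T'.verts := by
      intro x hx
      obtain ⟨k, hk, rfl⟩ := List.getElem_of_mem hx
      by_cases hk1 : k + 1 < P.length
      · exact hedge _ (mem_pathEdges.2 ⟨k, hk1, rfl⟩) _ (by simp)
      · cases k with
        | zero =>
          exfalso
          apply hrne
          have hlen : P.length = 1 := by omega
          obtain ⟨a, rfl⟩ := List.length_eq_one_iff.1 hlen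
          simp only [List.head?_cons, Option.some.injEq, List.getLast?_singleton] at hhd hlast
          exact hhd.symm.trans hlast
        | succ k => exact hedge _ (mem_pathEdges.2 ⟨k, hk, rfl⟩) _ (by simp)
    refine ⟨⟨hnil, hnd, fun x hx => Finset.mem_union_right _ (hmem x hx), halt, ?_⟩, ?_⟩
    · rintro x (hx | hx)
      · obtain rfl := Option.some.inj (hhd.symm.trans hx)
        exact hokS.root_free
      · obtain rfl := Option.some.inj (hlast.symm.trans hx)
        exact hokT.root_free
    · intro Q hQ x hxP hxQ
      have h3 := (h.path Q hQ).mem x hxQ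
      rcases Finset.mem_union.1 (hmem x hxP) with h4 | h4
      · exact Finset.disjoint_left.1 (h.removed_disj α S' hS) h4 h3
      · exact Finset.disjoint_left.1 (h.removed_disj β T' hT) h4 h3
  refine ⟨⟨h.matching, ?_, ?_, ?_, ?_, h.label_le, ?_, ?_⟩, ?_, ?_⟩
  · intro γ R hR
    exact h.ok γ R (hstr γ R hR).1
  · intro γ δ R Q hR hQ hne
    exact h.disj γ δ R Q (hstr γ R hR).1 (hstr δ Q hQ).1 hne
  · intro γ R hR
    obtain ⟨hR, h3, h4⟩ := hstr γ R hR
    simp only [Finset.disjoint_union_right]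
    exact ⟨h.removed_disj γ R hR, h.disj γ α R S' hR hS h3, h.disj γ β R T' hR hT h4⟩
  · intro x hx y hxy
    simp only [Finset.mem_union] at hx ⊢
    rcases hx with hx | hx | hx
    · exact Or.inl (h.removed_mate x hx y hxy)
    · exact Or.inr (Or.inl (hokS.good.mate x hx y hxy).1)
    · exact Or.inr (Or.inr (hokT.good.mate x hx y hxy).1)
  · rcases hps with ⟨P, hP, rfl⟩ | ⟨-, rfl⟩
    · intro Q hQ
      rcases List.mem_cons.1 hQ with rfl | hQ
      · exact (hnew _ hP).1
      · exact hold Q hQ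
    · exact hold
  · rcases hps with ⟨P, hP, rfl⟩ | ⟨-, rfl⟩
    · exact List.pairwise_cons.2 ⟨(hnew P hP).2, h.paths_disj⟩
    · exact h.paths_disj
  · intro γ hγ
    simp only [Finset.mem_union]
    rcases h.free γ hγ with h3 | ⟨R, hR⟩
    · exact Or.inl (Or.inl h3)
    · by_cases h4 : γ = α
      · left; right; left
        rw [h4, ← hSr]; exact hokS.good.root_mem
      by_cases h5 : γ = β
      · left; right; right
        rw [h5, ← hTr]; exact hokT.good.root_mem
      · exact Or.inr ⟨R, by rw [if_neg (by rw [hSr, hTr]; tauto)]; exact hR⟩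
  · intro x hx hxn
    simp only [Finset.mem_union, not_or] at hx
    refine h.unvisited x hx.1 fun γ R hR hxR => ?_
    by_cases h4 : γ = α
    · subst h4
      rw [Option.some.inj (hR.symm.trans hS)] at hxR
      exact hx.2.1 hxR
    by_cases h5 : γ = β
    · subst h5
      rw [Option.some.inj (hR.symm.trans hT)] at hxR
      exact hx.2.2 hxR
    · exact hxn γ R (by simp only; rw [if_neg (by rw [hSr, hTr]; tauto)]; exact hR) hxR

theorem Inv.augmentArc (h : m.Inv K L) (he : m.AugmentArc g m') : m'.Inv K L := by
  unfold AugmentArc at he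
  split_ifs at he with c
  · obtain ⟨⟨S, hSo, -⟩, ⟨T, hTo, -⟩, hns⟩ := c
    obtain ⟨α, hS, hu⟩ := exists_of_structOf hSo
    obtain ⟨β, hT, hv⟩ := exists_of_structOf hTo
    refine h.augment hS hT ?_ hu hv he
    rintro rfl
    obtain rfl := Option.some.inj (hS.symm.trans hT)
    exact hns ⟨S, hSo, hv⟩
  · exact he ▸ h

variable [Fintype V]

theorem mate_mem {x : V} (h : ¬ m.Free x) : s(x, m.mate x) ∈ m.matching := by
  have hex : ∃ t, s(x, t) ∈ m.matching := by
    unfold Free at h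
    push Not at h
    obtain ⟨e, he, y, rfl⟩ := h
    exact ⟨y, he⟩
  unfold mate
  rw [dif_pos hex]
  exact hex.choose_spec

/-- The last inner vertex above u is the tail of the matched arc that enters the node of u, and by
monotonicity its label is the largest on the path. It is one of the labels of which `distance` takes
the supremum. This supplies the hypothesis `hlow` of the overtakes. -/
theorem Inv.label_le_distance (h : m.Inv K L) {u w α : V} {S : Struct V}
    (hS : m.str α = some S) (hu : u ∈ S.verts) (hui : ¬ Inner K m.label u)
    (hw : w ∈ S.verts) (hwi : Inner K m.label w) (ha : S.Anc (S.top w) (S.top u)) :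
    m.label w ≤ m.distance u := by
  have hok := (h.ok α S hS).1
  rcases Relation.ReflTransGen.cases_tail ha with h1 | ⟨p, hwp, hpu⟩
  · exact absurd ((hok.good.inner_iff_of_top_eq hw hu h1.symm).1 hwi) hui
  obtain ⟨e, he, h1, h2, h3⟩ := hpu.exists_arc
  have hev := hok.good.arcs_mem e he
  rcases hok.good.arc_type e he h3 with ⟨h4, h5, -⟩ | ⟨-, -, h5⟩
  · have h6 := hok.good.anc_label_le hw hev.1 hwi h5 (h1 ▸ hwp)
    refine h6.trans ?_
    unfold distance
    rw [h.top_eq hS hu, if_neg]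
    · refine Finset.le_sup (f := m.label) (Finset.mem_filter.2 ⟨Finset.mem_univ _, ?_, e.2, ?_, h4⟩)
      · intro h7
        exact h3 ((hok.good.part u hu _ h7).trans h2.symm)
      · rw [← h2]; exact hok.good.self_mem _ hev.2
    -- The only free vertex of a structure is its root, whose node has no parent; but the node of u
    -- has one here.
    · rintro ⟨β, hβ, hf⟩
      obtain rfl := hok.eq_root β (hok.good.top_sub u hβ) hf
      rw [← hok.good.part u hu _ hβ] at hpu
      exact hok.good.root_no_parent _ hpu
  · exact absurd ((hok.good.inner_iff_of_top_eq hev.2 hu h2).1 h5) hui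

theorem Inv.contract (h : m.Inv K L) {α : V} {S : Struct V} (hS : m.str α = some S)
    (h1 : g.1 ∈ S.verts) (h2 : g.2 ∈ S.verts) (i1 : ¬ Inner K m.label g.1)
    (i2 : ¬ Inner K m.label g.2) (hne : S.top g.1 ≠ S.top g.2) : (m.contract g).Inv K L := by
  have hg := (h.ok α S hS).1.good
  have hlab : ∀ x, (m.contract g).label x = if ∃ y, s(x, y) ∈ m.matching ∧
      x ∈ (S.newBlossom g).verts ∧ y ∈ (S.newBlossom g).verts then 0 else m.label x := by
    intro x
    simp [Mem.contract, h.structOf_eq hS h1]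
  have hout : ∀ x, x ∉ S.verts → (m.contract g).label x = m.label x := by
    intro x hx
    rw [hlab, if_neg]
    rintro ⟨y, -, h3, -⟩
    exact hx ((hg.mem_newBlossom_iff h1 h2).1 h3).1
  refine PhaseInv.map_of_verts h ?_ ?_ ?_ ?_
  · intro β R hR
    split_ifs with hgR
    · obtain ⟨rfl, rfl⟩ := h.eq_of_mem hR hS hgR h1
      exact ⟨(h.ok β R hR).1.contract h.matching h1 h2 i1 i2 hne hlab, rfl⟩
    · refine ⟨(h.ok β R hR).1.congr_label fun x hx => hout x fun hxS => ?_, rfl⟩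
      obtain ⟨-, rfl⟩ := h.eq_of_mem hR hS hx hxS
      exact hgR h1
  · intro R
    split_ifs <;> rfl
  · intro x
    have := h.label_le x
    have := hlab x
    split_ifs at this <;> omega
  · intro x hx
    exact hout x (hx α S hS)

theorem Inv.overtake_unvisited (h : m.Inv K L) (hL : 2 ≤ L) {u v α : V} {S : Struct V}
    (hS : m.str α = some S) (hu : u ∈ S.verts) (hui : ¬ Inner K m.label u)
    (hc : S.verts.card < L) (hvr : v ∉ m.removed) (huv : s(u, v) ∉ m.matching)
    (hd : m.distance u + 1 < m.label v) (hvn : ∀ α S, m.str α = some S → v ∉ S.verts) :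
    (m.overtake (u, v) (m.distance u + 1)).Inv K L := by
  have hvt := mate_mem (h.not_free_of_unvisited hvr hvn)
  set t := m.mate v with ht
  have htv : s(t, v) ∈ m.matching := Sym2.eq_swap ▸ hvt
  -- Structures and the removed set are closed under mates, so t is unvisited as well. Its label is
  -- therefore K + 1, which makes t outer.
  have htr : t ∉ m.removed := fun h1 => hvr (h.removed_mate t h1 v htv)
  have htn : ∀ α S, m.str α = some S → t ∉ S.verts := fun α S hS h1 =>
    hvn α S hS ((h.ok α S hS).1.good.mate t h1 v htv).1
  have hlv := h.unvisited v hvr hvn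
  have hlt := h.unvisited t htr htn
  have hOK := (h.ok α S hS).1.addArc h.matching hL hu hui (hvn α S hS) (htn α S hS) hvt huv hc
    (d := m.distance u) (fun w hw hwi ha => h.label_le_distance hS hu hui hw hwi ha) hlv hlt hd
  have key : ∀ β R, m.str β = some R → (if u ∈ R.verts then
        if v ∈ R.verts then R.reroute u v t
        else match m.structOf v with
          | none => R.addArc u v t
          | some T => R.gain T u v t
      else if v ∈ R.verts then R.lose v t else R) =
      if u ∈ R.verts then R.addArc u v t else R := by
    intro β R hR
    rw [if_neg (hvn β R hR), if_neg (hvn β R hR), structOf_eq_none hvn]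
  have hmap : (m.overtake (u, v) (m.distance u + 1)).str =
      fun β => (m.str β).map fun R => if u ∈ R.verts then R.addArc u v t else R := by
    funext β
    simp only [overtake]
    cases hR : m.str β with
    | none => rfl
    | some R => exact congrArg some (key β R hR)
  unfold Inv
  rw [hmap]
  have huniq : ∀ β R, m.str β = some R → u ∈ R.verts → β = α ∧ R = S := fun β R hR huR =>
    h.eq_of_mem hR hS huR hu
  have hsub : ∀ R : Struct V, R.verts ⊆ (if u ∈ R.verts then R.addArc u v t else R).verts := by
    intro R; split_ifs
    · exact Finset.subset_union_left
    · exact subset_rfl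
  have hsup : ∀ β R x, m.str β = some R →
      x ∈ (if u ∈ R.verts then R.addArc u v t else R).verts →
      x ∈ R.verts ∨ (β = α ∧ (x = v ∨ x = t)) := by
    intro β R x hR hx
    split_ifs at hx with huR
    · simp only [Struct.addArc, Finset.mem_union, Finset.mem_insert, Finset.mem_singleton] at hx
      exact hx.imp_right fun h1 => ⟨(huniq β R hR huR).1, h1⟩
    · exact Or.inl hx
  refine PhaseInv.map h ?_ ?_ ?_ ?_ ?_ ?_
  · intro β R hR
    split_ifs with huR
    · obtain ⟨rfl, rfl⟩ := huniq β R hR huR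
      exact ⟨hOK, rfl⟩
    · exact ⟨(h.ok β R hR).1.congr_label fun x hx => Function.update_of_ne
        (fun h1 : x = v => hvn β R hR (h1 ▸ hx)) _ _, rfl⟩
  · intro β γ R Q hR hQ hne
    refine Finset.disjoint_left.2 fun x hx hx' => ?_
    rcases hsup β R x hR hx with h1 | ⟨h1, h2⟩ <;> rcases hsup γ Q x hQ hx' with h3 | ⟨h3, h4⟩
    · exact Finset.disjoint_left.1 (h.disj β γ R Q hR hQ hne) h1 h3
    · rcases h4 with rfl | rfl
      · exact hvn β R hR h1
      · exact htn β R hR h1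
    · rcases h2 with rfl | rfl
      · exact hvn γ Q hQ h3
      · exact htn γ Q hQ h3
    · exact hne (h1.trans h3.symm)
  · intro β R hR
    refine Finset.disjoint_left.2 fun x hx hx' => ?_
    rcases hsup β R x hR hx with h1 | ⟨-, rfl | rfl⟩
    · exact Finset.disjoint_left.1 (h.removed_disj β R hR) h1 hx'
    · exact hvr hx'
    · exact htr hx'
  · intro β R x hR hx
    exact ⟨β, R, hR, hsub R hx⟩
  · intro x
    simp only [overtake]
    by_cases hx : x = v
    · subst hx; simp; omega
    · rw [Function.update_of_ne hx]; exact h.label_le x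
  · intro x hx
    refine Function.update_of_ne (fun h1 : x = v => hx α S hS ?_) _ _
    rw [if_pos hu, h1]
    simp [Struct.addArc]

theorem Inv.overtake_same (h : m.Inv K L) {u v α : V} {S : Struct V}
    (hS : m.str α = some S) (hu : u ∈ S.verts) (hui : ¬ Inner K m.label u)
    (hc : S.verts.card < L) (huv : s(u, v) ∉ m.matching)
    (hd : m.distance u + 1 < m.label v) (hv : v ∈ S.verts) (hi : Inner K m.label v) :
    (m.overtake (u, v) (m.distance u + 1)).Inv K L := by
  have hok := (h.ok α S hS).1
  obtain ⟨t', ht'⟩ := hok.exists_mate_of_inner hv hi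
  have hvt := mate_mem (m := m) (x := v) fun hf => hf _ ht' (by simp)
  set t := m.mate v with ht
  have hOK := hok.reroute h.matching hu hui hv hi hvt huv hc
    (d := m.distance u) (fun w hw hwi ha => h.label_le_distance hS hu hui hw hwi ha) hd
  have huniq : ∀ β R, m.str β = some R → (u ∈ R.verts ∨ v ∈ R.verts) → β = α ∧ R = S := by
    rintro β R hR (huR | hvR)
    · exact h.eq_of_mem hR hS huR hu
    · exact h.eq_of_mem hR hS hvR hv
  have hmap : (m.overtake (u, v) (m.distance u + 1)).str =
      fun β => (m.str β).map fun R => if u ∈ R.verts then R.reroute u v t else R := by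
    funext β
    simp only [overtake]
    cases hR : m.str β with
    | none => rfl
    | some R =>
      simp only [Option.map_some, Option.some.injEq]
      by_cases huR : u ∈ R.verts
      · obtain ⟨rfl, rfl⟩ := huniq β R hR (Or.inl huR)
        rw [if_pos hu, if_pos hv, if_pos hu]
      · have hvR : v ∉ R.verts := fun hvR => huR ((huniq β R hR (Or.inr hvR)).2 ▸ hu)
        rw [if_neg huR, if_neg hvR, if_neg huR]
  unfold Inv
  rw [hmap]
  refine PhaseInv.map_of_verts h ?_ ?_ ?_ ?_
  · intro β R hR
    split_ifs with huR
    · obtain ⟨rfl, rfl⟩ := huniq β R hR (Or.inl huR)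
      exact ⟨hOK, rfl⟩
    · exact ⟨(h.ok β R hR).1.congr_label fun x hx => Function.update_of_ne
        (fun h1 : x = v => huR ((huniq β R hR (Or.inr (h1 ▸ hx))).2 ▸ hu)) _ _, rfl⟩
  · intro R; split_ifs <;> rfl
  · intro x
    simp only [overtake]
    have := hi.2
    by_cases hx : x = v
    · subst hx; simp; omega
    · rw [Function.update_of_ne hx]; exact h.label_le x
  · intro x hx
    exact Function.update_of_ne (fun h1 : x = v => hx α S hS (h1 ▸ hv)) _ _

theorem Inv.overtake_other (h : m.Inv K L) {u v α β : V} {S T : Struct V}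
    (hS : m.str α = some S) (hu : u ∈ S.verts) (hui : ¬ Inner K m.label u)
    (hc : S.verts.card < L) (huv : s(u, v) ∉ m.matching)
    (hd : m.distance u + 1 < m.label v) (hT : m.str β = some T) (hne : α ≠ β)
    (hv : v ∈ T.verts) (hi : Inner K m.label v) :
    (m.overtake (u, v) (m.distance u + 1)).Inv K L := by
  have hok := (h.ok α S hS).1
  have hokT := (h.ok β T hT).1
  obtain ⟨t', ht'⟩ := hokT.exists_mate_of_inner hv hi
  have hvt := mate_mem (m := m) (x := v) fun hf => hf _ ht' (by simp)
  set t := m.mate v with ht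
  have hST := h.disj α β S T hS hT hne
  have hOK := hok.gain hokT h.matching hST hu hui hv hi hvt huv hc
    (d := m.distance u) (fun w hw hwi ha => h.label_le_distance hS hu hui hw hwi ha) hd
  have hOKT := hokT.lose h.matching hv hi hvt
  have hu1 : ∀ γ R, m.str γ = some R → u ∈ R.verts → γ = α ∧ R = S := fun γ R hR huR =>
    h.eq_of_mem hR hS huR hu
  have hv1 : ∀ γ R, m.str γ = some R → v ∈ R.verts → γ = β ∧ R = T := fun γ R hR hvR =>
    h.eq_of_mem hR hT hvR hv
  have huT : u ∉ T.verts := Finset.disjoint_left.1 hST hu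
  have hvS : v ∉ S.verts := fun hvS => Finset.disjoint_left.1 hST hvS hv
  have hmap : (m.overtake (u, v) (m.distance u + 1)).str =
      fun γ => (m.str γ).map fun R => if u ∈ R.verts then R.gain T u v t else
        if v ∈ R.verts then R.lose v t else R := by
    funext γ
    simp only [overtake]
    cases hR : m.str γ with
    | none => rfl
    | some R =>
      simp only [Option.map_some, Option.some.injEq]
      by_cases huR : u ∈ R.verts
      · obtain ⟨rfl, rfl⟩ := hu1 γ R hR huR
        rw [if_pos hu, if_neg hvS, if_pos hu, h.structOf_eq hT hv]
      · rw [if_neg huR, if_neg huR]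
  unfold Inv
  rw [hmap]
  have hsub : T.subtree v ⊆ T.verts := Finset.filter_subset _ _
  have hvv : v ∈ T.subtree v := Struct.Good.self_mem_subtree hv
  -- The vertices of the subtree of v move to the structure of u and nothing else moves.
  -- Disjointness and coverage follow from this description.
  have hchar : ∀ γ R x, m.str γ = some R →
      (x ∈ (if u ∈ R.verts then R.gain T u v t else
        if v ∈ R.verts then R.lose v t else R).verts ↔
      (x ∈ T.subtree v ∧ γ = α) ∨ (x ∉ T.subtree v ∧ x ∈ R.verts)) := by
    intro γ R x hR
    by_cases huR : u ∈ R.verts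
    · obtain ⟨rfl, rfl⟩ := hu1 γ R hR huR
      rw [if_pos huR]
      have : x ∈ R.verts → x ∉ T.subtree v := fun h1 h2 =>
        Finset.disjoint_left.1 hST h1 (hsub h2)
      simp only [Struct.gain, Finset.mem_union]
      tauto
    · have hγ : γ ≠ α := by
        rintro rfl
        rw [Option.some.inj (hR.symm.trans hS)] at huR
        exact huR hu
      rw [if_neg huR]
      by_cases hvR : v ∈ R.verts
      · obtain ⟨rfl, rfl⟩ := hv1 γ R hR hvR
        rw [if_pos hvR]
        simp only [Struct.lose, Finset.mem_sdiff]
        tauto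
      · rw [if_neg hvR]
        have : x ∈ R.verts → x ∉ T.subtree v := fun h1 h2 =>
          hvR ((h.eq_of_mem hR hT h1 (hsub h2)).2 ▸ hv)
        tauto
  refine PhaseInv.map h ?_ ?_ ?_ ?_ ?_ ?_
  · intro γ R hR
    by_cases huR : u ∈ R.verts
    · obtain ⟨rfl, rfl⟩ := hu1 γ R hR huR
      rw [if_pos huR]
      exact ⟨hOK, rfl⟩
    · rw [if_neg huR]
      by_cases hvR : v ∈ R.verts
      · obtain ⟨rfl, rfl⟩ := hv1 γ R hR hvR
        rw [if_pos hvR]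
        refine ⟨hOKT.congr_label fun x hx => Function.update_of_ne (fun h1 : x = v => ?_) _ _, rfl⟩
        exact (Finset.mem_sdiff.1 hx).2 (h1 ▸ hvv)
      · rw [if_neg hvR]
        exact ⟨(h.ok γ R hR).1.congr_label fun x hx => Function.update_of_ne
          (fun h1 : x = v => hvR (h1 ▸ hx)) _ _, rfl⟩
  · intro γ δ R Q hR hQ hne
    refine Finset.disjoint_left.2 fun x hx hx' => ?_
    rw [hchar γ R x hR] at hx
    rw [hchar δ Q x hQ] at hx'
    rcases hx with ⟨h1, h2⟩ | ⟨h1, h2⟩ <;> rcases hx' with ⟨h3, h4⟩ | ⟨h3, h4⟩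
    · exact hne (h2.trans h4.symm)
    · exact h3 h1
    · exact h1 h3
    · exact Finset.disjoint_left.1 (h.disj γ δ R Q hR hQ hne) h2 h4
  · intro γ R hR
    refine Finset.disjoint_left.2 fun x hx hx' => ?_
    rw [hchar γ R x hR] at hx
    rcases hx with ⟨h1, -⟩ | ⟨-, h1⟩
    · exact Finset.disjoint_left.1 (h.removed_disj β T hT) (hsub h1) hx'
    · exact Finset.disjoint_left.1 (h.removed_disj γ R hR) h1 hx'
  · intro γ R x hR hx
    by_cases hxv : x ∈ T.subtree v
    · exact ⟨α, S, hS, (hchar α S x hS).2 (Or.inl ⟨hxv, rfl⟩)⟩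
    · exact ⟨γ, R, hR, (hchar γ R x hR).2 (Or.inr ⟨hxv, hx⟩)⟩
  · intro x
    simp only [overtake]
    have := hi.2
    by_cases hx : x = v
    · subst hx; simp; omega
    · rw [Function.update_of_ne hx]; exact h.label_le x
  · intro x hx
    refine Function.update_of_ne (fun h1 : x = v => hx α S hS ?_) _ _
    exact (hchar α S x hS).2 (Or.inl ⟨h1 ▸ hvv, rfl⟩)

theorem Inv.extendArc (h : m.Inv K L) (hL : 2 ≤ L) (he : m.ExtendArc g m') : m'.Inv K L := by
  unfold ExtendArc at he
  split_ifs at he with c1 c2 c3 c4 c5 c6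
  · exact he ▸ h
  · exact he ▸ h
  · exact he ▸ h
  all_goals
    rw [not_or] at c1
    rw [not_or, not_or, not_not] at c2
    obtain ⟨hne, ⟨S, hSo, hw⟩, hM⟩ := c2
    obtain ⟨α, hS, hu⟩ := exists_of_structOf hSo
    have hui : ¬ Inner K m.label g.1 :=
      h.not_inner_of_working hS hu hw
    rw [h.top_eq hS hu] at hne
  · obtain ⟨S', hSo', hv⟩ := c5
    obtain rfl := Option.some.inj (hSo.symm.trans hSo')
    rw [h.top_eq hS hv] at hne
    exact he ▸ h.contract hS hu hv hui ((h.outer_iff hS hv).1 c4) hne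
  · obtain ⟨T, hTo, -⟩ := c4
    obtain ⟨β, hT, hv⟩ := exists_of_structOf hTo
    refine h.augment hS hT ?_ hu hv he
    rintro rfl
    obtain rfl := Option.some.inj (hS.symm.trans hT)
    exact c5 ⟨S, hSo, hv⟩
  · subst he
    -- The test for marks in the algorithm is what makes the overtaking structure small.
    have hc : S.verts.card < L := by
      refine (h.ok α S hS).1.hold ?_ ?_
      · by_contra hcon
        exact c3 ⟨S, hSo, Or.inr (by simpa using hcon)⟩
      · by_contra hcon
        exact c3 ⟨S, hSo, Or.inl (by simpa using hcon)⟩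
    by_cases hvn : ∀ α S, m.str α = some S → g.2 ∉ S.verts
    · exact h.overtake_unvisited hL hS hu hui hc c1.2 hM c6 hvn
    · push Not at hvn
      obtain ⟨β, T, hT, hv⟩ := hvn
      have hi : Inner K m.label g.2 := by
        by_contra hcon
        exact c4 ((h.outer_iff hT hv).2 hcon)
      by_cases hab : α = β
      · subst hab
        obtain rfl := Option.some.inj (hS.symm.trans hT)
        exact h.overtake_same hS hu hui hc hM c6 hv hi
      · exact h.overtake_other hS hu hui hc hM c6 hT hab hv hi
  · exact he ▸ h

end Mem

end Memory

end EpsMM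

namespace EpsMM

open scoped Classical

/-! ### The symmetric difference with disjoint augmenting paths is a matching -/

section Augmentation

variable {V : Type*} {M : Finset (Sym2 V)} {removed : Finset V} {paths : List (List V)}

theorem IsMatching.insert {M : Finset (Sym2 V)} (hM : IsMatching M) {u v : V} (huv : u ≠ v)
    (hu : ∀ e ∈ M, u ∉ e) (hv : ∀ e ∈ M, v ∉ e) : IsMatching (insert s(u, v) M) := by
  have key : ∀ e ∈ M, ∀ x ∈ s(u, v), x ∉ e := by
    intro e he x hx
    rcases Sym2.mem_iff.1 hx with rfl | rfl
    · exact hu e he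
    · exact hv e he
  refine ⟨?_, ?_⟩
  · intro e he
    rcases Finset.mem_insert.1 he with rfl | he
    · simpa using huv
    · exact hM.1 e he
  · intro e he f hf x hx hx'
    rcases Finset.mem_insert.1 he with rfl | he <;> rcases Finset.mem_insert.1 hf with rfl | hf
    · rfl
    · exact absurd hx' (key f hf x hx)
    · exact absurd hx (key e he x hx')
    · exact hM.2 e he f hf x hx hx'

theorem nodup_index_eq {P : List V} (h : P.Nodup) {a b : ℕ} (ha : a < P.length)
    (hb : b < P.length) (hab : P[a] = P[b]) : a = b :=
  (h.getElem_inj_iff).1 hab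

/-- After the augmentation, the matched edge at the `i`-th vertex of a path leads to
the next vertex if `i` is even and to the previous one if `i` is odd. -/
theorem PathOK.edge_of_symmDiff (hM : IsMatching M) {P : List V} (hP : PathOK M removed P)
    {D : Finset (Sym2 V)} (hPD : ∀ e ∈ pathEdges P, e ∈ D) {i : ℕ} (hi : i < P.length)
    (hDP : ∀ e ∈ D, P[i] ∈ e → e ∈ pathEdges P) {e : Sym2 V} (he : e ∈ symmDiff M D)
    (hie : P[i] ∈ e) :
    (Even i ∧ ∃ h : i + 1 < P.length, e = s(P[i], P[i + 1])) ∨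
      (∃ k, ∃ h : k + 1 < P.length, i = k + 1 ∧ Even k ∧ e = s(P[k], P[k + 1])) := by
  rw [Finset.mem_symmDiff] at he
  rcases he with ⟨he, hne⟩ | ⟨he, hne⟩
  -- A matched edge at P[i] outside D cannot exist: the ends of P are free, and at an interior
  -- vertex one of the two path edges is matched and would have to be this edge.
  · exfalso
    have hpos : i ≠ 0 := by
      rintro rfl
      exact hP.free _ (Or.inl (by rw [List.head?_eq_getElem?, List.getElem?_eq_getElem hi])) e he hie
    have hlast : i + 1 < P.length := by
      by_contra hcon
      have hl : i = P.length - 1 := by omega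
      refine hP.free P[i] (Or.inr ?_) e he hie
      rw [List.getLast?_eq_getElem?, ← hl, List.getElem?_eq_getElem hi]
    obtain ⟨k, rfl⟩ := Nat.exists_eq_succ_of_ne_zero hpos
    rcases Nat.even_or_odd k with hk | hk
    · have h1 := (hP.alt (k + 1) hlast).2 hk.add_one
      have h2 := hM.2 _ he _ h1 _ hie (by simp)
      exact hne (h2 ▸ hPD _ (Mem.mem_pathEdges.2 ⟨k + 1, hlast, rfl⟩))
    · have h1 := (hP.alt k hi).2 hk
      have h2 := hM.2 _ he _ h1 _ hie (by simp)
      exact hne (h2 ▸ hPD _ (Mem.mem_pathEdges.2 ⟨k, hi, rfl⟩))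
  · obtain ⟨k, hk, rfl⟩ := Mem.mem_pathEdges.1 (hDP e he hie)
    have hev : Even k := by
      rw [← Nat.not_odd_iff_even]
      exact fun hodd => hne ((hP.alt k hk).2 hodd)
    rcases Sym2.mem_iff.1 hie with h1 | h1
    · obtain rfl := nodup_index_eq hP.nodup hi (by omega) h1
      exact Or.inl ⟨hev, hk, rfl⟩
    · obtain rfl := nodup_index_eq hP.nodup hi hk h1
      exact Or.inr ⟨k, hk, rfl, hev, rfl⟩

theorem mem_of_mem_pathEdges {P : List V} {e : Sym2 V} (he : e ∈ pathEdges P) {x : V}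
    (hx : x ∈ e) : x ∈ P := by
  obtain ⟨k, hk, rfl⟩ := Mem.mem_pathEdges.1 he
  rcases Sym2.mem_iff.1 hx with rfl | rfl <;> exact List.getElem_mem _

/-- At a vertex of a path only the edges of that path matter, as the paths are disjoint, and the
parity of its position determines the one edge that remains. At all other vertices nothing changes.
-/
theorem isMatching_symmDiff (hM : IsMatching M) (hP : ∀ P ∈ paths, PathOK M removed P)
    (hd : paths.Pairwise List.Disjoint) {D : Finset (Sym2 V)}
    (hD : ∀ e, e ∈ D ↔ ∃ P ∈ paths, e ∈ pathEdges P) : IsMatching (symmDiff M D) := by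
  constructor
  · intro e he
    rw [Finset.mem_symmDiff] at he
    rcases he with ⟨he, -⟩ | ⟨he, -⟩
    · exact hM.1 e he
    · obtain ⟨P, hPp, he⟩ := (hD e).1 he
      obtain ⟨k, hk, rfl⟩ := Mem.mem_pathEdges.1 he
      rw [Sym2.mk_isDiag_iff]
      intro heq
      have := nodup_index_eq (hP P hPp).nodup (by omega) hk heq
      omega
  · intro e he f hf v hve hvf
    by_cases hv : ∃ P ∈ paths, v ∈ P
    · obtain ⟨P, hPp, hvP⟩ := hv
      have hDP : ∀ e ∈ D, v ∈ e → e ∈ pathEdges P := by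
        intro e he hve
        obtain ⟨Q, hQ, he⟩ := (hD e).1 he
        by_cases hPQ : P = Q
        · rwa [hPQ]
        · have : Std.Symm (List.Disjoint (α := V)) := ⟨fun _ _ h => h.symm⟩
          have := hd.forall hPp hQ hPQ
          exact absurd (mem_of_mem_pathEdges he hve) (this hvP)
      have hPD : ∀ e ∈ pathEdges P, e ∈ D := fun e he => (hD e).2 ⟨P, hPp, he⟩
      obtain ⟨i, hi, rfl⟩ := List.getElem_of_mem hvP
      have h1 := (hP P hPp).edge_of_symmDiff hM hPD hi hDP he hve
      have h2 := (hP P hPp).edge_of_symmDiff hM hPD hi hDP hf hvf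
      rcases h1 with ⟨h1, -, rfl⟩ | ⟨k, hk, rfl, h1, rfl⟩ <;>
        rcases h2 with ⟨h2, -, rfl⟩ | ⟨k', hk', h3, h2, rfl⟩
      · rfl
      · rw [h3, Nat.even_add_one] at h1
        exact absurd h2 h1
      · rw [Nat.even_add_one] at h2
        exact absurd h1 h2
      · obtain rfl : k = k' := by omega
        rfl
    · have hDn : ∀ e ∈ symmDiff M D, v ∈ e → e ∈ M := by
        intro e he hve
        rw [Finset.mem_symmDiff] at he
        rcases he with ⟨he, -⟩ | ⟨he, -⟩
        · exact he
        · obtain ⟨P, hPp, he⟩ := (hD e).1 he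
          exact absurd ⟨P, hPp, mem_of_mem_pathEdges he hve⟩ hv
      exact hM.2 e (hDn e he hve) f (hDn f hf hvf) v hve hvf

end Augmentation

/-! ### The space bound -/

section Space

variable {V : Type*} [Fintype V] {M : Finset (Sym2 V)} {removed : Finset V}
  {paths : List (List V)} {K L : ℕ} {l : V → ℕ} {str : V → Option (Struct V)}

theorem IsMatching.card_le (hM : IsMatching M) : M.card ≤ Fintype.card V := by
  have hex : ∀ e : Sym2 V, ∃ v, v ∈ e := fun e => ⟨e.out.1, Sym2.out_fst_mem e⟩
  choose f hf using hex
  exact Finset.card_le_card_of_injOn f (fun _ _ => Finset.mem_univ _) fun e he e' he' hee =>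
    hM.2 e he e' he' _ (hf e) (hee ▸ hf e')

theorem Base.sum_verts_le (h : Base K L M l str removed paths) :
    ∑ α, ((str α).elim 0 fun S => S.verts.card) ≤ Fintype.card V := by
  have h1 : ∀ α, ((str α).elim 0 fun S => S.verts.card) = ((str α).elim ∅ Struct.verts).card := by
    intro α; cases str α <;> simp
  simp only [h1]
  rw [← Finset.card_biUnion]
  · exact Finset.card_le_univ _
  · intro α _ β _ hne
    cases hS : str α with
    | none => simp [Function.onFun, hS]
    | some S =>
      cases hT : str β with
      | none => simp [Function.onFun, hT]
      | some T => simpa [Function.onFun, hS, hT] using h.disj α β S T hS hT hne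

/-- The concatenation of the paths has no repeated vertex. Each path is nonempty, so counting its
size word at most doubles its length. -/
theorem Base.paths_le (h : Base K L M l str removed paths) :
    (paths.map fun P => 1 + P.length).sum ≤ 2 * Fintype.card V := by
  have h1 : paths.flatten.Nodup :=
    List.nodup_flatten.2 ⟨fun P hP => (h.path P hP).nodup, h.paths_disj⟩
  have h2 := h1.length_le_card
  have h3 : ∀ ps : List (List V), (∀ P ∈ ps, P ≠ []) →
      (ps.map fun P => 1 + P.length).sum ≤ 2 * ps.flatten.length := by
    intro ps
    induction ps with
    | nil => simp
    | cons P ps ih =>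
      intro hne
      have h4 := ih fun Q hQ => hne Q (List.mem_cons_of_mem _ hQ)
      have h5 := List.length_pos_iff.2 (hne P List.mem_cons_self)
      simp only [List.map_cons, List.sum_cons, List.flatten_cons, List.length_append]
      omega
  have := h3 paths fun P hP => (h.path P hP).ne_nil
  omega

theorem Base.sum_blossoms_le (h : Base K L M l str removed paths) :
    ∑ α, ((str α).elim 0 fun S => S.blossoms.card) ≤ 2 * Fintype.card V := by
  refine le_trans ?_ (Nat.mul_le_mul_left 2 h.sum_verts_le)
  rw [Finset.mul_sum]
  refine Finset.sum_le_sum fun α _ => ?_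
  cases hS : str α with
  | none => simp
  | some S => simpa using (h.ok α S hS).1.good.blossoms_card_le

/-- One factor of the cubic cost of a structure is summed over the disjoint structures, which gives
n; the other two are at most B. The constant is 23 for the terms with B^2 n, 8 for the multiples of
n and 7 for single words. -/
theorem words_le {m : Mem V} (h : Base K L m.matching m.label m.str m.removed m.paths)
    (hn : 1 ≤ Fintype.card V) (hL : 1 ≤ L)
    (hc : ∀ α, ∀ e ∈ m.collected α, ∃ S, m.str α = some S ∧ e.1 ∈ S.verts ∧ e.2 ∈ S.verts) :
    m.words ≤ 38 * (L * (K + 2)) ^ 2 * Fintype.card V := by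
  set n := Fintype.card V with hnn
  set B := L * (K + 2) with hB
  have hB1 : 1 ≤ B := Nat.mul_pos hL (by omega)
  have h1 : m.matching.card ≤ n := h.matching.card_le
  have h2 : m.removed.card ≤ n := Finset.card_le_univ _
  have h3 := h.paths_le
  have h4 : ∑ α, (1 + (m.str α).elim 0 Struct.words) ≤ n + 21 * B ^ 2 * n := by
    rw [Finset.sum_add_distrib]
    have e1 : ∑ _α : V, 1 = n := by simp [hnn]
    rw [e1]
    refine Nat.add_le_add_left (le_trans ?_ (Nat.mul_le_mul_left _ h.sum_verts_le)) _
    rw [Finset.mul_sum]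
    refine Finset.sum_le_sum fun α _ => ?_
    cases hS : m.str α with
    | none => simp
    | some S =>
      have hok := (h.ok α S hS).1
      simp only [Option.elim_some]
      refine hok.words_le.trans ?_
      have : S.verts.card ^ 2 ≤ B ^ 2 := Nat.pow_le_pow_left hok.card_le 2
      calc 21 * S.verts.card ^ 3 = 21 * S.verts.card ^ 2 * S.verts.card := by ring
        _ ≤ 21 * B ^ 2 * S.verts.card := by gcongr
  have h5 : ∑ α, (1 + 2 * (m.collected α).card) ≤ n * (1 + 2 * B ^ 2) := by
    refine (Finset.sum_le_card_nsmul _ _ (1 + 2 * B ^ 2) fun α _ => ?_).trans (by simp [hnn])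
    rcases (m.collected α).eq_empty_or_nonempty with h6 | ⟨e, he⟩
    · simp [h6]
    · obtain ⟨S, hS, -⟩ := hc α e he
      have h7 : (m.collected α).card ≤ S.verts.card ^ 2 := by
        refine Struct.card_le_sq_of_subset fun e he => ?_
        obtain ⟨S', hS', h8⟩ := hc α e he
        rwa [Option.some.inj (hS'.symm.trans hS)] at h8
      have h9 : S.verts.card ^ 2 ≤ B ^ 2 := Nat.pow_le_pow_left (h.ok α S hS).1.card_le 2
      omega
  unfold Mem.words
  have h6 : 1 ≤ B ^ 2 := Nat.one_le_pow _ _ hB1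
  have h7 : n ≤ B ^ 2 * n := Nat.le_mul_of_pos_left n h6
  have h8 : n * (1 + 2 * B ^ 2) = n + 2 * (B ^ 2 * n) := by ring
  have h9 : n + 21 * B ^ 2 * n = n + 21 * (B ^ 2 * n) := by ring
  have h10 : 38 * B ^ 2 * n = 38 * (B ^ 2 * n) := by ring
  omega

end Space

/-! ### The invariant at every point of the program -/

section Invariant

variable {V : Type*}

/-- The points of the program inside a phase. -/
def Point.InPhase : Point → Prop
  | .greedy | .phaseBegin | .finished => False
  | _ => True

/-- The points at which the sets of collected arcs may be nonempty. -/
def Point.Collecting : Point → Prop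
  | .collect | .contracting => True
  | _ => False

/-- The invariant of the memory. -/
structure MemInv (j : ℕ) (m : Mem V) : Prop where
  scale_pos : 1 ≤ m.scale
  scale_le : m.scale ≤ lastScale j
  phase_lt : m.phase < tMax j m.scale
  bundle_le : m.bundle ≤ tauMax j m.scale
  run : m.point.InPhase → m.Inv (ellMax j) (limit m.scale)
  idle : ¬ m.point.InPhase → IsMatching m.matching ∧ (∀ x, m.label x ≤ ellMax j + 1) ∧
    m.str = (fun _ => none) ∧ m.removed = ∅ ∧ m.paths = []
  coll : ∀ α, ∀ e ∈ m.collected α, ∃ S, m.str α = some S ∧ e.1 ∈ S.verts ∧ e.2 ∈ S.verts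
  coll_empty : ¬ m.point.Collecting → m.collected = fun _ => ∅

variable {j : ℕ} {m m' : Mem V} {g : V × V}

theorem two_le_limit (i : ℕ) : 2 ≤ limit i := by
  have := Nat.one_le_two_pow (n := i)
  unfold limit; omega

theorem tMax_pos (j i : ℕ) : 0 < tMax j i := by
  unfold tMax; positivity

/-- Between phases `PhaseInv` may fail, because free vertices have no structure. `Base` holds at all
times and suffices for the bounds on space and on structures. -/
theorem MemInv.base (h : MemInv j m) :
    Base (ellMax j) (limit m.scale) m.matching m.label m.str m.removed m.paths := by
  by_cases hp : m.point.InPhase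
  · exact (h.run hp).toBase
  · obtain ⟨h1, h2, h3, h4, h5⟩ := h.idle hp
    rw [h3, h4, h5]
    exact ⟨h1, by simp, by simp, by simp, by simp, h2, by simp, by simp⟩

theorem memInv_start : MemInv j (Mem.start : Mem V) := by
  refine ⟨le_rfl, by simp [Mem.start, lastScale], tMax_pos _ _, Nat.zero_le _, ?_, ?_, ?_, ?_⟩
  · simp [Mem.start, Point.InPhase]
  · simp [Mem.start, IsMatching]
  · simp [Mem.start]
  · simp [Mem.start]

/-- The memory changes only in the matching, the labels, the structures, the removed vertices
and the paths. -/
def SameControl (m m' : Mem V) : Prop :=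
  m'.point = m.point ∧ m'.scale = m.scale ∧ m'.phase = m.phase ∧ m'.bundle = m.bundle ∧
    m'.collected = m.collected

theorem Mem.Augment.sameControl (h : m.Augment g m') : SameControl m m' := by
  obtain ⟨S, T, -, -, ps, -, rfl⟩ := h
  exact ⟨rfl, rfl, rfl, rfl, rfl⟩

theorem MemInv.of_sameControl (h : MemInv j m) (hc : SameControl m m') (hp : m.point.InPhase)
    (hpc : ¬ m.point.Collecting) (hi : m'.Inv (ellMax j) (limit m.scale)) : MemInv j m' := by
  obtain ⟨h1, h2, h3, h4, h5⟩ := hc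
  refine ⟨by rw [h2]; exact h.scale_pos, by rw [h2]; exact h.scale_le,
    by rw [h2, h3]; exact h.phase_lt, by rw [h2, h4]; exact h.bundle_le,
    fun _ => by rw [h2]; exact hi, fun h6 => absurd hp (h1 ▸ h6), ?_, fun _ => ?_⟩
  · rw [h5, h.coll_empty hpc]; simp
  · rw [h5, h.coll_empty hpc]

theorem MemInv.endPass (h : MemInv j m) : MemInv j m.endPass := by
  unfold Mem.endPass
  split
  · next hp =>
    have hn : ¬ m.point.InPhase := by simp [hp, Point.InPhase]
    refine ⟨h.scale_pos, h.scale_le, h.phase_lt, h.bundle_le, ?_, fun _ => h.idle hn, h.coll,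
      fun _ => h.coll_empty (by simp [hp, Point.Collecting])⟩
    intro h1; simp [Point.InPhase] at h1
  · next hp =>
    have hin : m.point.InPhase := by simp [hp, Point.InPhase]
    refine ⟨h.scale_pos, h.scale_le, h.phase_lt, h.bundle_le, fun _ => h.run hin, ?_, by simp,
      fun _ => rfl⟩
    intro h1; simp [Point.InPhase] at h1
  · next hp =>
    have hin : m.point.InPhase := by simp [hp, Point.InPhase]
    refine ⟨h.scale_pos, h.scale_le, h.phase_lt, h.bundle_le, fun _ => h.run hin, ?_, h.coll, ?_⟩
    · intro h1; simp [Point.InPhase] at h1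
    · intro h1; simp [Point.Collecting] at h1
  · next hp =>
    have hin : m.point.InPhase := by simp [hp, Point.InPhase]
    refine ⟨h.scale_pos, h.scale_le, h.phase_lt, h.bundle_le, fun _ => h.run hin, ?_, h.coll,
      fun _ => h.coll_empty (by simp [hp, Point.Collecting])⟩
    intro h1; simp [Point.InPhase] at h1
  · exact h

theorem MemInv.beginBundle (h : MemInv j m) (hp : m.point = .bundleBegin) :
    MemInv j (m.beginBundle j) := by
  have hin : m.point.InPhase := by simp [hp, Point.InPhase]
  have hce := h.coll_empty (by simp [hp, Point.Collecting])
  unfold Mem.beginBundle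
  split_ifs with hb
  · refine ⟨h.scale_pos, h.scale_le, h.phase_lt, hb, fun _ => (h.run hin).mark, ?_, ?_,
      fun _ => hce⟩
    · intro h1; simp [Point.InPhase] at h1
    · intro α e he; simp [hce] at he
  · refine ⟨h.scale_pos, h.scale_le, h.phase_lt, h.bundle_le, fun _ => h.run hin, ?_, h.coll,
      fun _ => hce⟩
    intro h1; simp [Point.InPhase] at h1

theorem MemInv.backtrackAll (h : MemInv j m) (hp : m.point = .backtracking) :
    MemInv j m.backtrackAll := by
  have hin : m.point.InPhase := by simp [hp, Point.InPhase]
  have hce := h.coll_empty (by simp [hp, Point.Collecting])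
  refine ⟨h.scale_pos, h.scale_le, h.phase_lt, h.bundle_le, fun _ => (h.run hin).backtrack, ?_, ?_,
    fun _ => hce⟩
  · intro h1; simp [Mem.backtrackAll, Point.InPhase] at h1
  · intro α e he; simp [Mem.backtrackAll, hce] at he

/-- The end of a phase does not reset the counter of bundles, so its bound has to carry over to the
next scale. -/
theorem tauMax_mono (j : ℕ) {i i' : ℕ} (h : i ≤ i') : tauMax j i ≤ tauMax j i' := by
  unfold tauMax
  have := Nat.pow_le_pow_right (n := 2) (by norm_num) h
  gcongr

theorem Mem.AugmentArc.sameControl (h : m.AugmentArc g m') : SameControl m m' := by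
  unfold Mem.AugmentArc at h
  split_ifs at h
  · exact h.sameControl
  · subst h; exact ⟨rfl, rfl, rfl, rfl, rfl⟩

theorem MemInv.beginPhase (h : MemInv j m) (hp : m.point = .phaseBegin) :
    MemInv j (m.beginPhase j) := by
  have hn : ¬ m.point.InPhase := by simp [hp, Point.InPhase]
  obtain ⟨hM, -⟩ := h.idle hn
  have hni : ∀ x : V, ¬ Inner (ellMax j) (fun _ => ellMax j + 1) x := by
    intro x hx; exact absurd hx.2 (by simp)
  refine ⟨h.scale_pos, h.scale_le, h.phase_lt, Nat.zero_le _, fun _ => ?_, ?_, ?_, fun _ => rfl⟩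
  · have hstr : ∀ α S, (m.beginPhase j).str α = some S → m.Free α ∧ S = Struct.single α := by
      intro α S hS
      simp only [Mem.beginPhase] at hS
      split_ifs at hS with h1
      exact ⟨h1, (Option.some.inj hS).symm⟩
    refine ⟨⟨hM, ?_, ?_, ?_, ?_, ?_, ?_, ?_⟩, ?_, ?_⟩
    · intro α S hS
      obtain ⟨h1, rfl⟩ := hstr α S hS
      exact ⟨Struct.ok_single α h1 (hni α) (two_le_limit _), rfl⟩
    · intro α β S T hS hT hne
      obtain ⟨-, rfl⟩ := hstr α S hS
      obtain ⟨-, rfl⟩ := hstr β T hT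
      simpa [Struct.single] using hne
    · simp [Mem.beginPhase]
    · simp [Mem.beginPhase]
    · simp [Mem.beginPhase]
    · simp [Mem.beginPhase]
    · simp [Mem.beginPhase]
    · intro α hα
      exact Or.inr ⟨Struct.single α, if_pos hα⟩
    · intro x _ _; rfl
  · intro h1; simp [Mem.beginPhase, Point.InPhase] at h1
  · simp [Mem.beginPhase]

variable [Fintype V]

theorem Mem.ExtendArc.sameControl (h : m.ExtendArc g m') : SameControl m m' := by
  unfold Mem.ExtendArc at h
  split_ifs at h
  all_goals first
    | exact h.sameControl
    | (subst h; exact ⟨rfl, rfl, rfl, rfl, rfl⟩)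

theorem MemInv.read (h : MemInv j m) (hg : g.1 ≠ g.2) (hr : m.Read g m') :
    MemInv j m' ∧ m'.point = m.point ∧ m'.scale = m.scale ∧ m'.phase = m.phase ∧
      m'.bundle = m.bundle := by
  unfold Mem.Read at hr
  split at hr
  · next hp =>
    subst hr
    unfold Mem.greedyArc
    split_ifs with hf
    · refine ⟨⟨h.scale_pos, h.scale_le, h.phase_lt, h.bundle_le, ?_, ?_, h.coll, h.coll_empty⟩,
        rfl, rfl, rfl, rfl⟩
      · intro h1
        simp [hp, Point.InPhase] at h1
      · intro h1
        obtain ⟨h2, h3⟩ := h.idle h1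
        exact ⟨h2.insert hg hf.1 hf.2, h3⟩
    · exact ⟨h, rfl, rfl, rfl, rfl⟩
  · next hp =>
    have hin : m.point.InPhase := by simp [hp, Point.InPhase]
    have hc := Mem.ExtendArc.sameControl hr
    exact ⟨h.of_sameControl hc hin (by simp [hp, Point.Collecting])
      ((h.run hin).extendArc (two_le_limit _) hr), hc.1, hc.2.1, hc.2.2.1, hc.2.2.2.1⟩
  · next hp =>
    subst hr
    have hin : m.point.InPhase := by simp [hp, Point.InPhase]
    refine ⟨⟨h.scale_pos, h.scale_le, h.phase_lt, h.bundle_le, fun _ => h.run hin,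
      fun h1 => absurd hin h1, ?_, fun h1 => absurd ?_ h1⟩, rfl, rfl, rfl, rfl⟩
    · intro α e he
      simp only [Mem.collectArc] at he ⊢
      split_ifs at he with h1
      · rcases Finset.mem_insert.1 he with rfl | he
        · exact h1
        · exact h.coll α e he
      · exact h.coll α e he
    · simp [Mem.collectArc, hp, Point.Collecting]
  · next hp =>
    have hin : m.point.InPhase := by simp [hp, Point.InPhase]
    have hc := Mem.AugmentArc.sameControl hr
    exact ⟨h.of_sameControl hc hin (by simp [hp, Point.Collecting])
      ((h.run hin).augmentArc hr), hc.1, hc.2.1, hc.2.2.1, hc.2.2.2.1⟩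
  · exact hr.elim

theorem MemInv.contract_good (h : MemInv j m) (hp : m.point = .contracting) {α : V}
    (hc : m.Contractible α g) : ∃ S, m.str α = some S ∧ g.1 ∈ S.verts ∧ g.2 ∈ S.verts ∧
      S.top g.1 ≠ S.top g.2 ∧ (m.contract g).Inv (ellMax j) (limit m.scale) := by
  have hin : m.point.InPhase := by simp [hp, Point.InPhase]
  have hI := h.run hin
  obtain ⟨hg, S, hS, hw, hne, ho⟩ := hc
  obtain ⟨S', hS', h1, h2⟩ := h.coll α g hg
  obtain rfl := Option.some.inj (hS.symm.trans hS')
  have hok := (hI.ok α S hS).1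
  exact ⟨S, hS, h1, h2, hne.symm, hI.contract hS h1 h2 (hI.not_inner_of_working hS h1 hw)
    ((hok.good.outer_iff hok.root_not_inner h2).1 ho) hne.symm⟩

theorem MemInv.contractStep (h : MemInv j m) (hp : m.point = .contracting)
    (hs : m.ContractStep m') : MemInv j m' := by
  have hin : m.point.InPhase := by simp [hp, Point.InPhase]
  rcases hs with ⟨α, g, hc, rfl⟩ | ⟨-, rfl⟩
  · obtain ⟨S, hS, -, -, -, hI⟩ := h.contract_good hp hc
    refine ⟨h.scale_pos, h.scale_le, h.phase_lt, h.bundle_le, fun _ => hI,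
      fun h1 => absurd hin h1, ?_, h.coll_empty⟩
    intro β e he
    obtain ⟨R, hR, h1⟩ := h.coll β e he
    refine ⟨if g.1 ∈ R.verts then R.contract g else R, by simp [Mem.contract, hR], ?_⟩
    split_ifs
    · exact h1
    · exact h1
  · refine ⟨h.scale_pos, h.scale_le, h.phase_lt, h.bundle_le, fun _ => h.run hin, ?_, by simp,
      fun _ => rfl⟩
    intro h1; simp [Point.InPhase] at h1

theorem MemInv.endPhase (h : MemInv j m) (hp : m.point = .phaseEnd) : MemInv j (m.endPhase j) := by
  have hin : m.point.InPhase := by simp [hp, Point.InPhase]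
  have hI := h.run hin
  have hce := h.coll_empty (by simp [hp, Point.Collecting])
  have hn : ¬ (m.endPhase j).point.InPhase := by
    simp only [Mem.endPhase]; split_ifs <;> simp [Point.InPhase]
  have hsc : m.scale ≤ (m.endPhase j).scale ∧ (m.endPhase j).scale ≤ lastScale j := by
    have := h.scale_le
    simp only [Mem.endPhase]; split_ifs <;> omega
  refine ⟨h.scale_pos.trans hsc.1, hsc.2, ?_, h.bundle_le.trans (tauMax_mono j hsc.1),
    fun h1 => absurd h1 hn, fun _ => ⟨?_, h.base.label_le, rfl, rfl, rfl⟩, ?_, fun _ => hce⟩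
  · by_cases h1 : m.phase + 1 < tMax j m.scale
    · simp [Mem.endPhase, h1]
    · simp only [Mem.endPhase, if_neg h1]; exact tMax_pos _ _
  · exact isMatching_symmDiff hI.matching hI.path hI.paths_disj (by simp)
  · intro α e he; simp [Mem.endPhase, hce] at he

theorem MemInv.compute (h : MemInv j m) (hc : m.Compute j m') : MemInv j m' := by
  unfold Mem.Compute at hc
  split at hc
  · next hp => exact hc ▸ h.beginPhase hp
  · next hp => exact hc ▸ h.beginBundle hp
  · next hp => exact h.contractStep hp hc
  · next hp => exact hc ▸ h.backtrackAll hp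
  · next hp => exact hc ▸ h.endPhase hp
  · exact hc.elim

end Invariant

end EpsMM

namespace EpsMM

open scoped Classical

/-! ### Counting passes, progress and termination -/

section Executions

variable {V : Type*}

/-- The number of pass-bundles in the scales before `s`. -/
def bundlesBefore (j s : ℕ) : ℕ := ∑ i ∈ Finset.range s, tMax j i * tauMax j i

/-- A bound for the number of passes plus three; `x` is one inside a pass and zero otherwise. -/
def passBound (j : ℕ) (m : Mem V) (x : ℕ) : ℕ :=
  match m.point with
  | .greedy => 3 + x
  | .phaseBegin => 4 + 3 * (bundlesBefore j m.scale + m.phase * tauMax j m.scale)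
  | .bundleBegin | .backtracking | .phaseEnd =>
    4 + 3 * (bundlesBefore j m.scale + m.phase * tauMax j m.scale + m.bundle)
  | .extend => 1 + 3 * (bundlesBefore j m.scale + m.phase * tauMax j m.scale + m.bundle) + x
  | .collect => 2 + 3 * (bundlesBefore j m.scale + m.phase * tauMax j m.scale + m.bundle) + x
  | .contracting => 3 + 3 * (bundlesBefore j m.scale + m.phase * tauMax j m.scale + m.bundle)
  | .augmenting => 3 + 3 * (bundlesBefore j m.scale + m.phase * tauMax j m.scale + m.bundle) + x
  | .finished => 4 + 3 * bundlesBefore j (lastScale j + 1)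

theorem bundlesBefore_succ (j s : ℕ) :
    bundlesBefore j (s + 1) = bundlesBefore j s + tMax j s * tauMax j s :=
  Finset.sum_range_succ _ _

theorem bundlesBefore_mono (j : ℕ) {s s' : ℕ} (h : s ≤ s') :
    bundlesBefore j s ≤ bundlesBefore j s' :=
  Finset.sum_le_sum_of_subset (Finset.range_mono h)

/-- The invariant of a configuration. -/
structure ConfigInv (j : ℕ) (c : Config V) : Prop where
  mem : MemInv j c.mem
  stream : ∀ l, c.stream = some l → c.mem.point.UsesPass ∧ ∀ g ∈ l, g.1 ≠ g.2
  passes : c.passes + 3 ≤ passBound j c.mem (if c.stream.isSome then 1 else 0)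

/-- The pass-bundles that the phases up to the current one may execute. -/
theorem MemInv.bundles_le {j : ℕ} {m : Mem V} (h : MemInv j m) :
    bundlesBefore j m.scale + m.phase * tauMax j m.scale + m.bundle ≤
      bundlesBefore j m.scale + (m.phase + 1) * tauMax j m.scale := by
  have := h.bundle_le
  rw [Nat.add_mul, Nat.one_mul]
  omega

theorem MemInv.bundles_le_total {j : ℕ} {m : Mem V} (h : MemInv j m) :
    bundlesBefore j m.scale + (m.phase + 1) * tauMax j m.scale ≤
      bundlesBefore j (lastScale j + 1) := by
  have h1 : (m.phase + 1) * tauMax j m.scale ≤ tMax j m.scale * tauMax j m.scale :=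
    Nat.mul_le_mul_right _ h.phase_lt
  have h2 := bundlesBefore_succ j m.scale
  have h3 := bundlesBefore_mono j (Nat.succ_le_succ h.scale_le)
  simp only [Nat.succ_eq_add_one] at h3
  omega

theorem ConfigInv.passes_le {j : ℕ} {c : Config V} (h : ConfigInv j c) :
    c.passes ≤ 1 + 3 * bundlesBefore j (lastScale j + 1) := by
  have h1 := h.passes
  have h2 := h.mem.bundles_le
  have h3 := h.mem.bundles_le_total
  unfold passBound at h1
  split at h1 <;> (try split_ifs at h1) <;> omega

theorem IsEdgeStream.ne {G : SimpleGraph V} {l : List (V × V)} (hl : IsEdgeStream G l) {g : V × V}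
    (hg : g ∈ arcsOf l) : g.1 ≠ g.2 := by
  simp only [arcsOf, List.mem_flatMap, List.mem_cons, List.not_mem_nil, or_false] at hg
  obtain ⟨e, he, hg⟩ := hg
  have h1 : G.Adj e.1 e.2 := (hl.2 s(e.1, e.2)).1 (List.mem_map.2 ⟨e, he, rfl⟩)
  rcases hg with rfl | rfl
  · exact h1.ne
  · exact h1.ne.symm

theorem structure_bound_le (i j : ℕ) : limit i * (ellMax j + 2) ≤ 35 * (2 ^ i * 2 ^ j) := by
  have h1 := Nat.one_le_two_pow (n := i)
  have h2 := Nat.one_le_two_pow (n := j)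
  unfold limit ellMax
  calc (6 * 2 ^ i + 1) * (3 * 2 ^ j + 2) ≤ (7 * 2 ^ i) * (5 * 2 ^ j) := by gcongr <;> omega
    _ = _ := by ring

theorem two_pow_scale_le {i j : ℕ} (hi : i ≤ lastScale j) : 2 ^ i ≤ 64 * (2 ^ j) ^ 2 := by
  calc 2 ^ i ≤ 2 ^ lastScale j := Nat.pow_le_pow_right (by norm_num) hi
    _ = 64 * (2 ^ j) ^ 2 := by unfold lastScale; rw [pow_add, pow_mul']; ring

/-- A scale i has 144 * 72 * 4^i * 4^j bundles, and three times the sum of 4^i over i < s is at most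
4^s. -/
theorem bundlesBefore_le (j s : ℕ) : 3 * bundlesBefore j s ≤ 10368 * (2 ^ j) ^ 2 * 4 ^ s := by
  induction s with
  | zero => simp [bundlesBefore]
  | succ s ih =>
    rw [bundlesBefore_succ]
    have h1 : tMax j s * tauMax j s = 10368 * (2 ^ j) ^ 2 * 4 ^ s := by
      unfold tMax tauMax
      have : (4 : ℕ) ^ s = 2 ^ s * 2 ^ s := by rw [← mul_pow]; norm_num
      rw [this]; ring
    rw [h1, pow_succ 4 s]
    linarith

theorem ConfigInv.passes_le' {j : ℕ} {c : Config V} (h : ConfigInv j c) : c.passes ≤ 10 ^ 9 * (2 ^ j) ^ 6 := by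
  have h1 := h.passes_le
  have h2 := bundlesBefore_le j (lastScale j + 1)
  have h3 : 4 ^ (lastScale j + 1) = 16384 * ((2 : ℕ) ^ j) ^ 4 := by
    have : (4 : ℕ) = 2 ^ 2 := by norm_num
    unfold lastScale
    rw [this, ← pow_mul, ← pow_mul]
    have : 2 * (2 * j + 6 + 1) = 14 + j * 4 := by ring
    rw [this, pow_add]
    norm_num
  rw [h3] at h2
  have h4 : 10368 * ((2 : ℕ) ^ j) ^ 2 * (16384 * (2 ^ j) ^ 4) = 169869312 * (2 ^ j) ^ 6 := by ring
  have h5 : 1 ≤ ((2 : ℕ) ^ j) ^ 6 := Nat.one_le_pow _ _ (Nat.two_pow_pos j)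
  omega

/-- The operation has a result whether or not an expansion exists, so progress does not depend on
the alternating paths inside blossoms. -/
theorem Mem.exists_augment {m : Mem V} {g : V × V} {S T : Struct V}
    (hS : m.structOf g.1 = some S) (hT : m.structOf g.2 = some T) : ∃ m', m.Augment g m' := by
  by_cases h : ∃ P, m.IsExpansion S T g P
  · obtain ⟨P, hP⟩ := h
    exact ⟨_, S, T, hS, hT, _, Or.inl ⟨P, hP, rfl⟩, rfl⟩
  · exact ⟨_, S, T, hS, hT, _, Or.inr ⟨h, rfl⟩, rfl⟩

theorem Mem.exists_augmentArc (m : Mem V) (g : V × V) : ∃ m', m.AugmentArc g m' := by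
  unfold Mem.AugmentArc
  split_ifs with c
  · obtain ⟨⟨S, hS, -⟩, ⟨T, hT, -⟩, -⟩ := c
    exact exists_augment hS hT
  · exact ⟨_, rfl⟩

theorem Point.UsesPass.eq_or {p : Point} (h : p.UsesPass) :
    p = .greedy ∨ p = .extend ∨ p = .collect ∨ p = .augmenting := by
  cases p <;> simp_all [Point.UsesPass]

variable [Fintype V] {G : SimpleGraph V} {j : ℕ} {c c' : Config V}

theorem configInv_start : ConfigInv j (startConfig V) :=
  ⟨memInv_start, by simp [startConfig], by simp [startConfig, passBound, Mem.start]⟩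

/-- With N the bundles counted up to the current one, the three passes of a bundle raise the bound
from 1 + 3N to 4 + 3N, which is where bundle N + 1 starts. The offset three in `passes` avoids
truncated subtraction. -/
theorem ConfigInv.step (h : ConfigInv j c) (hs : Step G j c c') : ConfigInv j c' := by
  have hm := h.mem
  have hp := h.passes
  cases hs with
  | beginPass m k l hpt hl =>
    refine ⟨hm, ?_, ?_⟩
    · intro l' hl'
      obtain rfl := Option.some.inj hl'
      exact ⟨hpt, fun g hg => hl.ne hg⟩
    · simp only [Option.isSome_none, Option.isSome_some, passBound] at hp ⊢
      rcases hpt.eq_or with hq | hq | hq | hq <;> simp only [hq] at hp ⊢ <;> simp at hp ⊢ <;> omega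
  | read m m' k g l hr =>
    obtain ⟨h1, h2⟩ := h.stream _ rfl
    obtain ⟨h3, h4, h5, h6, h7⟩ := hm.read (h2 g List.mem_cons_self) hr
    refine ⟨h3, ?_, ?_⟩
    · intro l' hl'
      obtain rfl := Option.some.inj hl'
      exact ⟨by simpa [h4] using h1, fun g hg => h2 g (List.mem_cons_of_mem _ hg)⟩
    · simpa [passBound, h4, h5, h6, h7] using hp
  | endPass m k =>
    obtain ⟨h1, -⟩ := h.stream _ rfl
    refine ⟨hm.endPass, by simp, ?_⟩
    simp only [Option.isSome_none, Option.isSome_some, passBound] at hp ⊢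
    rcases h1.eq_or with hq | hq | hq | hq <;> simp only at hq <;>
      simp only [hq, Mem.endPass] at hp ⊢ <;> simp at hp ⊢ <;> omega
  | compute m m' k hc =>
    replace hm : MemInv j m := hm
    refine ⟨hm.compute hc, by simp, ?_⟩
    simp only [Option.isSome_none, passBound, Bool.false_eq_true, if_false] at hp ⊢
    unfold Mem.Compute at hc
    have h2 := hm.bundles_le
    have h3 := hm.bundles_le_total
    split at hc
    · next hq =>
      subst hc
      simp only [hq, Mem.beginPhase] at hp ⊢
      omega
    · next hq =>
      subst hc
      unfold Mem.beginBundle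
      split_ifs
      · simp only [hq] at hp ⊢
        omega
      · simp only [hq] at hp ⊢
        exact hp
    · next hq =>
      rcases hc with ⟨α, g, -, rfl⟩ | ⟨-, rfl⟩
      · simpa only [hq, Mem.contract] using hp
      · simpa [hq] using hp
    · next hq =>
      subst hc
      simpa only [hq, Mem.backtrackAll] using hp
    · next hq =>
      subst hc
      simp only [hq] at hp
      by_cases h4 : m.phase + 1 < tMax j m.scale
      · simp only [Mem.endPhase, if_pos h4, if_pos (Or.inl h4 : _ ∨ m.scale < lastScale j)]
        omega
      · by_cases h5 : m.scale < lastScale j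
        · simp only [Mem.endPhase, if_neg h4, if_pos h5, if_pos (Or.inr h5 : _ ∨ m.scale < _)]
          have h6 := bundlesBefore_succ j m.scale
          -- The scale is complete, so its bundles make up the next term of `bundlesBefore`.
          have h7 : m.phase + 1 = tMax j m.scale := by have := hm.phase_lt; omega
          rw [h7] at h2
          omega
        · simp only [Mem.endPhase, if_neg h4, if_neg h5, if_neg (not_or.2 ⟨h4, h5⟩)]
          omega
    · exact hc.elim

theorem Reachable.configInv (h : Reachable G j c) : ConfigInv j c := by
  induction h with
  | refl => exact configInv_start
  | tail _ hs ih => exact ih.step hs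

/-! ### No execution gets stuck -/

theorem exists_edgeStream (G : SimpleGraph V) : ∃ l, IsEdgeStream G l := by
  refine ⟨G.edgeFinset.toList.map Quot.out, ?_, ?_⟩
  all_goals
    have hid : (G.edgeFinset.toList.map Quot.out).map (fun e : V × V => s(e.1, e.2)) =
        G.edgeFinset.toList := by
      rw [List.map_map]
      convert List.map_id _
      funext e
      exact Quot.out_eq e
    rw [hid]
  · exact Finset.nodup_toList _
  · intro e
    rw [Finset.mem_toList, SimpleGraph.mem_edgeFinset]

theorem Mem.exists_extendArc (m : Mem V) (g : V × V) : ∃ m', m.ExtendArc g m' := by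
  unfold Mem.ExtendArc
  split_ifs with c1 c2 c3 c4 c5
  · exact ⟨_, rfl⟩
  · exact ⟨_, rfl⟩
  · exact ⟨_, rfl⟩
  · exact ⟨_, rfl⟩
  · rw [not_or, not_or, not_not] at c2
    obtain ⟨-, ⟨S, hS, -⟩, -⟩ := c2
    obtain ⟨T, hT, -⟩ := c4
    exact exists_augment hS hT
  · exact ⟨_, rfl⟩
  · exact ⟨_, rfl⟩

theorem Mem.exists_read {m : Mem V} (hp : m.point.UsesPass) (g : V × V) : ∃ m', m.Read g m' := by
  unfold Mem.Read
  rcases hp.eq_or with hq | hq | hq | hq <;> rw [hq]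
  · exact ⟨_, rfl⟩
  · exact m.exists_extendArc g
  · exact ⟨_, rfl⟩
  · exact m.exists_augmentArc g

theorem Mem.exists_compute {m : Mem V} (j : ℕ) (hp : ¬ m.point.UsesPass)
    (hf : m.point ≠ .finished) : ∃ m', m.Compute j m' := by
  unfold Mem.Compute
  cases hq : m.point
  case contracting =>
    simp only
    by_cases h : ∃ α g, m.Contractible α g
    · obtain ⟨α, g, h⟩ := h
      exact ⟨_, Or.inl ⟨α, g, h, rfl⟩⟩
    · exact ⟨_, Or.inr ⟨h, rfl⟩⟩
  all_goals first
    | exact ⟨_, rfl⟩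
    | exact absurd hq hf
    | exact absurd (by rw [hq]; trivial) hp

theorem ConfigInv.exists_step (h : ConfigInv j c) (hf : c.mem.point ≠ .finished) :
    ∃ c', Step G j c c' := by
  obtain ⟨m, k, s⟩ := c
  cases s with
  | none =>
    by_cases hp : m.point.UsesPass
    · obtain ⟨l, hl⟩ := exists_edgeStream G
      exact ⟨_, Step.beginPass m k l hp hl⟩
    · obtain ⟨m', hm'⟩ := Mem.exists_compute j hp hf
      exact ⟨_, Step.compute m m' k hm'⟩
  | some l =>
    cases l with
    | nil => exact ⟨_, Step.endPass m k⟩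
    | cons g l =>
      obtain ⟨m', hm'⟩ := Mem.exists_read (h.stream _ rfl).1 g
      exact ⟨_, Step.read m m' k g l hm'⟩

/-! ### Every execution is finite -/

/-- The number of stored blossoms. -/
def Mem.blossomCount (m : Mem V) : ℕ := ∑ α, ((m.str α).elim 0 fun S => S.blossoms.card)

/-- The new blossom contains two vertices from different nodes, so it was not stored before and the
count really increases. It stays below 2n because the invariant survives the contraction. -/
theorem MemInv.blossomCount_contract {m : Mem V} {g : V × V} {α : V} (h : MemInv j m)
    (hp : m.point = .contracting) (hc : m.Contractible α g) :
    m.blossomCount < (m.contract g).blossomCount ∧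
      (m.contract g).blossomCount ≤ 2 * Fintype.card V := by
  obtain ⟨S, hS, h1, h2, hne, hI⟩ := h.contract_good hp hc
  refine ⟨?_, hI.toBase.sum_blossoms_le⟩
  refine Finset.sum_lt_sum (fun β _ => ?_) ⟨α, Finset.mem_univ _, ?_⟩
  · cases hR : m.str β with
    | none => simp
    | some R =>
      simp only [Mem.contract, hR, Option.map_some, Option.elim_some]
      split_ifs
      · exact Finset.card_le_card (Finset.subset_insert _ _)
      · exact le_rfl
  · simp only [Mem.contract, hS, Option.map_some, Option.elim_some, if_pos h1]
    have hg := (h.base.ok α S hS).1.good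
    have hnew : S.newBlossom g ∉ S.blossoms := by
      intro hb
      have h3 := (hg.mem_newBlossom_iff (g := g) h1 h2).2 ⟨h1, Struct.left_mem_cycle⟩
      have h4 := (hg.mem_newBlossom_iff (g := g) h1 h2).2 ⟨h2, Struct.right_mem_cycle⟩
      exact hne (hg.part g.1 h1 g.2 (Struct.mem_top.2 ⟨_, hb, h3, h4⟩)).symm
    simp only [Struct.contract, Finset.card_insert_of_notMem hnew]
    exact Nat.lt_succ_self _

/-- The position in a phase, decreasing with time. -/
def phasePosition (j : ℕ) (m : Mem V) : ℕ :=
  match m.point with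
  | .greedy => 8 * tauMax j m.scale + 9
  | .phaseBegin => 8 * tauMax j m.scale + 8
  | .bundleBegin => 8 * (tauMax j m.scale - m.bundle) + 2
  | .extend => 8 * (tauMax j m.scale - m.bundle) + 7
  | .collect => 8 * (tauMax j m.scale - m.bundle) + 6
  | .contracting => 8 * (tauMax j m.scale - m.bundle) + 5
  | .augmenting => 8 * (tauMax j m.scale - m.bundle) + 4
  | .backtracking => 8 * (tauMax j m.scale - m.bundle) + 3
  | .phaseEnd => 1
  | .finished => 0

/-- The scales that are left. -/
def scalesLeft (j : ℕ) (m : Mem V) : ℕ :=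
  match m.point with
  | .finished => 0
  | _ => lastScale j + 1 - m.scale

/-- A quantity that decreases lexicographically in every step. -/
def rank (j : ℕ) (c : Config V) : ℕ ×ₗ ℕ ×ₗ ℕ ×ₗ ℕ ×ₗ ℕ :=
  toLex (scalesLeft j c.mem, toLex (tMax j c.mem.scale - c.mem.phase,
    toLex (phasePosition j c.mem, match c.stream with
      | none => toLex (1, 2 * Fintype.card V - c.mem.blossomCount)
      | some l => toLex (0, l.length))))

theorem rank_lt_of_position (h1 : scalesLeft j c'.mem = scalesLeft j c.mem)
    (h2 : c'.mem.scale = c.mem.scale) (h3 : c'.mem.phase = c.mem.phase)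
    (h4 : phasePosition j c'.mem < phasePosition j c.mem) : rank j c' < rank j c := by
  simp only [rank, Prod.Lex.toLex_lt_toLex]
  exact Or.inr ⟨h1, Or.inr ⟨by rw [h2, h3], Or.inl h4⟩⟩

/-- The fourth component is 1 outside the passes and 0 inside, so beginning a pass lowers it;
reading shortens the stream, and ending a pass lowers the position. A contraction keeps everything
but the last component. A position loses 8 per bundle, which exceeds the spread of the points within
a bundle. -/
theorem ConfigInv.rank_lt (h : ConfigInv j c) (hs : Step G j c c') : rank j c' < rank j c := by
  have hm := h.mem
  cases hs with
  | beginPass m k l hpt hl =>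
    simp only [rank, Prod.Lex.toLex_lt_toLex]
    exact Or.inr ⟨trivial, Or.inr ⟨trivial, Or.inr ⟨trivial, Or.inl Nat.zero_lt_one⟩⟩⟩
  | read m m' k g l hr =>
    obtain ⟨h1, h2⟩ := h.stream _ rfl
    obtain ⟨-, h4, h5, h6, h7⟩ := hm.read (h2 g List.mem_cons_self) hr
    simp only [rank, Prod.Lex.toLex_lt_toLex]
    refine Or.inr ⟨?_, Or.inr ⟨?_, Or.inr ⟨?_, Or.inr ⟨trivial, by simp⟩⟩⟩⟩
    · simp only [scalesLeft, h4, h5]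
    · simp only [h5, h6]
    · simp only [phasePosition, h4, h5, h7]
  | endPass m k =>
    obtain ⟨h1, -⟩ := h.stream _ rfl
    rcases h1.eq_or with hq | hq | hq | hq <;> simp only at hq <;>
      refine rank_lt_of_position ?_ ?_ ?_ ?_ <;> simp [Mem.endPass, hq, scalesLeft, phasePosition]
  | compute m m' k hc =>
    replace hm : MemInv j m := hm
    unfold Mem.Compute at hc
    split at hc
    · next hq =>
      subst hc
      refine rank_lt_of_position ?_ rfl rfl ?_ <;>
        simp [Mem.beginPhase, hq, scalesLeft, phasePosition]
    · next hq =>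
      subst hc
      unfold Mem.beginBundle
      split_ifs with hb
      · refine rank_lt_of_position ?_ rfl rfl ?_
        · simp [hq, scalesLeft]
        · simp only [phasePosition, hq]; omega
      · refine rank_lt_of_position ?_ rfl rfl ?_
        · simp [hq, scalesLeft]
        · simp only [phasePosition, hq]; omega
    · next hq =>
      rcases hc with ⟨α, g, hcon, rfl⟩ | ⟨-, rfl⟩
      · obtain ⟨h1, h2⟩ := MemInv.blossomCount_contract hm hq hcon
        have h3 : 2 * Fintype.card V - (m.contract g).blossomCount <
            2 * Fintype.card V - m.blossomCount := by
          omega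
        simp only [rank, Prod.Lex.toLex_lt_toLex]
        exact Or.inr ⟨rfl, Or.inr ⟨rfl, Or.inr ⟨rfl, Or.inr ⟨trivial, h3⟩⟩⟩⟩
      · refine rank_lt_of_position ?_ rfl rfl ?_ <;> simp [hq, scalesLeft, phasePosition]
    · next hq =>
      subst hc
      refine rank_lt_of_position ?_ rfl rfl ?_ <;>
        simp [Mem.backtrackAll, hq, scalesLeft, phasePosition]
    · next hq =>
      subst hc
      have hsc := hm.scale_le
      by_cases h4 : m.phase + 1 < tMax j m.scale
      · simp only [rank, Prod.Lex.toLex_lt_toLex]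
        refine Or.inr ⟨?_, Or.inl ?_⟩
        · simp [Mem.endPhase, h4, scalesLeft, hq]
        · simp only [Mem.endPhase, if_pos h4]; omega
      · simp only [rank, Prod.Lex.toLex_lt_toLex]
        left
        by_cases h5 : m.scale < lastScale j
        · simp only [Mem.endPhase, if_neg h4, if_pos h5, if_pos (Or.inr h5 : _ ∨ m.scale < _),
            scalesLeft, hq]
          omega
        · simp only [Mem.endPhase, if_neg h4, if_neg h5, if_neg (not_or.2 ⟨h4, h5⟩),
            scalesLeft, hq]
          omega
    · exact hc.elim

theorem no_infinite_execution (G : SimpleGraph V) (j : ℕ) :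
    ¬ ∃ f : ℕ → Config V, f 0 = startConfig V ∧ ∀ i, Step G j (f i) (f (i + 1)) := by
  rintro ⟨f, hf0, hf⟩
  have hinv : ∀ i, ConfigInv j (f i) := by
    intro i
    induction i with
    | zero => rw [hf0]; exact configInv_start
    | succ i ih => exact ih.step (hf i)
  obtain ⟨n, hn⟩ := WellFounded.not_rel_apply_succ (r := (· < ·)) fun i => rank j (f i)
  exact hn ((hinv n).rank_lt (hf n))

/-! ### Numerical bounds -/

theorem MemInv.words_le {m : Mem V} [Nonempty V] (h : MemInv j m) :
    m.words ≤ 10 ^ 9 * (2 ^ j) ^ 6 * Fintype.card V := by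
  have h1 := EpsMM.words_le h.base Fintype.card_pos
    ((by norm_num : 1 ≤ 2).trans (two_le_limit m.scale)) h.coll
  refine h1.trans (Nat.mul_le_mul_right _ ?_)
  have h2 := structure_bound_le m.scale j
  have h3 : 35 * (2 ^ m.scale * 2 ^ j) ≤ 35 * (64 * (2 ^ j) ^ 2 * 2 ^ j) := by
    gcongr; exact two_pow_scale_le h.scale_le
  calc 38 * (limit m.scale * (ellMax j + 2)) ^ 2
      ≤ 38 * (35 * (64 * (2 ^ j) ^ 2 * 2 ^ j)) ^ 2 := 
        Nat.mul_le_mul_left 38 (Nat.pow_le_pow_left (h2.trans h3) 2)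
    _ = 190668800 * (2 ^ j) ^ 6 := by ring
    _ ≤ 10 ^ 9 * (2 ^ j) ^ 6 := by gcongr; norm_num

theorem MemInv.maxNumber_le {m : Mem V} (h : MemInv j m) :
    m.maxNumber ≤ 10 ^ 9 * (2 ^ j) ^ 3 := by
  have hq : 1 ≤ 2 ^ j := Nat.one_le_two_pow
  -- Needed only for the counter of scales, which is linear in j; the other numbers are already
  -- powers of two up to constants.
  have hj : j < 2 ^ j := Nat.lt_two_pow_self
  have hi := two_pow_scale_le h.scale_le
  have h3 : 2 ^ j ≤ (2 ^ j) ^ 3 := Nat.le_self_pow (by norm_num) _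
  have h4 : 2 ^ m.scale * 2 ^ j ≤ 64 * (2 ^ j) ^ 3 := by
    calc 2 ^ m.scale * 2 ^ j ≤ 64 * (2 ^ j) ^ 2 * 2 ^ j := by gcongr
      _ = _ := by ring
  have hs := h.scale_le
  have hp := h.phase_lt
  have hb := h.bundle_le
  unfold lastScale at hs
  unfold tMax at hp
  unfold tauMax at hb
  rw [mul_assoc] at hp hb
  unfold Mem.maxNumber
  refine max_le (max_le ?_ ?_) (max_le ?_ (Finset.sup_le fun x _ => ?_))
  · omega
  · omega
  · omega
  · have := h.base.label_le x
    unfold ellMax at this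
    omega

end Executions

end EpsMM

theorem mainTheorem3 :
    ∃ C : ℝ, 0 < C ∧
      ∀ (V : Type*) [Fintype V] [Nonempty V] (G : SimpleGraph V) (j : ℕ) (ε : ℝ),
        ε = 1 / 2 ^ j →
        -- every execution is finite
        (¬ ∃ f : ℕ → EpsMM.Config V, f 0 = EpsMM.startConfig V ∧
          ∀ i, EpsMM.Step G j (f i) (f (i + 1))) ∧
        ∀ c : EpsMM.Config V, EpsMM.Reachable G j c →
          -- an execution stops only when the algorithm has finished
          (c.mem.point ≠ EpsMM.Point.finished → ∃ c', EpsMM.Step G j c c') ∧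
          -- the number of passes
          (c.passes : ℝ) ≤ C / ε ^ 6 ∧
          -- the space in words, and the numbers that a word has to hold
          (c.mem.words : ℝ) ≤ C * Fintype.card V / ε ^ 6 ∧
          (c.mem.maxNumber : ℝ) ≤ C / ε ^ 3 ∧
          -- the size of the structures in the scale h
          ∀ h : ℝ, h = 1 / 2 ^ c.mem.scale →
            ∀ (α : V) (S : EpsMM.Struct V), c.mem.str α = some S →
              (S.verts.card : ℝ) ≤ C / (h * ε) := by
  -- One constant for all bounds: the computed ones are 169869312 (plus one) for the passes,
  -- 190668800 for the words, 144 * 64 for the largest counter and 35 for the structures.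
  refine ⟨10 ^ 9, by norm_num, ?_⟩
  intro V _ _ G j ε hε
  refine ⟨EpsMM.no_infinite_execution G j, fun c hc => ?_⟩
  have hinv := hc.configInv
  have hdiv : ∀ (a : ℝ) (k : ℕ), a / ε ^ k = a * (2 ^ j) ^ k := by
    intro a k
    rw [hε, one_div, inv_pow, div_inv_eq_mul]
  refine ⟨fun hf => hinv.exists_step hf, ?_, ?_, ?_, ?_⟩
  · rw [hdiv]
    exact_mod_cast hinv.passes_le'
  · rw [hdiv]
    have := hinv.mem.words_le
    calc (c.mem.words : ℝ) ≤ ((10 ^ 9 * (2 ^ j) ^ 6 * Fintype.card V : ℕ) : ℝ) := by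
          exact_mod_cast this
      _ = _ := by push_cast; ring
  · rw [hdiv]
    exact_mod_cast hinv.mem.maxNumber_le
  · intro h hh α S hS
    have h1 := ((hinv.mem.base.ok α S hS).1.card_le).trans
      (EpsMM.structure_bound_le c.mem.scale j)
    have h2 : (10 : ℝ) ^ 9 / (h * ε) = 10 ^ 9 * (2 ^ c.mem.scale * 2 ^ j) := by
      rw [hh, hε, div_mul_div_comm, one_mul, one_div, div_inv_eq_mul]
    rw [h2]
    calc (S.verts.card : ℝ) ≤ ((35 * (2 ^ c.mem.scale * 2 ^ j) : ℕ) : ℝ) := by exact_mod_cast h1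
      _ = 35 * (2 ^ c.mem.scale * 2 ^ j) := by push_cast; ring
      _ ≤ 10 ^ 9 * (2 ^ c.mem.scale * 2 ^ j) := by gcongr; norm_num
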